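/- Let $\Theta\subseteq\mathbb R$ with $0\in\Theta$, and let $\mathcal G=\{g(\cdot;\theta):\theta\in\Theta\}$ be a family of probability densities on $\mathbb R$, with distribution functions $G(\cdot;\theta)$ and laws $P_\theta$, such that $G(\cdot;\theta)$ is symmetric with respect to zero (that is, $1-G(x;\theta)-G(-x;\theta)=0$ for all $x$) if and only if $\theta=0$. Put $F=G(\cdot;0)$. For an i.i.d. sample $X_1,\dots,X_n$ let $$J_n=\binom n3^{-1}\sum_{1\le i<j<k\le n}\Phi(X_i,X_j,X_k),\qquad \widetilde J_n=\sqrt{n|J_n|},$$ $$\Phi(x_1,x_2,x_3)=\frac1{3!}\sum_{\pi}\Big(\mathrm I\{|x_{\pi(1)}-x_{\pi(2)}|<|x_{\pi(3)}|\}-\mathrm I\{|x_{\pi(1)}+x_{\pi(2)}|<|x_{\pi(3)}|\}\Big),$$ where $\pi$ runs over the permutations of $\{1,2,3\}$. Let $\mathcal J_F$ be the integral operator on $L^2(F)$, $\mathcal J_F[v](x)=\int\varphi_F(x,y)v(y)\,dF(y)$, with kernel $\varphi_F(s,t)=\frac23\big(F(|s+t|)-F(|s-t|)\big)$. A sequence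 of statistics $T_n=T_n(X_1,\dots,X_n)$ is said to have approximate Bahadur slope $c^*_T(\theta)=a_T\,b_T(\theta)^2$ at $\theta\ne0$ if under $P_0$ it converges in distribution to a non-degenerate law with distribution function $F_T$ satisfying $\log(1-F_T(t))=-\frac{a_Tt^2}{2}(1+o(1))$ as $t\to\infty$ for some $a_T>0$, and $T_n/\sqrt n\to b_T(\theta)>0$ in $P_\theta$-probability. Then $\mathcal J_F$ has a largest eigenvalue $\nu_1$, and $\nu_1>0$; for every $\theta\in\Theta\setminus\{0\}$ the limit $b_J(\theta)$ of $J_n$ in $P_\theta$-probability exists; and whenever $b_J(\theta)\neq0$, the approximate Bahadur slope of $\widetilde J_n$ at $\theta$ exists, is unique, and equals $$c^*_{\widetilde J}(\theta)=\frac{|b_J(\theta)|}{3\nu_1}$$ (which is $b_J(\theta)/(3\nu_1)$ when $b_J(\theta)>0$). In particular, if the slope exists for all $\theta\ne0$ in $\Theta$ close to $0$, then $c^*_{\widetilde J}(\theta)\sim |b_J(\theta)|/(3\nu_1)$ as $\theta\to0$. -/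

import Mathlib

open MeasureTheory ProbabilityTheory Filter Asymptotics
open scoped Topology

noncomputable section

/-- The kernel `I{|x₀ - x₁| < |x₂|} - I{|x₀ + x₁| < |x₂|}` before symmetrization. -/
def rawKernel (x : Fin 3 → ℝ) : ℝ :=
  (if |x 0 - x 1| < |x 2| then 1 else 0) - (if |x 0 + x 1| < |x 2| then 1 else 0)

/-- The symmetrized kernel `Φ` of degree three. -/
def symKernel (x : Fin 3 → ℝ) : ℝ :=
  (1 / (Nat.factorial 3 : ℝ)) * ∑ π : Equiv.Perm (Fin 3), rawKernel (fun i => x (π i))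

/-- The U-statistic `J_n`. -/
def statJ (n : ℕ) (x : Fin n → ℝ) : ℝ :=
  ((n.choose 3 : ℝ))⁻¹ *
    ∑ i : Fin n, ∑ j ∈ Finset.Ioi i, ∑ k ∈ Finset.Ioi j, symKernel ![x i, x j, x k]

/-- The statistic `J̃_n = √(n |J_n|)`. -/
def statJTilde (n : ℕ) (x : Fin n → ℝ) : ℝ :=
  Real.sqrt (n * |statJ n x|)

/-- The second projection `φ_F(s,t) = (2/3) (F(|s+t|) - F(|s-t|))`, for a d.f. `F`. -/
def phi (F : ℝ → ℝ) (s t : ℝ) : ℝ :=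
  2 / 3 * (F |s + t| - F |s - t|)

/-- The integral operator with kernel `K` with respect to `μ`, applied to a function `v`. -/
def integralOp (K : ℝ → ℝ → ℝ) (μ : Measure ℝ) (v : ℝ → ℝ) (x : ℝ) : ℝ :=
  ∫ y, K x y * v y ∂μ

/-- The eigenvalues, on `L²(μ)`, of the integral operator with kernel `K`. -/
def integralOpEigenvalues (K : ℝ → ℝ → ℝ) (μ : Measure ℝ) : Set ℝ :=
  {ν | ∃ v : Lp ℝ 2 μ, v ≠ 0 ∧ integralOp K μ v =ᵐ[μ] fun x => ν * v x}

/-- The law of an infinite i.i.d. sample `X_1, X_2, …` from `P`, on the space of sequences. -/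
def sampleLaw (P : ProbabilityMeasure ℝ) : Measure (ℕ → ℝ) :=
  Measure.infinitePi fun _ : ℕ => (P : Measure ℝ)

instance (P : ProbabilityMeasure ℝ) : IsProbabilityMeasure (sampleLaw P) := by
  unfold sampleLaw; infer_instance

/-- The random variable `T_n(X_1, …, X_n)` on the space of infinite samples. -/
def evalStat (T : (n : ℕ) → (Fin n → ℝ) → ℝ) (n : ℕ) (ω : ℕ → ℝ) : ℝ :=
  T n fun i => ω i

/-- `c` is the approximate Bahadur slope of the sequence of statistics `T`, for the null law `P₀`
and the alternative law `P₁`: under `P₀`, `T_n` converges in distribution to a non-degenerate law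
`Q` with `log (1 - F_Q(t)) = -(a t² / 2) (1 + o(1))` as `t → ∞`; under `P₁`, `T_n / √n` converges in
probability to `b > 0`; and `c = a b²`. -/
def IsApproxBahadurSlope (T : (n : ℕ) → (Fin n → ℝ) → ℝ) (P₀ P₁ : ProbabilityMeasure ℝ)
    (c : ℝ) : Prop :=
  ∃ (Q : ProbabilityMeasure ℝ) (a b : ℝ),
    TendstoInDistribution (evalStat T) atTop (id : ℝ → ℝ) (fun _ => sampleLaw P₀) (Q : Measure ℝ) ∧
    (∀ z : ℝ, (Q : Measure ℝ) ≠ Measure.dirac z) ∧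
    0 < a ∧
    (fun t : ℝ => Real.log (1 - cdf (Q : Measure ℝ) t)) ~[atTop] (fun t : ℝ => -(a * t ^ 2 / 2)) ∧
    TendstoInMeasure (sampleLaw P₁) (fun (n : ℕ) ω => evalStat T n ω / Real.sqrt n) atTop
      (fun _ => b) ∧
    0 < b ∧
    c = a * b ^ 2

/-- A one-parameter family of probability densities `g(x; θ)`, `θ ∈ Θ ⊆ ℝ`, `0 ∈ Θ`, whose d.f.
`G(x; θ)` is symmetric with respect to zero only for `θ = 0`. -/
structure AlternativeFamily where
  Θ : Set ℝ
  zero_mem : (0 : ℝ) ∈ Θ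
  g : ℝ → Θ → ℝ
  measurable_g : ∀ θ, Measurable fun x => g x θ
  g_nonneg : ∀ x θ, 0 ≤ g x θ
  lintegral_g : ∀ θ, ∫⁻ x, ENNReal.ofReal (g x θ) = 1
  symmetric_iff : ∀ θ : Θ,
    (∀ x : ℝ,
      1 - cdf (volume.withDensity fun y => ENNReal.ofReal (g y θ)) x
        - cdf (volume.withDensity fun y => ENNReal.ofReal (g y θ)) (-x) = 0) ↔ (θ : ℝ) = 0

namespace AlternativeFamily

/-- The parameter `θ = 0` of the null distribution. -/
def null (𝒢 : AlternativeFamily) : 𝒢.Θ := ⟨0, 𝒢.zero_mem⟩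

/-- The probability law `P_θ` with density `g(·; θ)`. -/
def law (𝒢 : AlternativeFamily) (θ : 𝒢.Θ) : ProbabilityMeasure ℝ :=
  ⟨volume.withDensity fun y => ENNReal.ofReal (𝒢.g y θ), ⟨by
    rw [withDensity_apply _ MeasurableSet.univ, Measure.restrict_univ]
    exact 𝒢.lintegral_g θ⟩⟩

/-- The null distribution function `F(x) = G(x; 0)`. -/
def nullCdf (𝒢 : AlternativeFamily) : ℝ → ℝ := fun x => cdf (𝒢.law 𝒢.null : Measure ℝ) x

end AlternativeFamily

end

/-! Under a symmetric atomless null law, `Φ` is centred and its first projection vanishes, while its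
second projection is `phi F`. The Hoeffding decomposition therefore gives `n J_n = 6/(n-1) ∑ φ(X_i,
X_j)` over pairs, plus a completely degenerate remainder that tends to zero in `L²`
(`integral_sq_remainder_le`). The kernel is Hilbert–Schmidt. Truncating its expansion `∑ ν_i e_i(x)
e_i(y)`, applying the multivariate central limit theorem to the sums of the `e_i(X_k)`, and letting
the truncation grow yields `n J_n → Y = ∑ 3 ν_i (Z_i² - 1)` with independent standard Gaussian `Z_i`
(`tendstoInDistribution_mul_statJ`).

The tail of `√|Y|` is governed by the largest coefficient: `log P(√|Y| > t) ~ -t² / (2 · 3ν₁)`, so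
`a = 1/(3ν₁)`. The upper bound is a Chernoff bound, and the lower bound isolates one Gaussian
coordinate belonging to `ν₁`. Because the absolute value of `Y` enters, negative eigenvalues matter
too, so `|ν_i| ≤ ν₁` is needed. This holds because `φ(x, y)` has the sign of `x y`: after
multiplication by the signs of the variables the kernel is nonnegative, which makes the operator
norm itself an eigenvalue (`isGreatest_integralOpEigenvalues_norm`, `abs_phi_le`).

Under an alternative, the weak law of large numbers for U-statistics gives `J_n → b`, hence `T_n/√n
= √|J_n| → √|b|`, and the slope is `a · |b|`. Uniqueness of limits in distribution and in measure
makes the slope unique. -/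

/-! ### Compact symmetric operators on a Hilbert space -/

theorem exists_hilbertBasis_eigenvectors {E : Type*} [NormedAddCommGroup E]
    [InnerProductSpace ℝ E] [CompleteSpace E] {T : E →L[ℝ] E} (hT : IsCompactOperator T)
    (hT' : T.IsSymmetric) :
    ∃ (s : Set E) (b : HilbertBasis s ℝ E) (ν : s → ℝ), ∀ i, T (b i) = ν i • b i := by
  have hEig : OrthogonalFamily ℝ (fun μ => Module.End.eigenspace (T : Module.End ℝ E) μ) fun μ =>
    (Module.End.eigenspace (T : Module.End ℝ E) μ).subtypeₗᵢ :=
    LinearMap.IsSymmetric.orthogonalFamily_eigenspaces hT'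
  have hcl : ∀ μ : ℝ, IsClosed (Module.End.eigenspace (T : Module.End ℝ E) μ : Set E) := by
    intro μ
    have : (Module.End.eigenspace (T : Module.End ℝ E) μ : Set E) = {x | T x = μ • x} := by
      ext x; simp
    rw [this]
    exact isClosed_eq T.continuous (continuous_const_smul μ)
  have hcomp : ∀ μ : ℝ, CompleteSpace (Module.End.eigenspace (T : Module.End ℝ E) μ) :=
    fun μ => (hcl μ).completeSpace_coe
  have hb : ∀ μ : ℝ, ∃ (w : Set (Module.End.eigenspace (T : Module.End ℝ E) μ))
      (b : HilbertBasis w ℝ (Module.End.eigenspace (T : Module.End ℝ E) μ)),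
      ⇑b = ((↑) : w → Module.End.eigenspace (T : Module.End ℝ E) μ) :=
    fun μ => exists_hilbertBasis _ _
  choose w b hwb using hb
  have hon := hEig.orthonormal_sigma_orthonormal (α := fun μ => w μ) (v_family := fun μ => b μ)
    fun μ => (b μ).orthonormal
  -- A vector orthogonal to the chosen bases is orthogonal to every eigenspace, since each element
  -- of an eigenspace is the sum of its expansion. Eigenspaces of a compact symmetric operator, the
  -- kernel included, have trivial common orthogonal complement.
  have hspan : (Submodule.span ℝ (Set.range fun a : Σ μ : ℝ, w μ => ((b a.1 a.2 : _) : E)))ᗮ = ⊥ := by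
    rw [Submodule.eq_bot_iff]
    intro x hx
    have hx' : ∀ (μ : ℝ) (i : w μ), inner ℝ ((b μ i : _) : E) x = 0 := fun μ i =>
      (Submodule.mem_orthogonal _ _).1 hx _ (Submodule.subset_span ⟨⟨μ, i⟩, rfl⟩)
    have : x ∈ (⨆ μ, Module.End.eigenspace (T : Module.End ℝ E) μ)ᗮ := by
      rw [← Submodule.iInf_orthogonal, Submodule.mem_iInf]
      intro μ
      rw [Submodule.mem_orthogonal]
      intro u hu
      have h1 := ((b μ).hasSum_repr ⟨u, hu⟩).mapL
        ((innerSL ℝ x).comp (Module.End.eigenspace (T : Module.End ℝ E) μ).subtypeL)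
      have h2 : (fun i => ((innerSL ℝ x).comp
          (Module.End.eigenspace (T : Module.End ℝ E) μ).subtypeL)
          ((b μ).repr ⟨u, hu⟩ i • b μ i)) = fun _ => 0 := by
        funext i
        have := hx' μ i
        rw [real_inner_comm] at this
        simp [this]
      rw [h2] at h1
      have h3 := h1.unique hasSum_zero
      rw [real_inner_comm]
      simpa using h3
    rwa [ContinuousLinearMap.orthogonalComplement_iSup_eigenspaces_eq_bot hT hT',
      Submodule.mem_bot] at this
  let B := HilbertBasis.mkOfOrthogonalEqBot hon hspan
  have hB : ⇑B = fun a : Σ μ : ℝ, w μ => ((b a.1 a.2 : _) : E) :=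
    HilbertBasis.coe_mkOfOrthogonalEqBot hon hspan
  have hTB : ∀ a, T (B a) = a.1 • B a := by
    intro a
    rw [hB]
    exact Module.End.mem_eigenspace_iff.1 (b a.1 a.2).2
  have hr := B.orthonormal.toSubtypeRange
  have hsr : (Submodule.span ℝ (Set.range (Subtype.val : Set.range B → E)))ᗮ = ⊥ := by
    rw [Subtype.range_coe, hB]; exact hspan
  have hex : ∀ i : Set.range B, ∃ ν : ℝ, T i = ν • (i : E) := by
    rintro ⟨_, a, rfl⟩
    exact ⟨a.1, hTB a⟩
  choose ν hν using hex
  refine ⟨Set.range B, HilbertBasis.mkOfOrthogonalEqBot hr hsr, ν, fun i => ?_⟩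
  rw [HilbertBasis.coe_mkOfOrthogonalEqBot]
  exact hν i

/-- Distinct vectors of the family are at distance `√2`, so the balls of radius `1/2` around them
are disjoint. Countability is what allows sums over a basis to be exchanged with integrals. -/
theorem Orthonormal.countable_of_secondCountable {E ι : Type*} [NormedAddCommGroup E]
    [InnerProductSpace ℝ E] [SecondCountableTopology E] {v : ι → E} (hv : Orthonormal ℝ v) :
    Countable ι := by
  have hdist : ∀ i j, i ≠ j → 1 ≤ dist (v i) (v j) := by
    intro i j hij
    rw [dist_eq_norm]
    have h1 : ‖v i - v j‖ ^ 2 = 2 := by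
      rw [norm_sub_sq_real, hv.1 i, hv.1 j, hv.2 hij]; norm_num
    nlinarith [norm_nonneg (v i - v j)]
  have hd : Set.PairwiseDisjoint (Set.univ : Set ι) (fun i => Metric.ball (v i) (1 / 2)) := by
    intro i _ j _ hij
    exact Metric.ball_disjoint_ball (by linarith [hdist i j hij])
  have := hd.countable_of_isOpen (fun i _ => Metric.isOpen_ball)
    (fun i _ => ⟨v i, Metric.mem_ball_self (by norm_num)⟩)
  exact Set.countable_univ_iff.1 this

/-- A compact symmetric operator whose quadratic form is dominated in absolute value by its
positive part has its norm as an eigenvalue. -/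
theorem hasEigenvalue_norm_of_abs_inner_le {E : Type*} [NormedAddCommGroup E]
    [InnerProductSpace ℝ E] [CompleteSpace E] {T : E →L[ℝ] E} (hT : IsCompactOperator T)
    (hT' : T.IsSymmetric) (h0 : T ≠ 0)
    (hpos : ∀ v, ∃ w, ‖w‖ = ‖v‖ ∧ |inner ℝ (T v) v| ≤ inner ℝ (T w) w) :
    Module.End.HasEigenvalue (T : Module.End ℝ E) ‖T‖ := by
  have hn : 0 < ‖T‖ := norm_pos_iff.2 h0
  have hnt : Nontrivial E := by
    by_contra h
    rw [not_nontrivial_iff_subsingleton] at h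
    exact h0 (Subsingleton.elim _ _)
  rw [hT.hasEigenvalue_iff_mem_spectrum hn.ne']
  by_contra hc
  -- If `‖T‖` were in the resolvent set, the Rayleigh quotient would stay below `‖T‖ - ε`. By `hpos`
  -- so would its absolute value, whose supremum is `‖T‖` for a symmetric operator.
  have hres : algebraMap ℝ ℝ ‖T‖ ∈ resolventSet ℝ T := by
    simpa [spectrum] using hc
  obtain ⟨ε, hε, h⟩ := T.rayleighQuotient_le_of_norm_mem_resolventSet hres
  have habs : ∀ x, |T.rayleighQuotient x| ≤ ‖T‖ - ε := by
    intro x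
    obtain ⟨w, hw, hle⟩ := hpos x
    refine le_trans ?_ (h w)
    simp only [ContinuousLinearMap.rayleighQuotient, ContinuousLinearMap.reApplyInnerSelf_apply,
      hw, abs_div, RCLike.re_to_real]
    rw [abs_of_nonneg (sq_nonneg ‖x‖)]
    gcongr
  have := ContinuousLinearMap.norm_eq_iSup_rayleighQuotient T hT'
  have h2 : ⨆ x, |T.rayleighQuotient x| ≤ ‖T‖ - ε := ciSup_le habs
  linarith

/-! ### Integral operators with bounded kernels -/

structure IsBoundedKernel (K : ℝ → ℝ → ℝ) (C : ℝ) : Prop where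
  measurable : Measurable (Function.uncurry K)
  bound : ∀ x y, |K x y| ≤ C

namespace IsBoundedKernel

variable {K : ℝ → ℝ → ℝ} {C : ℝ} (hK : IsBoundedKernel K C)
  (μ : Measure ℝ) [IsProbabilityMeasure μ]

include hK

theorem measurable_section (x : ℝ) : Measurable (K x) :=
  hK.measurable.comp measurable_prodMk_left

theorem memLp_section (x : ℝ) : MemLp (K x) 2 μ :=
  MemLp.of_bound (hK.measurable_section x).aestronglyMeasurable C
    (.of_forall fun y => by simpa using hK.bound x y)

theorem integrable_prod : Integrable (Function.uncurry K) (μ.prod μ) :=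
  Integrable.of_bound hK.measurable.aestronglyMeasurable C
    (.of_forall fun y => hK.bound y.1 y.2)

theorem sq : IsBoundedKernel (fun x y => K x y ^ 2) (C ^ 2) where
  measurable := hK.measurable.pow_const 2
  bound x y := by
    rw [abs_pow]
    exact pow_le_pow_left₀ (abs_nonneg _) (hK.bound x y) 2

/-- The section `K x ·` as an element of `L²`. -/
noncomputable def sectionLp (x : ℝ) : Lp ℝ 2 μ := (hK.memLp_section μ x).toLp

theorem inner_sectionLp (x : ℝ) (v : Lp ℝ 2 μ) :
    inner ℝ (hK.sectionLp μ x) v = integralOp K μ v x := by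
  rw [L2.inner_def, integralOp]
  refine integral_congr_ae ?_
  filter_upwards [(hK.memLp_section μ x).coeFn_toLp] with y hy
  rw [sectionLp, hy]
  simp [mul_comm]

theorem norm_sectionLp_sq (x : ℝ) : ‖hK.sectionLp μ x‖ ^ 2 = ∫ y, K x y ^ 2 ∂μ := by
  rw [← real_inner_self_eq_norm_sq, inner_sectionLp, integralOp]
  refine integral_congr_ae ?_
  filter_upwards [(hK.memLp_section μ x).coeFn_toLp] with y hy
  rw [sectionLp, hy]
  ring

theorem measurable_integralOp (v : Lp ℝ 2 μ) : Measurable (integralOp K μ v) := by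
  have : StronglyMeasurable (Function.uncurry fun x y => K x y * v y) :=
    hK.measurable.stronglyMeasurable.mul
      ((Lp.stronglyMeasurable v).comp_measurable measurable_snd)
  exact (this.integral_prod_right (ν := μ)).measurable

theorem norm_sectionLp_le (x : ℝ) : ‖hK.sectionLp μ x‖ ≤ |C| := by
  refine abs_le_of_sq_le_sq' ?_ (abs_nonneg C) |>.2
  rw [norm_sectionLp_sq, sq_abs]
  refine (integral_mono_of_nonneg (.of_forall fun y => sq_nonneg _) (integrable_const (C ^ 2))
    (.of_forall fun y => ?_)).trans (by simp)
  have := (hK.sq.bound x y)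
  exact (le_abs_self _).trans this

theorem abs_integralOp_le (v : Lp ℝ 2 μ) (x : ℝ) : |integralOp K μ v x| ≤ |C| * ‖v‖ := by
  rw [← hK.inner_sectionLp μ x v]
  exact (abs_real_inner_le_norm _ _).trans
    (mul_le_mul_of_nonneg_right (hK.norm_sectionLp_le μ x) (norm_nonneg _))

theorem memLp_integralOp (v : Lp ℝ 2 μ) : MemLp (integralOp K μ v) 2 μ :=
  MemLp.of_bound (hK.measurable_integralOp μ v).aestronglyMeasurable (|C| * ‖v‖)
    (.of_forall fun y => by simpa using hK.abs_integralOp_le μ v y)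

theorem integralOp_sq_le (v : Lp ℝ 2 μ) (x : ℝ) :
    integralOp K μ v x ^ 2 ≤ (∫ y, K x y ^ 2 ∂μ) * ‖v‖ ^ 2 := by
  rw [← hK.inner_sectionLp μ x v, ← hK.norm_sectionLp_sq μ x, ← mul_pow, ← sq_abs]
  exact pow_le_pow_left₀ (abs_nonneg _) (abs_real_inner_le_norm _ _) 2

theorem integrable_integral_sq : Integrable (fun x => ∫ y, K x y ^ 2 ∂μ) μ :=
  (hK.sq.integrable_prod μ).integral_prod_left

theorem integral_integralOp_sq_le (v : Lp ℝ 2 μ) :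
    ∫ x, integralOp K μ v x ^ 2 ∂μ ≤ (∫ x, ∫ y, K x y ^ 2 ∂μ ∂μ) * ‖v‖ ^ 2 := by
  rw [← integral_mul_const]
  exact integral_mono_of_nonneg (.of_forall fun x => sq_nonneg _)
    ((hK.integrable_integral_sq μ).mul_const _) (.of_forall fun x => hK.integralOp_sq_le μ v x)

omit hK [IsProbabilityMeasure μ] in
theorem norm_toLp_sq {f : ℝ → ℝ} (hf : MemLp f 2 μ) : ‖hf.toLp‖ ^ 2 = ∫ x, f x ^ 2 ∂μ := by
  rw [← real_inner_self_eq_norm_sq, L2.inner_def]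
  refine integral_congr_ae ?_
  filter_upwards [hf.coeFn_toLp] with y hy
  rw [hy]
  simp [pow_two]

/-- The bounded operator on `L²(μ)` with kernel `K`. -/
noncomputable def op : Lp ℝ 2 μ →L[ℝ] Lp ℝ 2 μ :=
  LinearMap.mkContinuous
    { toFun := fun v => (hK.memLp_integralOp μ v).toLp
      map_add' := fun u v => by
        rw [← MemLp.toLp_add]
        refine MemLp.toLp_congr _ _ (.of_forall fun x => ?_)
        simp only [Pi.add_apply, ← hK.inner_sectionLp μ x, inner_add_right]
      map_smul' := fun c v => by
        rw [RingHom.id_apply, ← MemLp.toLp_const_smul]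
        refine MemLp.toLp_congr _ _ (.of_forall fun x => ?_)
        simp only [Pi.smul_apply, ← hK.inner_sectionLp μ x, inner_smul_right, smul_eq_mul] }
    -- The Hilbert–Schmidt norm of `K` rather than its supremum bound: compactness is obtained from
    -- convergence of kernels in `L²(μ ⊗ μ)`.
    (Real.sqrt (∫ x, ∫ y, K x y ^ 2 ∂μ ∂μ)) (fun v => by
      have h0 : 0 ≤ ∫ x, ∫ y, K x y ^ 2 ∂μ ∂μ :=
        integral_nonneg fun x => integral_nonneg fun y => sq_nonneg _
      refine abs_le_of_sq_le_sq' ?_ (by positivity) |>.2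
      rw [mul_pow, Real.sq_sqrt h0]
      simp only [LinearMap.coe_mk, AddHom.coe_mk]
      rw [norm_toLp_sq μ]
      exact hK.integral_integralOp_sq_le μ v)

theorem coeFn_op (v : Lp ℝ 2 μ) : hK.op μ v =ᵐ[μ] integralOp K μ v :=
  (hK.memLp_integralOp μ v).coeFn_toLp

theorem op_eq_iff (v w : Lp ℝ 2 μ) : hK.op μ v = w ↔ integralOp K μ v =ᵐ[μ] w := by
  rw [Lp.ext_iff]
  exact ⟨fun h => (hK.coeFn_op μ v).symm.trans h, fun h => (hK.coeFn_op μ v).trans h⟩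

theorem norm_op_le : ‖hK.op μ‖ ≤ Real.sqrt (∫ x, ∫ y, K x y ^ 2 ∂μ ∂μ) :=
  LinearMap.mkContinuous_norm_le _ (Real.sqrt_nonneg _) _

theorem norm_op_sq (v : Lp ℝ 2 μ) : ‖hK.op μ v‖ ^ 2 = ∫ x, integralOp K μ v x ^ 2 ∂μ :=
  norm_toLp_sq μ (hK.memLp_integralOp μ v)

theorem inner_op (u v : Lp ℝ 2 μ) :
    inner ℝ (hK.op μ u) v = ∫ x, ∫ y, K x y * u y * v x ∂μ ∂μ := by
  rw [L2.inner_def]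
  refine integral_congr_ae ?_
  filter_upwards [hK.coeFn_op μ u] with x hx
  rw [hx, integral_mul_const]
  simp [integralOp, mul_comm]

omit [IsProbabilityMeasure μ] in
theorem integrable_mul_mul {u v : ℝ → ℝ} (hu : Integrable u μ) (hv : Integrable v μ) :
    Integrable (fun p : ℝ × ℝ => K p.1 p.2 * u p.2 * v p.1) (μ.prod μ) := by
  have h := (hv.mul_prod hu).bdd_mul (c := C) hK.measurable.aestronglyMeasurable
    (.of_forall fun p => hK.bound p.1 p.2)
  refine h.congr (.of_forall fun p => ?_)
  simp only [Function.uncurry]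
  ring

theorem isSymmetric_op (hs : ∀ x y, K x y = K y x) : (hK.op μ).IsSymmetric := by
  intro u v
  have hu : Integrable u μ := (Lp.memLp u).integrable (by norm_num)
  have hv : Integrable v μ := (Lp.memLp v).integrable (by norm_num)
  simp only [ContinuousLinearMap.coe_coe]
  rw [hK.inner_op μ u v, real_inner_comm, hK.inner_op μ v u,
    integral_integral_swap (hK.integrable_mul_mul μ hu hv)]
  refine integral_congr_ae (.of_forall fun x => integral_congr_ae (.of_forall fun y => ?_))
  simp only []
  rw [hs]; ring

theorem sub {K' : ℝ → ℝ → ℝ} {C' : ℝ} (hK' : IsBoundedKernel K' C') :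
    IsBoundedKernel (fun x y => K x y - K' x y) (C + C') where
  measurable := hK.measurable.sub hK'.measurable
  bound x y := (abs_sub _ _).trans (add_le_add (hK.bound x y) (hK'.bound x y))

theorem op_sub {K' : ℝ → ℝ → ℝ} {C' : ℝ} (hK' : IsBoundedKernel K' C') :
    (hK.sub hK').op μ = hK.op μ - hK'.op μ := by
  ext1 v
  rw [op_eq_iff, _root_.sub_apply]
  filter_upwards [hK.coeFn_op μ v, hK'.coeFn_op μ v, Lp.coeFn_sub (hK.op μ v) (hK'.op μ v)]
    with x h1 h2 h3
  rw [h3, Pi.sub_apply, h1, h2, ← (hK.sub hK').inner_sectionLp μ, ← hK.inner_sectionLp μ x,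
    ← hK'.inner_sectionLp μ x, ← inner_sub_left]
  congr 1

-- In its first variable the kernel depends only on the value of `q`, so the range lies in the span
-- of the finitely many indicators of fibres of `q`.
omit hK in
theorem isCompactOperator_op_comp_simpleFunc (q : SimpleFunc ℝ ℝ)
    (hKq : IsBoundedKernel (fun x y => K (q x) y) C) : IsCompactOperator (hKq.op μ) := by
  let g : ℝ → Lp ℝ 2 μ := fun a =>
    indicatorConstLp 2 (q.measurableSet_fiber a) (measure_ne_top μ _) (1 : ℝ)
  let V : Submodule ℝ (Lp ℝ 2 μ) := Submodule.span ℝ (g '' (q.range : Set ℝ))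
  have hfin : FiniteDimensional ℝ V :=
    FiniteDimensional.span_of_finite ℝ (q.range.finite_toSet.image g)
  have hmem : ∀ v, hKq.op μ v ∈ V := by
    intro v
    have : hKq.op μ v = ∑ a ∈ q.range, integralOp K μ v a • g a := by
      rw [op_eq_iff]
      have h1 : ∀ a, (g a : ℝ → ℝ) =ᵐ[μ] (q ⁻¹' {a}).indicator fun _ => (1 : ℝ) :=
        fun a => indicatorConstLp_coeFn
      have h2 := Lp.coeFn_finsetSum (s := q.range) (fun a => integralOp K μ v a • g a)
      have h3 : ∀ᵐ x ∂μ, ∀ a ∈ q.range, (integralOp K μ v a • g a : Lp ℝ 2 μ) x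
          = integralOp K μ v a * (q ⁻¹' {a}).indicator (fun _ => (1 : ℝ)) x := by
        rw [Filter.eventually_all_finset]
        intro a _
        filter_upwards [h1 a, Lp.coeFn_smul (integralOp K μ v a) (g a)] with x h h'
        rw [h', Pi.smul_apply, h, smul_eq_mul]
      filter_upwards [h2, h3] with x hx hx3
      rw [hx, Finset.sum_apply, Finset.sum_congr rfl hx3, Finset.sum_eq_single (q x)]
      · simp [Set.indicator, integralOp]
      · intro b _ hb
        simp [Set.indicator, hb.symm]
      · intro h
        exact absurd (q.mem_range_self x) h
    rw [this]
    exact Submodule.sum_mem _ fun a ha =>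
      Submodule.smul_mem _ _ (Submodule.subset_span ⟨a, ha, rfl⟩)
  have h1 : IsCompactOperator ((hKq.op μ).codRestrict V hmem) :=
    (isCompactOperator_id (E := V)).comp_clm _
  exact h1.clm_comp V.subtypeL

/-- Discretizing the first variable by simple functions `q n x → x` gives finite-rank operators.
Continuity and dominated convergence make the kernels converge in Hilbert–Schmidt norm, hence the
operators in norm, and norm limits of compact operators are compact. -/
theorem isCompactOperator_op (hc : ∀ y, Continuous fun x => K x y) :
    IsCompactOperator (hK.op μ) := by
  let q : ℕ → SimpleFunc ℝ ℝ := fun n =>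
    SimpleFunc.approxOn id measurable_id Set.univ 0 (Set.mem_univ _) n
  have hqt : ∀ x, Tendsto (fun n => q n x) atTop (𝓝 x) := fun x =>
    SimpleFunc.tendsto_approxOn measurable_id (Set.mem_univ _) (by simp)
  let Kn : ℕ → ℝ → ℝ → ℝ := fun n x y => K (q n x) y
  have hKn : ∀ n, IsBoundedKernel (Kn n) C := fun n =>
    ⟨hK.measurable.comp (((q n).measurable.comp measurable_fst).prodMk measurable_snd),
      fun x y => hK.bound _ _⟩
  have hcompact : ∀ n, IsCompactOperator ((hKn n).op μ) := fun n =>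
    isCompactOperator_op_comp_simpleFunc μ (q n) (hKn n)
  refine isCompactOperator_of_tendsto (l := atTop) (F := fun n => (hKn n).op μ) ?_
    (.of_forall hcompact)
  rw [tendsto_iff_norm_sub_tendsto_zero]
  have hlim : Tendsto (fun n => ∫ x, ∫ y, (Kn n x y - K x y) ^ 2 ∂μ ∂μ) atTop (𝓝 0) := by
    have h0 : ∫ _ : ℝ × ℝ, (0 : ℝ) ∂(μ.prod μ) = 0 := by simp
    have h1 : ∀ n, ∫ x, ∫ y, (Kn n x y - K x y) ^ 2 ∂μ ∂μ
        = ∫ p : ℝ × ℝ, (Kn n p.1 p.2 - K p.1 p.2) ^ 2 ∂(μ.prod μ) := fun n =>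
      (integral_prod _ (((hKn n).sub hK).sq.integrable_prod μ)).symm
    simp_rw [h1]
    rw [← h0]
    refine tendsto_integral_of_dominated_convergence (fun _ => (C + C) ^ 2)
      (fun n => (((hKn n).sub hK).sq.integrable_prod μ).aestronglyMeasurable)
      (integrable_const _) (fun n => .of_forall fun p => ?_) (.of_forall fun p => ?_)
    · rw [Real.norm_eq_abs]
      exact ((hKn n).sub hK).sq.bound p.1 p.2
    · have h2 : Tendsto (fun n => Kn n p.1 p.2) atTop (𝓝 (K p.1 p.2)) :=
        ((hc p.2).tendsto p.1).comp (hqt p.1)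
      have h3 := (h2.sub_const (K p.1 p.2)).pow 2
      simpa using h3
  have hsq := (Real.continuous_sqrt.tendsto 0).comp hlim
  rw [Real.sqrt_zero] at hsq
  refine squeeze_zero (fun n => norm_nonneg _) (fun n => ?_) hsq
  rw [← (hKn n).op_sub μ hK]
  exact ((hKn n).sub hK).norm_op_le μ

end IsBoundedKernel

/-! ### Eigenfunction expansion of a symmetric kernel and its largest eigenvalue -/

theorem Orthonormal.norm_sub_sum_sq {E ι : Type*} [NormedAddCommGroup E]
    [InnerProductSpace ℝ E] {v : ι → E} (hv : Orthonormal ℝ v) (s : Finset ι) (x : E) :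
    ‖x - ∑ i ∈ s, inner ℝ x (v i) • v i‖ ^ 2 = ‖x‖ ^ 2 - ∑ i ∈ s, inner ℝ x (v i) ^ 2 := by
  classical
  have h1 : inner ℝ x (∑ i ∈ s, inner ℝ x (v i) • v i) = ∑ i ∈ s, inner ℝ x (v i) ^ 2 := by
    rw [inner_sum]
    exact Finset.sum_congr rfl fun i _ => by rw [inner_smul_right, sq]
  have h2 : ‖∑ i ∈ s, inner ℝ x (v i) • v i‖ ^ 2 = ∑ i ∈ s, inner ℝ x (v i) ^ 2 := by
    rw [← real_inner_self_eq_norm_sq, hv.inner_sum]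
    exact Finset.sum_congr rfl fun i _ => by simp [sq]
  rw [norm_sub_sq_real, h1, h2]
  ring

/-- An expansion `K x y = ∑ ν i * e i x * e i y`, convergent in `L²(μ ⊗ μ)`, with bounded
orthonormal eigenfunctions `e i` for the nonzero eigenvalues `ν i`. -/
structure IsEigenExpansion {ι : Type} (K : ℝ → ℝ → ℝ) (μ : Measure ℝ) (ν : ι → ℝ)
    (e : ι → ℝ → ℝ) : Prop where
  ne_zero : ∀ i, ν i ≠ 0
  measurable : ∀ i, Measurable (e i)
  bounded : ∀ i, ∃ B, ∀ x, |e i x| ≤ B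
  eigen : ∀ i x, ∫ y, K x y * e i y ∂μ = ν i * e i x
  norm_one : ∀ i, ∫ x, e i x * e i x ∂μ = 1
  orthogonal : ∀ i j, i ≠ j → ∫ x, e i x * e j x ∂μ = 0
  complete : ∀ r ∈ integralOpEigenvalues K μ, r ≠ 0 → ∃ i, ν i = r
  mem_eigenvalues : ∀ i, ν i ∈ integralOpEigenvalues K μ
  summable_sq : Summable fun i => ν i ^ 2
  approx : ∀ ε > 0, ∃ s₀ : Finset ι, ∀ s, s₀ ⊆ s →
    ∫ x, ∫ y, (K x y - ∑ i ∈ s, ν i * e i x * e i y) ^ 2 ∂μ ∂μ ≤ ε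

namespace IsBoundedKernel

variable {K : ℝ → ℝ → ℝ} {C : ℝ} (hK : IsBoundedKernel K C)
  (μ : Measure ℝ) [IsProbabilityMeasure μ]

include hK

/-- Parseval's identity for each section `K x ·`, integrated over `x`: the squared norms of the
images of a basis add up to the squared Hilbert–Schmidt norm. -/
theorem hasSum_integral_integralOp_sq {ι : Type*} [Countable ι] (b : HilbertBasis ι ℝ (Lp ℝ 2 μ)) :
    HasSum (fun i => ∫ x, integralOp K μ (b i) x ^ 2 ∂μ) (∫ x, ∫ y, K x y ^ 2 ∂μ ∂μ) := by
  have hs : ∀ x, HasSum (fun i => integralOp K μ (b i) x ^ 2) (∫ y, K x y ^ 2 ∂μ) := by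
    intro x
    have := b.hasSum_inner_mul_inner (hK.sectionLp μ x) (hK.sectionLp μ x)
    rw [real_inner_self_eq_norm_sq, hK.norm_sectionLp_sq μ x] at this
    refine this.congr_fun ?_ |> fun h => h
    intro i
    rw [← hK.inner_sectionLp μ x, real_inner_comm (hK.sectionLp μ x) (b i), pow_two]
  refine hasSum_integral_of_dominated_convergence
    (fun i x => integralOp K μ (b i) x ^ 2)
    (fun i => ((hK.measurable_integralOp μ (b i)).pow_const 2).aestronglyMeasurable)
    (fun i => .of_forall fun x => by simp) (.of_forall fun x => (hs x).summable) ?_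
    (.of_forall hs)
  refine (hK.integrable_integral_sq μ).congr (.of_forall fun x => ?_)
  exact (hs x).tsum_eq.symm

theorem mem_integralOpEigenvalues_iff (r : ℝ) :
    r ∈ integralOpEigenvalues K μ ↔ ∃ v : Lp ℝ 2 μ, v ≠ 0 ∧ hK.op μ v = r • v := by
  refine exists_congr fun v => and_congr_right fun _ => ?_
  rw [op_eq_iff]
  have h := Lp.coeFn_smul r v
  constructor <;> intro h'
  · filter_upwards [h, h'] with x h1 h2
    rw [h1, h2]; rfl
  · filter_upwards [h, h'] with x h1 h2
    rw [h2, h1]; rfl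

/-- Eigenvectors with eigenvalue zero are dropped from an eigenbasis. Each remaining class `b i` is
replaced by the version `ν i⁻¹ ∫ K x y b i(y) dμ(y)`, which is bounded and satisfies the eigenvalue
equation at every point. Pythagoras on the sections shows that the squared error of a partial sum is
`∬ K² - ∑ ν i²`, and this tends to zero because the full sum of the `ν i²` equals `∬ K²`. -/
theorem exists_isEigenExpansion (hs : ∀ x y, K x y = K y x)
    (hc : ∀ y, Continuous fun x => K x y) :
    ∃ (ι : Type) (_ : Countable ι) (ν : ι → ℝ) (e : ι → ℝ → ℝ), IsEigenExpansion K μ ν e := by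
  obtain ⟨S, b, ν, hν⟩ := exists_hilbertBasis_eigenvectors (hK.isCompactOperator_op μ hc)
    (hK.isSymmetric_op μ hs)
  have : Fact ((2 : ENNReal) ≠ ⊤) := ⟨by norm_num⟩
  have hcount : Countable S := b.orthonormal.countable_of_secondCountable
  let ι := {i : S // ν i ≠ 0}
  let e : ι → ℝ → ℝ := fun i x => (ν i)⁻¹ * integralOp K μ (b i) x
  have he : ∀ (i : ι) x, ν i * e i x = integralOp K μ (b i) x := fun i x => by
    simp only [e]; rw [mul_inv_cancel_left₀ i.2]
  have heb : ∀ i : ι, e i =ᵐ[μ] b i := by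
    intro i
    have h1 := (hK.op_eq_iff μ (b i) _).1 (hν i)
    filter_upwards [h1, Lp.coeFn_smul (ν i) (b i)] with x hx hx2
    simp only [e]
    rw [hx, hx2, Pi.smul_apply, smul_eq_mul, inv_mul_cancel_left₀ i.2]
  have hmeas : ∀ i, Measurable (e i) := fun i => (hK.measurable_integralOp μ (b i)).const_mul _
  have hbdd : ∀ i, ∃ B, ∀ x, |e i x| ≤ B := fun i =>
    ⟨|(ν i)⁻¹| * (|C| * ‖b i‖), fun x => by
      simp only [e]
      rw [abs_mul]
      exact mul_le_mul_of_nonneg_left (hK.abs_integralOp_le μ _ x) (abs_nonneg _)⟩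
  have hinner : ∀ i j : ι, ∫ x, e i x * e j x ∂μ = inner ℝ (b i) (b j) := by
    intro i j
    rw [L2.inner_def]
    refine integral_congr_ae ?_
    filter_upwards [heb i, heb j] with x h1 h2
    rw [h1, h2]; simp [mul_comm]
  have hnormsq : ∀ i, ∫ x, integralOp K μ (b i) x ^ 2 ∂μ = ν i ^ 2 := by
    intro i
    rw [← hK.norm_op_sq μ, hν, norm_smul, b.orthonormal.1 i, mul_one, Real.norm_eq_abs, sq_abs]
  have hsum : HasSum (fun i : S => ν i ^ 2) (∫ x, ∫ y, K x y ^ 2 ∂μ ∂μ) := by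
    have := hK.hasSum_integral_integralOp_sq μ b
    simpa only [hnormsq] using this
  have hsum' : HasSum (fun i : ι => ν i ^ 2) (∫ x, ∫ y, K x y ^ 2 ∂μ ∂μ) := by
    refine (hasSum_subtype_iff_of_support_subset (s := {i : S | ν i ≠ 0}) (f := fun i : S => ν i ^ 2)
      ?_).2 hsum
    intro i hi
    simpa using hi
  have horth : Orthonormal ℝ (fun i : ι => b i) := b.orthonormal.comp _ Subtype.val_injective
  have herr : ∀ s : Finset ι, ∫ x, ∫ y, (K x y - ∑ i ∈ s, ν i * e i x * e i y) ^ 2 ∂μ ∂μ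
      = (∫ x, ∫ y, K x y ^ 2 ∂μ ∂μ) - ∑ i ∈ s, ν i ^ 2 := by
    intro s
    have h1 : ∀ x, ∫ y, (K x y - ∑ i ∈ s, ν i * e i x * e i y) ^ 2 ∂μ
        = (∫ y, K x y ^ 2 ∂μ) - ∑ i ∈ s, integralOp K μ (b i) x ^ 2 := by
      intro x
      have h2 := horth.norm_sub_sum_sq s (hK.sectionLp μ x)
      simp only [hK.norm_sectionLp_sq μ x, hK.inner_sectionLp μ x] at h2
      rw [← h2, ← real_inner_self_eq_norm_sq, L2.inner_def]
      refine integral_congr_ae ?_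
      have h3 := Lp.coeFn_sub (hK.sectionLp μ x) (∑ i ∈ s, integralOp K μ (b i) x • (b i))
      have h4 := Lp.coeFn_finsetSum (s := s) (fun i : ι => integralOp K μ (b i) x • (b i))
      have h5 : ∀ᵐ y ∂μ, ∀ i ∈ s, (integralOp K μ (b i) x • b i : Lp ℝ 2 μ) y
          = ν i * e i x * e i y := by
        rw [Filter.eventually_all_finset]
        intro i _
        filter_upwards [Lp.coeFn_smul (integralOp K μ (b i) x) (b i), heb i] with y h h'
        rw [h, Pi.smul_apply, smul_eq_mul, he, h']
      filter_upwards [h3, h4, h5, (hK.memLp_section μ x).coeFn_toLp] with y h3 h4 h5 h6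
      have : (hK.sectionLp μ x) y = K x y := h6
      rw [h3, Pi.sub_apply, h4, Finset.sum_apply, Finset.sum_congr rfl h5, this]
      simp [pow_two]
    simp_rw [h1]
    have hint : ∀ i : ι, Integrable (fun x => integralOp K μ (b i) x ^ 2) μ := fun i =>
      (hK.memLp_integralOp μ (b i)).integrable_sq
    rw [integral_sub (hK.integrable_integral_sq μ) (integrable_finsetSum _ fun i _ => hint i),
      integral_finsetSum _ fun i _ => hint i]
    simp_rw [hnormsq]
  refine ⟨ι, inferInstance, fun i => ν i, e, ⟨fun i => i.2, hmeas, hbdd, ?_, ?_, ?_, ?_, ?_,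
    hsum'.summable, ?_⟩⟩
  · intro i x
    rw [he, integralOp]
    refine integral_congr_ae ?_
    filter_upwards [heb i] with y hy
    rw [hy]
  · intro i
    rw [hinner, real_inner_self_eq_norm_sq, b.orthonormal.1, one_pow]
  · intro i j hij
    rw [hinner]
    exact b.orthonormal.2 fun h => hij (Subtype.ext h)
  -- An eigenvector for a nonzero `r` different from all `ν i` would be orthogonal to the whole
  -- basis, hence zero.
  · intro r hr hr0
    obtain ⟨v, hv0, hv⟩ := (hK.mem_integralOpEigenvalues_iff μ r).1 hr
    by_contra! hne
    apply hv0
    have hz : ∀ i, inner ℝ (b i) v = 0 := by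
      intro i
      have h1 := hK.isSymmetric_op μ hs (b i) v
      simp only [ContinuousLinearMap.coe_coe] at h1
      rw [hν, hv, inner_smul_left, inner_smul_right] at h1
      by_contra h0
      have h2 : ν i = r := mul_right_cancel₀ h0 (by simpa using h1)
      exact hne ⟨i, h2 ▸ hr0⟩ h2
    have h2 := b.hasSum_repr v
    simp only [b.repr_apply_apply, hz, zero_smul] at h2
    exact h2.unique hasSum_zero
  · intro i
    exact (hK.mem_integralOpEigenvalues_iff μ _).2
      ⟨b i, norm_pos_iff.1 (by rw [b.orthonormal.1]; norm_num), hν i⟩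
  · intro ε hε
    have := hsum'
    rw [HasSum, SummationFilter.unconditional_filter, Metric.tendsto_nhds] at this
    obtain ⟨s₀, h₀⟩ := eventually_atTop.1 (this ε hε)
    refine ⟨s₀, fun s hss => ?_⟩
    rw [herr]
    have := h₀ s hss
    rw [Real.dist_eq, abs_sub_comm] at this
    exact (le_abs_self _).trans this.le

/-- The sign condition makes `K x y σ(x) σ(y)` dominate `|K x y|`. Replacing `v` by `σ |v|`
preserves the norm, and its quadratic form dominates the absolute value of that of `v`, so the
operator norm is an eigenvalue. It bounds every eigenvalue in absolute value. -/
theorem isGreatest_integralOpEigenvalues_norm (hs : ∀ x y, K x y = K y x)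
    (hc : ∀ y, Continuous fun x => K x y) (h0 : 0 < ∫ x, ∫ y, K x y ^ 2 ∂μ ∂μ)
    {σ : ℝ → ℝ} (hσ : Measurable σ) (hσ1 : ∀ x, |σ x| = 1)
    (hKσ : ∀ x y, |K x y| ≤ K x y * σ y * σ x) :
    ∃ r, 0 < r ∧ IsGreatest (integralOpEigenvalues K μ) r ∧
      ∀ ν ∈ integralOpEigenvalues K μ, |ν| ≤ r := by
  have hle : ∀ ν ∈ integralOpEigenvalues K μ, |ν| ≤ ‖hK.op μ‖ := by
    intro ν hν
    obtain ⟨v, hv0, hv⟩ := (hK.mem_integralOpEigenvalues_iff μ ν).1 hν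
    have := (hK.op μ).le_opNorm v
    rw [hv, norm_smul, Real.norm_eq_abs] at this
    exact le_of_mul_le_mul_right this (norm_pos_iff.2 hv0)
  -- A zero operator would make the sum in the integrated Parseval identity vanish, contradicting `∬
  -- K² > 0`.
  have hne : hK.op μ ≠ 0 := by
    intro hzero
    obtain ⟨S, b, -⟩ := exists_hilbertBasis ℝ (Lp ℝ 2 μ)
    have : Fact ((2 : ENNReal) ≠ ⊤) := ⟨by norm_num⟩
    have : Countable S := b.orthonormal.countable_of_secondCountable
    have h1 := hK.hasSum_integral_integralOp_sq μ b
    simp only [← hK.norm_op_sq μ, hzero] at h1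
    simp only [_root_.zero_apply, norm_zero, ne_eq, OfNat.ofNat_ne_zero, not_false_eq_true,
      zero_pow] at h1
    exact h0.ne' (h1.unique hasSum_zero)
  have hmem := hasEigenvalue_norm_of_abs_inner_le (hK.isCompactOperator_op μ hc)
    (hK.isSymmetric_op μ hs) hne (by
      intro v
      have hw : MemLp (fun x => σ x * |v x|) 2 μ := by
        refine MemLp.of_le (Lp.memLp v).norm
          (hσ.aestronglyMeasurable.mul (Lp.memLp v).aestronglyMeasurable.norm)
          (.of_forall fun x => ?_)
        simp [hσ1 x]
      refine ⟨hw.toLp, ?_, ?_⟩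
      · rw [Lp.norm_def, Lp.norm_def, eLpNorm_congr_ae hw.coeFn_toLp]
        congr 1
        refine eLpNorm_congr_norm_ae (.of_forall fun x => ?_)
        simp [hσ1 x]
      · have hv : Integrable v μ := (Lp.memLp v).integrable (by norm_num)
        have hwi : Integrable (hw.toLp : ℝ → ℝ) μ := (Lp.memLp hw.toLp).integrable (by norm_num)
        have h1 := hK.integrable_mul_mul μ hv hv
        have h2 := hK.integrable_mul_mul μ hwi hwi
        rw [hK.inner_op μ, hK.inner_op μ, ← integral_prod _ h1, ← integral_prod _ h2]
        refine (abs_integral_le_integral_abs).trans (integral_mono_ae h1.abs h2 ?_)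
        have h3 : ∀ᵐ p ∂(μ.prod μ), (hw.toLp : ℝ → ℝ) p.1 = σ p.1 * |v p.1| :=
          Measure.quasiMeasurePreserving_fst.ae hw.coeFn_toLp
        have h4 : ∀ᵐ p ∂(μ.prod μ), (hw.toLp : ℝ → ℝ) p.2 = σ p.2 * |v p.2| :=
          Measure.quasiMeasurePreserving_snd.ae hw.coeFn_toLp
        filter_upwards [h3, h4] with p h3 h4
        rw [h3, h4, abs_mul, abs_mul]
        have h5 := mul_le_mul_of_nonneg_right (hKσ p.1 p.2)
          (mul_nonneg (abs_nonneg (v p.2)) (abs_nonneg (v p.1)))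
        linarith)
  obtain ⟨v, hv⟩ := hmem.exists_hasEigenvector
  have h2 : ‖hK.op μ‖ ∈ integralOpEigenvalues K μ :=
    (hK.mem_integralOpEigenvalues_iff μ _).2 ⟨v, hv.2, hv.apply_eq_smul⟩
  exact ⟨‖hK.op μ‖, norm_pos_iff.2 hne, ⟨h2, fun r hr => (le_abs_self r).trans (hle r hr)⟩, hle⟩

end IsBoundedKernel

/-! ### Integration over an i.i.d. sample -/

theorem measurable_update_prod (i : ℕ) :
    Measurable fun p : (ℕ → ℝ) × ℝ => Function.update p.1 i p.2 := by
  rw [measurable_pi_iff]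
  intro j
  by_cases h : j = i
  · subst h; simpa using measurable_snd
  · simp only [Function.update_of_ne h]
    exact (measurable_pi_apply j).comp measurable_fst

/-- Resampling one coordinate preserves the law of an i.i.d. sample. -/
theorem measurePreserving_update (P : ProbabilityMeasure ℝ) (i : ℕ) :
    MeasurePreserving (fun p : (ℕ → ℝ) × ℝ => Function.update p.1 i p.2)
      ((sampleLaw P).prod (P : Measure ℝ)) (sampleLaw P) where
  measurable := measurable_update_prod i
  map_eq := by
    refine Measure.eq_infinitePi _ fun s t ht => ?_
    rw [Measure.map_apply (measurable_update_prod i)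
      (MeasurableSet.pi s.countable_toSet fun j _ => ht j)]
    by_cases hi : i ∈ s
    · have : (fun p : (ℕ → ℝ) × ℝ => Function.update p.1 i p.2) ⁻¹' Set.pi s t
          = Set.pi (s.erase i : Finset ℕ) t ×ˢ t i := by
        ext p
        simp only [Set.mem_preimage, Set.mem_pi, Set.mem_prod, Finset.coe_erase, Set.mem_sdiff,
          Finset.mem_coe, Set.mem_singleton_iff, and_imp]
        constructor
        · intro h
          refine ⟨fun j hj hji => ?_, ?_⟩
          · simpa [hji] using h j hj
          · simpa using h i hi
        · rintro ⟨h1, h2⟩ j hj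
          by_cases hji : j = i
          · subst hji; simpa using h2
          · simpa [hji] using h1 j hj hji
      rw [this, Measure.prod_prod, sampleLaw, Measure.infinitePi_pi _ fun j _ => ht j,
        mul_comm, Finset.mul_prod_erase s (fun j => (P : Measure ℝ) (t j)) hi]
    · have : (fun p : (ℕ → ℝ) × ℝ => Function.update p.1 i p.2) ⁻¹' Set.pi s t
          = Set.pi s t ×ˢ Set.univ := by
        ext p
        simp only [Set.mem_preimage, Set.mem_pi, Set.mem_prod, Finset.mem_coe, Set.mem_univ,
          and_true]
        refine forall₂_congr fun j hj => ?_
        rw [Function.update_of_ne (by rintro rfl; exact hi hj)]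
      rw [this, Measure.prod_prod, sampleLaw, Measure.infinitePi_pi _ fun j _ => ht j]
      simp

/-- Independence is used in this form in the moment computations: one coordinate is averaged out,
while the factors that do not depend on it stay fixed. -/
theorem integral_sampleLaw_update (P : ProbabilityMeasure ℝ) (i : ℕ) {f : (ℕ → ℝ) → ℝ} {C : ℝ}
    (hf : Measurable f) (hC : ∀ ω, |f ω| ≤ C) :
    ∫ ω, f ω ∂(sampleLaw P) = ∫ ω, ∫ x, f (Function.update ω i x) ∂(P : Measure ℝ) ∂(sampleLaw P) := by
  conv_lhs => rw [← (measurePreserving_update P i).map_eq]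
  rw [integral_map (measurable_update_prod i).aemeasurable hf.aestronglyMeasurable, integral_prod]
  exact Integrable.of_bound (hf.comp (measurable_update_prod i)).aestronglyMeasurable C
    (.of_forall fun p => hC _)

theorem measurePreserving_eval_sampleLaw (P : ProbabilityMeasure ℝ) (i : ℕ) :
    MeasurePreserving (fun ω : ℕ → ℝ => ω i) (sampleLaw P) (P : Measure ℝ) :=
  ⟨measurable_pi_apply i, Measure.infinitePi_map_eval _ i⟩

theorem integral_sampleLaw_eval (P : ProbabilityMeasure ℝ) (i : ℕ) {f : ℝ → ℝ}
    (hf : Measurable f) : ∫ ω, f (ω i) ∂(sampleLaw P) = ∫ x, f x ∂(P : Measure ℝ) := by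
  rw [← (measurePreserving_eval_sampleLaw P i).map_eq,
    integral_map (measurable_pi_apply i).aemeasurable hf.aestronglyMeasurable]

theorem integral_sampleLaw_eval₂ (P : ProbabilityMeasure ℝ) {i j : ℕ} (hij : i ≠ j)
    {K : ℝ → ℝ → ℝ} {C : ℝ} (hK : IsBoundedKernel K C) :
    ∫ ω, K (ω i) (ω j) ∂(sampleLaw P)
      = ∫ x, ∫ y, K x y ∂(P : Measure ℝ) ∂(P : Measure ℝ) := by
  have h1 := integral_prod _ (hK.integrable_prod (P : Measure ℝ))
  simp only [Function.uncurry] at h1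
  rw [← h1]
  have := Measure.infinitePi_map_eval_prod (P := fun _ : ℕ => (P : Measure ℝ)) hij
  rw [← this]
  exact (integral_map (φ := fun ω : ℕ → ℝ => (ω i, ω j)) (by fun_prop)
    hK.measurable.aestronglyMeasurable).symm

structure IsBoundedKernel₃ (h : ℝ → ℝ → ℝ → ℝ) (C : ℝ) : Prop where
  measurable : Measurable fun p : ℝ × ℝ × ℝ => h p.1 p.2.1 p.2.2
  bound : ∀ x y z, |h x y z| ≤ C

theorem abs_integral_le_of_abs_le {Ω : Type*} [MeasurableSpace Ω] {μ : Measure Ω}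
    [IsProbabilityMeasure μ] {f : Ω → ℝ} {C : ℝ} (hC : ∀ ω, |f ω| ≤ C) : |∫ ω, f ω ∂μ| ≤ C := by
  simpa using norm_integral_le_of_norm_le_const (μ := μ) (f := f) (C := C) (.of_forall hC)

namespace IsBoundedKernel₃

variable {h : ℝ → ℝ → ℝ → ℝ} {C : ℝ}

theorem measurable_eval (hh : IsBoundedKernel₃ h C) (i j k : ℕ) :
    Measurable fun ω : ℕ → ℝ => h (ω i) (ω j) (ω k) :=
  hh.measurable.comp (g := fun p : ℝ × ℝ × ℝ => h p.1 p.2.1 p.2.2)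
    (f := fun ω : ℕ → ℝ => (ω i, ω j, ω k)) (by fun_prop)

theorem isBoundedKernel_integral (hh : IsBoundedKernel₃ h C) (P : ProbabilityMeasure ℝ) :
    IsBoundedKernel (fun x y => ∫ z, h x y z ∂(P : Measure ℝ)) C where
  measurable := by
    have : StronglyMeasurable fun q : (ℝ × ℝ) × ℝ => h q.1.1 q.1.2 q.2 :=
      (hh.measurable.comp (g := fun p : ℝ × ℝ × ℝ => h p.1 p.2.1 p.2.2)
        (f := fun q : (ℝ × ℝ) × ℝ => (q.1.1, q.1.2, q.2)) (by fun_prop)).stronglyMeasurable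
    exact (this.integral_prod_right' (ν := (P : Measure ℝ))).measurable
  bound x y := abs_integral_le_of_abs_le (hh.bound x y)

theorem integral_mul (hh : IsBoundedKernel₃ h C) (P : ProbabilityMeasure ℝ) {i j k : ℕ}
    (hij : i ≠ j) (hik : i ≠ k) (hjk : j ≠ k) {G : (ℕ → ℝ) → ℝ} {B : ℝ} (hG : Measurable G)
    (hB : ∀ ω, |G ω| ≤ B) (hi : ∀ ω x, G (Function.update ω i x) = G ω)
    (hj : ∀ ω x, G (Function.update ω j x) = G ω) (hk : ∀ ω x, G (Function.update ω k x) = G ω) :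
    ∫ ω, h (ω i) (ω j) (ω k) * G ω ∂(sampleLaw P)
      = (∫ x, ∫ y, ∫ z, h x y z ∂(P : Measure ℝ) ∂(P : Measure ℝ) ∂(P : Measure ℝ))
        * ∫ ω, G ω ∂(sampleLaw P) := by
  have hK := hh.isBoundedKernel_integral P
  have hC : 0 ≤ C := (abs_nonneg _).trans (hh.bound 0 0 0)
  have hmul : ∀ a b : ℝ, |a| ≤ C → |b| ≤ B → |a * b| ≤ C * B := fun a b ha hb => by
    rw [abs_mul]; exact mul_le_mul ha hb (abs_nonneg _) hC
  have hK1 : Measurable fun x => ∫ y, ∫ z, h x y z ∂(P : Measure ℝ) ∂(P : Measure ℝ) :=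
    (hK.measurable.stronglyMeasurable.integral_prod_right (ν := (P : Measure ℝ))).measurable
  rw [integral_sampleLaw_update P k (f := fun ω => h (ω i) (ω j) (ω k) * G ω)
    ((hh.measurable_eval i j k).mul hG)
    fun ω => hmul _ _ (hh.bound _ _ _) (hB ω)]
  simp only [Function.update_self, Function.update_of_ne hik, Function.update_of_ne hjk, hk,
    integral_mul_const]
  rw [integral_sampleLaw_update P j (f := fun ω => (∫ z, h (ω i) (ω j) z ∂(P : Measure ℝ)) * G ω)
    ((hK.measurable.comp (f := fun ω : ℕ → ℝ => (ω i, ω j)) (by fun_prop)).mul hG)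
    fun ω => hmul _ _ (hK.bound _ _) (hB ω)]
  simp only [Function.update_self, Function.update_of_ne hij, hj, integral_mul_const]
  rw [integral_sampleLaw_update P i
    (f := fun ω => (∫ y, ∫ z, h (ω i) y z ∂(P : Measure ℝ) ∂(P : Measure ℝ)) * G ω)
    ((hK1.comp (measurable_pi_apply i)).mul hG)
    fun ω => hmul _ _ (abs_integral_le_of_abs_le (hK.bound _)) (hB ω)]
  simp only [Function.update_self, hi, integral_mul_const, integral_const_mul]

end IsBoundedKernel₃

/-- Only pairs related by `R` contribute to the expanded square. For centred kernels `R` will mean a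
common index, for degenerate ones equality of the index tuples. -/
theorem integral_sq_sum_le {Ω α : Type*} [MeasurableSpace Ω] {μ : Measure Ω}
    (S : Finset α) (f : α → Ω → ℝ) (R : α → α → Prop) [DecidableRel R] {B : ℝ}
    (hint : ∀ a b, Integrable (fun ω => f a ω * f b ω) μ)
    (h0 : ∀ a ∈ S, ∀ b ∈ S, ¬ R a b → ∫ ω, f a ω * f b ω ∂μ = 0)
    (hB : ∀ a ∈ S, ∀ b ∈ S, R a b → ∫ ω, f a ω * f b ω ∂μ ≤ B) :
    ∫ ω, (∑ a ∈ S, f a ω) ^ 2 ∂μ ≤ ∑ a ∈ S, ((S.filter (R a)).card : ℝ) * B := by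
  simp_rw [pow_two, Finset.sum_mul_sum]
  rw [integral_finsetSum _ fun a _ => integrable_finsetSum _ fun b _ => hint a b]
  refine Finset.sum_le_sum fun a ha => ?_
  rw [integral_finsetSum _ fun b _ => hint a b, ← nsmul_eq_mul, ← Finset.sum_const,
    Finset.sum_filter]
  refine Finset.sum_le_sum fun b hb => ?_
  split_ifs with h
  · exact hB a ha b hb h
  · exact (h0 a ha b hb h).le

theorem tendstoInMeasure_of_tendsto_integral_sq {Ω : Type*} [MeasurableSpace Ω] {μ : Measure Ω}
    {f : ℕ → Ω → ℝ} {g : Ω → ℝ} (hint : ∀ n, Integrable (fun ω => (f n ω - g ω) ^ 2) μ)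
    (hlim : Tendsto (fun n => ∫ ω, (f n ω - g ω) ^ 2 ∂μ) atTop (𝓝 0)) :
    TendstoInMeasure μ f atTop g := by
  rw [tendstoInMeasure_iff_norm]
  intro ε hε
  have h1 : ∀ n, μ {ω | ε ≤ ‖f n ω - g ω‖} ≤ ENNReal.ofReal ((∫ ω, (f n ω - g ω) ^ 2 ∂μ) / ε ^ 2) := by
    intro n
    rw [ENNReal.ofReal_div_of_pos (by positivity),
      ofReal_integral_eq_lintegral_ofReal (hint n) (.of_forall fun ω => sq_nonneg _)]
    refine (measure_mono fun ω hω => ?_).trans (meas_ge_le_lintegral_div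
      (hint n).aestronglyMeasurable.aemeasurable.ennreal_ofReal
      (by simpa using hε.ne') ENNReal.ofReal_ne_top)
    simp only [Set.mem_ofPred_eq, Real.norm_eq_abs] at hω ⊢
    refine ENNReal.ofReal_le_ofReal ?_
    rw [← sq_abs (f n ω - g ω)]
    exact pow_le_pow_left₀ hε.le hω 2
  have h2 : Tendsto (fun n => ENNReal.ofReal ((∫ ω, (f n ω - g ω) ^ 2 ∂μ) / ε ^ 2)) atTop (𝓝 0) := by
    have := ENNReal.tendsto_ofReal (hlim.div_const (ε ^ 2))
    simpa using this
  exact tendsto_of_tendsto_of_tendsto_of_le_of_le tendsto_const_nhds h2 (fun _ => zero_le) h1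

/-! ### Sums over increasing pairs and triples of indices -/

/-- The pairs `(j, i)` with `i < j < n`. -/
def pairIdx (n : ℕ) : Finset (ℕ × ℕ) :=
  (Finset.range n ×ˢ Finset.range n).filter fun p => p.2 < p.1

/-- The triples `(k, j, i)` with `i < j < k < n`. -/
def tripleIdx (n : ℕ) : Finset (ℕ × ℕ × ℕ) :=
  (Finset.range n ×ˢ Finset.range n ×ˢ Finset.range n).filter
    fun t => t.2.2 < t.2.1 ∧ t.2.1 < t.1

theorem mem_pairIdx {n : ℕ} {p : ℕ × ℕ} : p ∈ pairIdx n ↔ p.1 < n ∧ p.2 < p.1 := by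
  simp only [pairIdx, Finset.mem_filter, Finset.mem_product, Finset.mem_range]
  omega

theorem mem_tripleIdx {n : ℕ} {t : ℕ × ℕ × ℕ} :
    t ∈ tripleIdx n ↔ t.1 < n ∧ t.2.1 < t.1 ∧ t.2.2 < t.2.1 := by
  simp only [tripleIdx, Finset.mem_filter, Finset.mem_product, Finset.mem_range]
  omega

theorem sum_pairIdx {M : Type*} [AddCommMonoid M] (n : ℕ) (f : ℕ × ℕ → M) :
    ∑ p ∈ pairIdx n, f p = ∑ j ∈ Finset.range n, ∑ i ∈ Finset.range j, f (j, i) :=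
  Finset.sum_finset_product _ _ _ fun p => by simp [mem_pairIdx]

theorem sum_tripleIdx {M : Type*} [AddCommMonoid M] (n : ℕ) (f : ℕ × ℕ × ℕ → M) :
    ∑ t ∈ tripleIdx n, f t = ∑ k ∈ Finset.range n, ∑ p ∈ pairIdx k, f (k, p) :=
  Finset.sum_finset_product _ _ _ fun p => by simp [mem_pairIdx, mem_tripleIdx]

/-- With the largest index stored first, passing from `n` to `n + 1` adds exactly the pairs with top
index `n`. This, and its analogue for triples, drives the inductions below. -/
theorem sum_pairIdx_succ {M : Type*} [AddCommMonoid M] (n : ℕ) (f : ℕ × ℕ → M) :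
    ∑ p ∈ pairIdx (n + 1), f p = ∑ p ∈ pairIdx n, f p + ∑ i ∈ Finset.range n, f (n, i) := by
  simp_rw [sum_pairIdx, Finset.sum_range_succ]

theorem sum_tripleIdx_succ {M : Type*} [AddCommMonoid M] (n : ℕ) (f : ℕ × ℕ × ℕ → M) :
    ∑ t ∈ tripleIdx (n + 1), f t = ∑ t ∈ tripleIdx n, f t + ∑ p ∈ pairIdx n, f (n, p) := by
  simp_rw [sum_tripleIdx, Finset.sum_range_succ]

theorem card_pairIdx (n : ℕ) : (pairIdx n).card = n.choose 2 := by
  induction n with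
  | zero => rfl
  | succ n ih =>
    rw [Finset.card_eq_sum_ones, sum_pairIdx_succ, ← Finset.card_eq_sum_ones, ih,
      Nat.choose_succ_succ' n 1]
    simp [add_comm]

theorem card_tripleIdx (n : ℕ) : (tripleIdx n).card = n.choose 3 := by
  induction n with
  | zero => rfl
  | succ n ih =>
    rw [Finset.card_eq_sum_ones, sum_tripleIdx_succ, ← Finset.card_eq_sum_ones, ih,
      Nat.choose_succ_succ' n 2, ← Finset.card_eq_sum_ones, card_pairIdx, add_comm]

theorem sum_pairIdx_add (n : ℕ) (g : ℕ → ℝ) :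
    ∑ p ∈ pairIdx n, (g p.1 + g p.2) = ((n : ℝ) - 1) * ∑ i ∈ Finset.range n, g i := by
  induction n with
  | zero => simp [pairIdx]
  | succ n ih =>
    rw [sum_pairIdx_succ, ih, Finset.sum_add_distrib, Finset.sum_range_succ]
    simp
    ring

/-- Each pair is contained in exactly `n - 2` triples. This weight appears when the pairwise part of
the Hoeffding decomposition is collected. -/
theorem sum_tripleIdx_pairs (n : ℕ) (f : ℕ → ℕ → ℝ) :
    ∑ t ∈ tripleIdx n, (f t.1 t.2.1 + f t.1 t.2.2 + f t.2.1 t.2.2)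
      = ((n : ℝ) - 2) * ∑ p ∈ pairIdx n, f p.1 p.2 := by
  induction n with
  | zero => simp [tripleIdx, pairIdx]
  | succ n ih =>
    rw [sum_tripleIdx_succ, ih, Finset.sum_add_distrib, sum_pairIdx_add n (f n),
      sum_pairIdx_succ]
    push_cast
    ring

theorem sq_sum_eq_pairIdx (n : ℕ) (g : ℕ → ℝ) :
    2 * ∑ p ∈ pairIdx n, g p.1 * g p.2
      = (∑ i ∈ Finset.range n, g i) ^ 2 - ∑ i ∈ Finset.range n, g i ^ 2 := by
  induction n with
  | zero => simp [pairIdx]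
  | succ n ih =>
    rw [sum_pairIdx_succ, mul_add, ih, Finset.sum_range_succ, Finset.sum_range_succ]
    simp only [← Finset.mul_sum]
    ring

theorem cast_choose_three (n : ℕ) :
    ((n.choose 3 : ℕ) : ℝ) = n * (n - 1) * (n - 2) / 6 := by
  induction n with
  | zero => simp
  | succ n ih =>
    rw [Nat.choose_succ_succ' n 2]
    push_cast
    rw [ih, Nat.cast_choose_two]
    ring

theorem cube_le_choose_three {n : ℕ} (hn : 3 ≤ n) :
    (n : ℝ) ^ 3 / 27 ≤ (n.choose 3 : ℕ) := by
  rw [cast_choose_three]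
  have h : (3 : ℝ) ≤ n := by exact_mod_cast hn
  -- The difference of the two sides is `n (n - 3) (7n - 6) / 54`; equality holds at `n = 3`.
  nlinarith [mul_nonneg (by linarith : (0 : ℝ) ≤ n) (mul_nonneg (by linarith : (0 : ℝ) ≤ (n : ℝ) - 3)
    (by linarith : (0 : ℝ) ≤ 7 * (n : ℝ) - 6))]

theorem statJ_eq_sum_tripleIdx (n : ℕ) (ω : ℕ → ℝ) :
    evalStat statJ n ω = ((n.choose 3 : ℕ) : ℝ)⁻¹ *
      ∑ t ∈ tripleIdx n, symKernel ![ω t.2.2, ω t.2.1, ω t.1] := by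
  rw [evalStat, statJ]
  congr 1
  have h1 : ∀ i : Fin n, Finset.Ioi i = Finset.univ.filter (fun j => i < j) := fun i => by
    ext j; simp
  have h2 : ∑ i : Fin n, ∑ j ∈ Finset.Ioi i, ∑ k ∈ Finset.Ioi j, symKernel ![ω i, ω j, ω k]
      = ∑ i : Fin n, ∑ j : Fin n, ∑ k : Fin n, if (i : ℕ) < j ∧ (j : ℕ) < k then
        symKernel ![ω i, ω j, ω k] else 0 := by
    refine Finset.sum_congr rfl fun i _ => ?_
    rw [h1, Finset.sum_filter]
    refine Finset.sum_congr rfl fun j _ => ?_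
    rw [h1, Finset.sum_filter]
    by_cases hij : i < j
    · simp [hij]
    · simp [hij]
  rw [h2]
  rw [Fin.sum_univ_eq_sum_range (fun i : ℕ => ∑ j : Fin n, ∑ k : Fin n, if i < (j : ℕ) ∧ (j : ℕ) < k
    then symKernel ![ω i, ω j, ω k] else 0)]
  have h3 : ∀ i : ℕ, ∑ j : Fin n, ∑ k : Fin n, (if i < (j : ℕ) ∧ (j : ℕ) < k
      then symKernel ![ω i, ω j, ω k] else 0) = ∑ j ∈ Finset.range n, ∑ k ∈ Finset.range n,
      (if i < j ∧ j < k then symKernel ![ω i, ω j, ω k] else 0) := by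
    intro i
    rw [Fin.sum_univ_eq_sum_range (fun j : ℕ => ∑ k : Fin n, if i < j ∧ j < k
      then symKernel ![ω i, ω j, ω k] else 0)]
    refine Finset.sum_congr rfl fun j _ => ?_
    rw [Fin.sum_univ_eq_sum_range (fun k : ℕ => if i < j ∧ j < k
      then symKernel ![ω i, ω j, ω k] else 0)]
  simp_rw [h3]
  rw [tripleIdx, Finset.sum_filter, Finset.sum_product, Finset.sum_comm]
  simp_rw [Finset.sum_product]
  rw [Finset.sum_comm]
  refine (Finset.sum_congr rfl fun i _ => Finset.sum_comm).trans ?_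
  rw [Finset.sum_comm]
  refine (Finset.sum_congr rfl fun i _ => Finset.sum_comm).trans ?_
  rfl

/-- A triple meeting `t` has one of its three positions filled by one of the at most three indices
of `t`, and the other two positions take at most `n²` values. -/
theorem card_filter_tripleIdx_inter_le (n : ℕ) (t : ℕ × ℕ × ℕ) :
    ((tripleIdx n).filter fun t' => ¬ Disjoint ({t.1, t.2.1, t.2.2} : Finset ℕ)
      {t'.1, t'.2.1, t'.2.2}).card ≤ 9 * n ^ 2 := by
  set U : Finset ℕ := {t.1, t.2.1, t.2.2} with hU
  have hUc : U.card ≤ 3 := Finset.card_le_three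
  have hsub : ((tripleIdx n).filter fun t' => ¬ Disjoint U {t'.1, t'.2.1, t'.2.2}) ⊆
      (U ×ˢ Finset.range n ×ˢ Finset.range n) ∪ ((Finset.range n ×ˢ U ×ˢ Finset.range n) ∪
        (Finset.range n ×ˢ Finset.range n ×ˢ U)) := by
    intro t' ht'
    rw [Finset.mem_filter, mem_tripleIdx, Finset.not_disjoint_iff] at ht'
    obtain ⟨⟨h1, h2, h3⟩, a, haU, ha⟩ := ht'
    simp only [Finset.mem_union, Finset.mem_product, Finset.mem_range]
    simp only [Finset.mem_insert, Finset.mem_singleton] at ha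
    rcases ha with rfl | rfl | rfl
    · exact Or.inl ⟨haU, by omega, by omega⟩
    · exact Or.inr (Or.inl ⟨by omega, haU, by omega⟩)
    · exact Or.inr (Or.inr ⟨by omega, by omega, haU⟩)
  refine (Finset.card_le_card hsub).trans ((Finset.card_union_le _ _).trans
    ((Nat.add_le_add_left (Finset.card_union_le _ _) _).trans ?_))
  simp only [Finset.card_product, Finset.card_range]
  nlinarith [Nat.mul_le_mul_right (n * n) hUc]

/-! ### Second moments of U-statistics and the weak law of large numbers -/

namespace IsBoundedKernel₃

variable {h : ℝ → ℝ → ℝ → ℝ} {C : ℝ}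

theorem integrable_section (hh : IsBoundedKernel₃ h C) (P : ProbabilityMeasure ℝ) (x y : ℝ) :
    Integrable (fun z => h x y z) (P : Measure ℝ) :=
  Integrable.of_bound (hh.measurable.comp (f := fun z : ℝ => (x, y, z))
    (by fun_prop)).aestronglyMeasurable C (.of_forall fun z => hh.bound x y z)

theorem integrable_mul (hh : IsBoundedKernel₃ h C) (P : ProbabilityMeasure ℝ)
    (t t' : ℕ × ℕ × ℕ) :
    Integrable (fun ω : ℕ → ℝ => h (ω t.2.2) (ω t.2.1) (ω t.1) * h (ω t'.2.2) (ω t'.2.1) (ω t'.1))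
      (sampleLaw P) :=
  Integrable.of_bound ((hh.measurable_eval _ _ _).mul
    (hh.measurable_eval _ _ _)).aestronglyMeasurable (C * C) (.of_forall fun ω => by
      rw [norm_mul]
      exact mul_le_mul (hh.bound _ _ _) (hh.bound _ _ _) (norm_nonneg _)
        ((abs_nonneg _).trans (hh.bound 0 0 0)))

theorem integral_mul_le (hh : IsBoundedKernel₃ h C) (P : ProbabilityMeasure ℝ)
    (t t' : ℕ × ℕ × ℕ) :
    ∫ ω : ℕ → ℝ, h (ω t.2.2) (ω t.2.1) (ω t.1) * h (ω t'.2.2) (ω t'.2.1) (ω t'.1) ∂(sampleLaw P)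
      ≤ C ^ 2 :=
  (le_abs_self _).trans (abs_integral_le_of_abs_le fun ω => by
    rw [abs_mul, pow_two]
    exact mul_le_mul (hh.bound _ _ _) (hh.bound _ _ _) (abs_nonneg _)
      ((abs_nonneg _).trans (hh.bound 0 0 0)))

/-- Terms with disjoint triples are uncorrelated, so each triple interacts with only `O(n²)` others.
After division by the square of the binomial coefficient the bound is `O(1/n)`. -/
theorem integral_sq_sum_le_of_centered (hh : IsBoundedKernel₃ h C) (P : ProbabilityMeasure ℝ)
    (h0 : ∫ x, ∫ y, ∫ z, h x y z ∂(P : Measure ℝ) ∂(P : Measure ℝ) ∂(P : Measure ℝ) = 0) (n : ℕ) :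
    ∫ ω, (∑ t ∈ tripleIdx n, h (ω t.2.2) (ω t.2.1) (ω t.1)) ^ 2 ∂(sampleLaw P)
      ≤ (n.choose 3 : ℕ) * (9 * (n : ℝ) ^ 2 * C ^ 2) := by
  refine (integral_sq_sum_le (tripleIdx n) _ (fun t t' => ¬ Disjoint
    ({t.1, t.2.1, t.2.2} : Finset ℕ) {t'.1, t'.2.1, t'.2.2}) (hh.integrable_mul P) ?_
    fun t _ t' _ _ => hh.integral_mul_le P t t').trans ?_
  · intro t ht t' ht' hd
    rw [not_not] at hd
    obtain ⟨_, h2, h3⟩ := mem_tripleIdx.1 ht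
    have hne : ∀ a ∈ ({t.1, t.2.1, t.2.2} : Finset ℕ),
        t'.1 ≠ a ∧ t'.2.1 ≠ a ∧ t'.2.2 ≠ a := by
      intro a ha
      have := Finset.disjoint_left.1 hd ha
      simp only [Finset.mem_insert, Finset.mem_singleton, not_or] at this
      exact ⟨Ne.symm this.1, Ne.symm this.2.1, Ne.symm this.2.2⟩
    have hinv : ∀ a ∈ ({t.1, t.2.1, t.2.2} : Finset ℕ), ∀ (ω : ℕ → ℝ) (x : ℝ),
        h (Function.update ω a x t'.2.2) (Function.update ω a x t'.2.1)
          (Function.update ω a x t'.1) = h (ω t'.2.2) (ω t'.2.1) (ω t'.1) := by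
      intro a ha ω x
      obtain ⟨h1, h2, h3⟩ := hne a ha
      rw [Function.update_of_ne h1, Function.update_of_ne h2, Function.update_of_ne h3]
    rw [hh.integral_mul P (i := t.2.2) (j := t.2.1) (k := t.1) (by omega) (by omega) (by omega)
      (hh.measurable_eval _ _ _) (fun ω => hh.bound _ _ _) (hinv _ (by simp)) (hinv _ (by simp))
      (hinv _ (by simp)), h0, zero_mul]
  · rw [← card_tripleIdx, ← nsmul_eq_mul, ← Finset.sum_const]
    refine Finset.sum_le_sum fun t _ => mul_le_mul_of_nonneg_right ?_ (sq_nonneg C)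
    exact_mod_cast card_filter_tripleIdx_inter_le n t

/-- Of two different triples, the first has an index missing from the second. Averaging over that
coordinate kills the mixed moment, so only the diagonal remains. -/
theorem integral_sq_sum_le_of_degenerate (hh : IsBoundedKernel₃ h C) (P : ProbabilityMeasure ℝ)
    (hx : ∀ y z, ∫ x, h x y z ∂(P : Measure ℝ) = 0) (hy : ∀ x z, ∫ y, h x y z ∂(P : Measure ℝ) = 0)
    (hz : ∀ x y, ∫ z, h x y z ∂(P : Measure ℝ) = 0) (n : ℕ) :
    ∫ ω, (∑ t ∈ tripleIdx n, h (ω t.2.2) (ω t.2.1) (ω t.1)) ^ 2 ∂(sampleLaw P)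
      ≤ (n.choose 3 : ℕ) * C ^ 2 := by
  refine (integral_sq_sum_le (tripleIdx n) _ (fun t t' => t = t') (hh.integrable_mul P) ?_
    fun t _ t' _ _ => hh.integral_mul_le P t t').trans ?_
  · intro t ht t' ht' hne
    obtain ⟨_, h2, h3⟩ := mem_tripleIdx.1 ht
    obtain ⟨_, h2', h3'⟩ := mem_tripleIdx.1 ht'
    have hC : 0 ≤ C := (abs_nonneg _).trans (hh.bound 0 0 0)
    have key : ∀ a, t'.1 ≠ a → t'.2.1 ≠ a → t'.2.2 ≠ a →
        (∀ ω : ℕ → ℝ, ∫ x, h (Function.update ω a x t.2.2) (Function.update ω a x t.2.1)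
          (Function.update ω a x t.1) ∂(P : Measure ℝ) = 0) →
        ∫ ω, h (ω t.2.2) (ω t.2.1) (ω t.1) * h (ω t'.2.2) (ω t'.2.1) (ω t'.1) ∂(sampleLaw P)
          = 0 := by
      intro a h1 h2 h3 h4
      rw [integral_sampleLaw_update P a (f := fun ω => h (ω t.2.2) (ω t.2.1) (ω t.1) *
          h (ω t'.2.2) (ω t'.2.1) (ω t'.1))
        ((hh.measurable_eval _ _ _).mul (hh.measurable_eval _ _ _)) (C := C * C) (fun ω => by
          rw [abs_mul]
          exact mul_le_mul (hh.bound _ _ _) (hh.bound _ _ _) (abs_nonneg _) hC)]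
      simp only [Function.update_of_ne h1, Function.update_of_ne h2, Function.update_of_ne h3,
        integral_mul_const, h4, zero_mul, integral_zero]
    -- If every index of `t` occurred in `t'`, monotonicity of both triples would force them to be
    -- equal.
    have hcases : (t'.1 ≠ t.1 ∧ t'.2.1 ≠ t.1 ∧ t'.2.2 ≠ t.1) ∨
        (t'.1 ≠ t.2.1 ∧ t'.2.1 ≠ t.2.1 ∧ t'.2.2 ≠ t.2.1) ∨
        (t'.1 ≠ t.2.2 ∧ t'.2.1 ≠ t.2.2 ∧ t'.2.2 ≠ t.2.2) := by
      by_contra hcon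
      refine hne (Prod.ext ?_ (Prod.ext ?_ ?_)) <;> omega
    rcases hcases with ⟨h1, h4, h5⟩ | ⟨h1, h4, h5⟩ | ⟨h1, h4, h5⟩
    · refine key _ h1 h4 h5 fun ω => ?_
      simp only [Function.update_self, Function.update_of_ne (show t.2.2 ≠ t.1 by omega),
        Function.update_of_ne (show t.2.1 ≠ t.1 by omega), hz]
    · refine key _ h1 h4 h5 fun ω => ?_
      simp only [Function.update_self, Function.update_of_ne (show t.2.2 ≠ t.2.1 by omega),
        Function.update_of_ne (show t.1 ≠ t.2.1 by omega), hy]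
    · refine key _ h1 h4 h5 fun ω => ?_
      simp only [Function.update_self, Function.update_of_ne (show t.1 ≠ t.2.2 by omega),
        Function.update_of_ne (show t.2.1 ≠ t.2.2 by omega), hx]
  · rw [← card_tripleIdx, ← nsmul_eq_mul, ← Finset.sum_const]
    refine Finset.sum_le_sum fun t ht => ?_
    rw [Finset.filter_eq, if_pos ht]
    simp

theorem tendstoInMeasure_average (hh : IsBoundedKernel₃ h C) (P : ProbabilityMeasure ℝ) :
    TendstoInMeasure (sampleLaw P)
      (fun n ω => ((n.choose 3 : ℕ) : ℝ)⁻¹ * ∑ t ∈ tripleIdx n, h (ω t.2.2) (ω t.2.1) (ω t.1)) atTop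
      fun _ => ∫ x, ∫ y, ∫ z, h x y z ∂(P : Measure ℝ) ∂(P : Measure ℝ) ∂(P : Measure ℝ) := by
  set m := ∫ x, ∫ y, ∫ z, h x y z ∂(P : Measure ℝ) ∂(P : Measure ℝ) ∂(P : Measure ℝ) with hm
  have hg : IsBoundedKernel₃ (fun x y z => h x y z - m) (C + |m|) :=
    ⟨hh.measurable.sub_const m, fun x y z =>
      (abs_sub _ _).trans (add_le_add_left (hh.bound x y z) _)⟩
  have hK := hh.isBoundedKernel_integral P
  have hg0 : ∫ x, ∫ y, ∫ z, (h x y z - m) ∂(P : Measure ℝ) ∂(P : Measure ℝ) ∂(P : Measure ℝ) = 0 := by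
    have h1 : ∀ x y, ∫ z, (h x y z - m) ∂(P : Measure ℝ)
        = (∫ z, h x y z ∂(P : Measure ℝ)) - m := by
      intro x y
      rw [integral_sub (hh.integrable_section P x y) (integrable_const _)]
      simp
    have h2 : ∀ x, ∫ y, ((∫ z, h x y z ∂(P : Measure ℝ)) - m) ∂(P : Measure ℝ)
        = (∫ y, ∫ z, h x y z ∂(P : Measure ℝ) ∂(P : Measure ℝ)) - m := by
      intro x
      rw [integral_sub ((hK.memLp_section _ x).integrable (by norm_num)) (integrable_const _)]
      simp
    simp_rw [h1, h2]
    have h3 : Integrable (fun x => ∫ y, ∫ z, h x y z ∂(P : Measure ℝ) ∂(P : Measure ℝ))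
      (P : Measure ℝ) := (hK.integrable_prod _).integral_prod_left
    rw [integral_sub h3 (integrable_const _), ← hm]
    simp
  have hmeas : ∀ n, Measurable fun ω : ℕ → ℝ =>
      ∑ t ∈ tripleIdx n, (h (ω t.2.2) (ω t.2.1) (ω t.1) - m) := fun n =>
    Finset.measurable_fun_sum _ fun t _ => hg.measurable_eval _ _ _
  have hsplit : ∀ n, 3 ≤ n → ∀ ω : ℕ → ℝ,
      ((n.choose 3 : ℕ) : ℝ)⁻¹ * ∑ t ∈ tripleIdx n, h (ω t.2.2) (ω t.2.1) (ω t.1) - m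
      = ((n.choose 3 : ℕ) : ℝ)⁻¹ * ∑ t ∈ tripleIdx n, (h (ω t.2.2) (ω t.2.1) (ω t.1) - m) := by
    intro n hn ω
    have : ((n.choose 3 : ℕ) : ℝ) ≠ 0 := by exact_mod_cast (Nat.choose_pos hn).ne'
    rw [Finset.sum_sub_distrib, Finset.sum_const, card_tripleIdx, nsmul_eq_mul]
    field_simp
  have hCm : 0 ≤ C + |m| := (abs_nonneg _).trans (hg.bound 0 0 0)
  have hCh : 0 ≤ C := (abs_nonneg _).trans (hh.bound 0 0 0)
  refine tendstoInMeasure_of_tendsto_integral_sq (fun n => ?_) ?_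
  · refine Integrable.of_bound (Measurable.aestronglyMeasurable ?_)
      ((((n.choose 3 : ℕ) : ℝ)⁻¹ * ∑ t ∈ tripleIdx n, C + |m|) ^ 2) (.of_forall fun ω => ?_)
    · exact (((Finset.measurable_fun_sum _ fun t _ =>
        hh.measurable_eval _ _ _).const_mul _).sub_const m).pow_const 2
    · rw [norm_pow]
      refine pow_le_pow_left₀ (norm_nonneg _) ((norm_sub_le _ _).trans (add_le_add_left ?_ _)) 2
      rw [norm_mul, Real.norm_of_nonneg (by positivity)]
      exact mul_le_mul_of_nonneg_left (norm_sum_le_of_le _ fun t _ => hh.bound _ _ _)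
        (by positivity)
  -- Here `243 = 9 · 27`: the factor `9` counts intersecting triples and `27` comes from `n³/27 ≤
  -- n.choose 3`.
  · have hbound : ∀ n, 3 ≤ n → ∫ ω, (((n.choose 3 : ℕ) : ℝ)⁻¹ *
        ∑ t ∈ tripleIdx n, h (ω t.2.2) (ω t.2.1) (ω t.1) - m) ^ 2 ∂(sampleLaw P)
        ≤ 243 * (C + |m|) ^ 2 / n := by
      intro n hn
      have hn0 : (0 : ℝ) < n := by exact_mod_cast (by omega : 0 < n)
      have hc3 := cube_le_choose_three hn
      have hcpos : (0 : ℝ) < (n.choose 3 : ℕ) := by exact_mod_cast Nat.choose_pos hn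
      simp_rw [hsplit n hn, mul_pow, integral_const_mul]
      refine (mul_le_mul_of_nonneg_left (hg.integral_sq_sum_le_of_centered P hg0 n)
        (by positivity)).trans ?_
      rw [inv_pow, inv_mul_le_iff₀ (by positivity), mul_div_assoc', le_div_iff₀ hn0]
      have : (n : ℝ) ^ 3 * 9 ≤ 243 * (n.choose 3 : ℕ) := by linarith
      calc ((n.choose 3 : ℕ) : ℝ) * (9 * (n : ℝ) ^ 2 * (C + |m|) ^ 2) * n
          = (n.choose 3 : ℕ) * (C + |m|) ^ 2 * ((n : ℝ) ^ 3 * 9) := by ring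
        _ ≤ (n.choose 3 : ℕ) * (C + |m|) ^ 2 * (243 * (n.choose 3 : ℕ)) :=
            mul_le_mul_of_nonneg_left this (by positivity)
        _ = _ := by ring
    refine squeeze_zero' (.of_forall fun n => integral_nonneg fun ω => sq_nonneg _)
      ((eventually_ge_atTop 3).mono hbound) ?_
    exact tendsto_const_div_atTop_nhds_zero_nat _

end IsBoundedKernel₃

namespace IsBoundedKernel

variable {K : ℝ → ℝ → ℝ} {C : ℝ}

theorem measurable_eval (hK : IsBoundedKernel K C) (i j : ℕ) :
    Measurable fun ω : ℕ → ℝ => K (ω i) (ω j) :=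
  hK.measurable.comp (f := fun ω : ℕ → ℝ => (ω i, ω j)) (by fun_prop)

/-- The bound keeps `∬ K²` instead of a supremum, because it will be applied to the truncation error
of the eigenfunction expansion, which is controlled only in `L²`. -/
theorem integral_sq_sum_le_of_degenerate (hK : IsBoundedKernel K C) (P : ProbabilityMeasure ℝ)
    (hs : ∀ x y, K x y = K y x) (h0 : ∀ x, ∫ y, K x y ∂(P : Measure ℝ) = 0) (n : ℕ) :
    ∫ ω, (∑ p ∈ pairIdx n, K (ω p.1) (ω p.2)) ^ 2 ∂(sampleLaw P)
      ≤ (n.choose 2 : ℕ) * ∫ x, ∫ y, K x y ^ 2 ∂(P : Measure ℝ) ∂(P : Measure ℝ) := by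
  have hC : 0 ≤ C := (abs_nonneg _).trans (hK.bound 0 0)
  have hprod : ∀ p p' : ℕ × ℕ, ∀ ω : ℕ → ℝ, |K (ω p.1) (ω p.2) * K (ω p'.1) (ω p'.2)| ≤ C * C := by
    intro p p' ω
    rw [abs_mul]
    exact mul_le_mul (hK.bound _ _) (hK.bound _ _) (abs_nonneg _) hC
  have hmeas : ∀ p p' : ℕ × ℕ, Measurable fun ω : ℕ → ℝ =>
      K (ω p.1) (ω p.2) * K (ω p'.1) (ω p'.2) := fun p p' =>
    (hK.measurable_eval _ _).mul (hK.measurable_eval _ _)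
  refine (integral_sq_sum_le (pairIdx n) _ (fun p p' => p = p')
    (fun p p' => Integrable.of_bound (hmeas p p').aestronglyMeasurable _
      (.of_forall (hprod p p'))) ?_ (B := ∫ x, ∫ y, K x y ^ 2 ∂(P : Measure ℝ) ∂(P : Measure ℝ))
    ?_).trans ?_
  · intro p hp p' hp' hne
    obtain ⟨_, h2⟩ := mem_pairIdx.1 hp
    obtain ⟨_, h2'⟩ := mem_pairIdx.1 hp'
    have h0' : ∀ y, ∫ x, K x y ∂(P : Measure ℝ) = 0 := fun y => by
      simp_rw [hs _ y]; exact h0 y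
    have hcases : (p'.1 ≠ p.1 ∧ p'.2 ≠ p.1) ∨ (p'.1 ≠ p.2 ∧ p'.2 ≠ p.2) := by
      by_contra hcon
      exact hne (Prod.ext (by omega) (by omega))
    rcases hcases with ⟨h3, h4⟩ | ⟨h3, h4⟩
    · rw [integral_sampleLaw_update P p.1 (hmeas p p') (hprod p p')]
      simp only [Function.update_of_ne h3, Function.update_of_ne h4, Function.update_self,
        Function.update_of_ne h2.ne, integral_mul_const, h0', zero_mul, integral_zero]
    · rw [integral_sampleLaw_update P p.2 (hmeas p p') (hprod p p')]
      simp only [Function.update_of_ne h3, Function.update_of_ne h4, Function.update_self,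
        Function.update_of_ne h2.ne', integral_mul_const, h0, zero_mul, integral_zero]
  · rintro p hp _ _ rfl
    obtain ⟨_, h2⟩ := mem_pairIdx.1 hp
    simp_rw [← pow_two]
    exact (integral_sampleLaw_eval₂ P h2.ne' hK.sq).le
  · rw [← card_pairIdx, ← nsmul_eq_mul, ← Finset.sum_const]
    refine Finset.sum_le_sum fun t ht => ?_
    rw [Finset.filter_eq, if_pos ht]
    simp

end IsBoundedKernel

/-! ### The kernel `Φ` and its Hoeffding decomposition under a symmetric law -/

/-- The kernel `rawKernel` as a function of three variables. -/
noncomputable def rawKernel₃ (x y z : ℝ) : ℝ :=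
  (if |x - y| < |z| then 1 else 0) - (if |x + y| < |z| then 1 else 0)

theorem rawKernel₃_comm (x y z : ℝ) : rawKernel₃ x y z = rawKernel₃ y x z := by
  rw [rawKernel₃, rawKernel₃, abs_sub_comm, add_comm]

theorem univ_perm_fin_three : (Finset.univ : Finset (Equiv.Perm (Fin 3))) =
    {1, Equiv.swap 0 1, Equiv.swap 0 2, Equiv.swap 1 2, Equiv.swap 0 1 * Equiv.swap 1 2,
      Equiv.swap 1 2 * Equiv.swap 0 1} := by
  decide

/-- The raw kernel is symmetric in its first two arguments, so the six permutations pair up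
according to which variable is the threshold. -/
theorem symKernel_vec (x y z : ℝ) : symKernel ![x, y, z] =
    1 / 3 * (rawKernel₃ x y z + rawKernel₃ x z y + rawKernel₃ y z x) := by
  have h : ∀ π : Equiv.Perm (Fin 3), rawKernel (fun i => (![x, y, z] : Fin 3 → ℝ) (π i))
      = rawKernel₃ ((![x, y, z] : Fin 3 → ℝ) (π 0)) ((![x, y, z] : Fin 3 → ℝ) (π 1))
        ((![x, y, z] : Fin 3 → ℝ) (π 2)) := fun π => rfl
  have e1 : ((Equiv.swap 0 1 : Equiv.Perm (Fin 3)) 0 = 1 ∧ (Equiv.swap 0 1 : Equiv.Perm (Fin 3)) 1 = 0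
    ∧ (Equiv.swap 0 1 : Equiv.Perm (Fin 3)) 2 = 2) := by decide
  have e2 : ((Equiv.swap 0 2 : Equiv.Perm (Fin 3)) 0 = 2 ∧ (Equiv.swap 0 2 : Equiv.Perm (Fin 3)) 1 = 1
    ∧ (Equiv.swap 0 2 : Equiv.Perm (Fin 3)) 2 = 0) := by decide
  have e3 : ((Equiv.swap 1 2 : Equiv.Perm (Fin 3)) 0 = 0 ∧ (Equiv.swap 1 2 : Equiv.Perm (Fin 3)) 1 = 2
    ∧ (Equiv.swap 1 2 : Equiv.Perm (Fin 3)) 2 = 1) := by decide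
  rw [symKernel, univ_perm_fin_three]
  simp_rw [h]
  rw [Finset.sum_insert (by decide), Finset.sum_insert (by decide), Finset.sum_insert (by decide),
    Finset.sum_insert (by decide), Finset.sum_insert (by decide), Finset.sum_singleton]
  simp only [Equiv.Perm.coe_mul, Function.comp_apply, Equiv.Perm.coe_one, id_eq, e1, e2, e3]
  simp only [Matrix.cons_val_zero, Matrix.cons_val_one, Matrix.cons_val]
  rw [rawKernel₃_comm y x z, rawKernel₃_comm z y x, rawKernel₃_comm z x y]
  simp only [Nat.factorial]
  push_cast
  ring

theorem symKernel_swap_right (x y z : ℝ) : symKernel ![x, y, z] = symKernel ![x, z, y] := by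
  rw [symKernel_vec, symKernel_vec, rawKernel₃_comm y z x]; ring

theorem symKernel_swap_left (x y z : ℝ) : symKernel ![x, y, z] = symKernel ![y, x, z] := by
  rw [symKernel_vec, symKernel_vec, rawKernel₃_comm y x z]; ring

theorem abs_rawKernel₃_le (x y z : ℝ) : |rawKernel₃ x y z| ≤ 1 := by
  rw [rawKernel₃]; split_ifs <;> simp

theorem isBoundedKernel₃_rawKernel₃ : IsBoundedKernel₃ rawKernel₃ 1 where
  measurable := by
    refine Measurable.sub (Measurable.ite (measurableSet_lt ?_ ?_) measurable_const measurable_const)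
      (Measurable.ite (measurableSet_lt ?_ ?_) measurable_const measurable_const) <;>
    exact Measurable.abs (by fun_prop)
  bound := abs_rawKernel₃_le

theorem isBoundedKernel₃_symKernel : IsBoundedKernel₃ (fun x y z => symKernel ![x, y, z]) 1 where
  measurable := by
    simp_rw [symKernel_vec]
    refine Measurable.const_mul ((Measurable.add ?_ ?_).add ?_) _
    · exact isBoundedKernel₃_rawKernel₃.measurable
    · exact isBoundedKernel₃_rawKernel₃.measurable.comp
        (f := fun p : ℝ × ℝ × ℝ => (p.1, p.2.2, p.2.1)) (by fun_prop)
    · exact isBoundedKernel₃_rawKernel₃.measurable.comp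
        (f := fun p : ℝ × ℝ × ℝ => (p.2.1, p.2.2, p.1)) (by fun_prop)
  bound x y z := by
    rw [symKernel_vec, abs_le]
    have h1 := abs_le.1 (abs_rawKernel₃_le x y z)
    have h2 := abs_le.1 (abs_rawKernel₃_le x z y)
    have h3 := abs_le.1 (abs_rawKernel₃_le y z x)
    constructor <;> linarith [h1.1, h1.2, h2.1, h2.2, h3.1, h3.2]

section Symmetric

variable {P : ProbabilityMeasure ℝ}

theorem map_neg_eq_of_cdf_symmetric [NullSingletonClass (P : Measure ℝ)]
    (hsym : ∀ x, 1 - cdf (P : Measure ℝ) x - cdf (P : Measure ℝ) (-x) = 0) :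
    (P : Measure ℝ).map (fun x => -x) = P := by
  have hp : IsProbabilityMeasure ((P : Measure ℝ).map (fun x => -x)) :=
    Measure.isProbabilityMeasure_map measurable_neg.aemeasurable
  refine Measure.ext_of_Iic _ _ fun a => ?_
  rw [Measure.map_apply measurable_neg measurableSet_Iic]
  have h1 : (fun x : ℝ => -x) ⁻¹' Set.Iic a = Set.Ici (-a) := by
    ext x; simp
  rw [h1]
  have h2 : (P : Measure ℝ) (Set.Ici (-a)) = (P : Measure ℝ) (Set.Ioi (-a)) :=
    measure_congr Ioi_ae_eq_Ici.symm
  rw [h2, ← ENNReal.toReal_eq_toReal_iff' (measure_ne_top _ _) (measure_ne_top _ _)]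
  have h3 : Set.Ioi (-a) = (Set.Iic (-a))ᶜ := by simp
  change (P : Measure ℝ).real _ = (P : Measure ℝ).real _
  rw [h3, probReal_compl_eq_one_sub measurableSet_Iic, ← cdf_eq_real, ← cdf_eq_real]
  linarith [hsym a]

theorem integral_comp_neg_of_map_neg (hneg : (P : Measure ℝ).map (fun x => -x) = P)
    (f : ℝ → ℝ) : ∫ x, f (-x) ∂(P : Measure ℝ) = ∫ x, f x ∂(P : Measure ℝ) := by
  conv_rhs => rw [← hneg]
  exact (integral_map_equiv (MeasurableEquiv.neg ℝ) f).symm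

/-- By symmetry and absence of atoms, `P(|Z| > a) = 2 (1 - F(a))` for `a ≥ 0`. -/
theorem integral_rawKernel₃_right [NullSingletonClass (P : Measure ℝ)]
    (hsym : ∀ x, 1 - cdf (P : Measure ℝ) x - cdf (P : Measure ℝ) (-x) = 0) (x y : ℝ) :
    ∫ z, rawKernel₃ x y z ∂(P : Measure ℝ)
      = 2 * (cdf (P : Measure ℝ) |x + y| - cdf (P : Measure ℝ) |x - y|) := by
  have h1 : ∀ a : ℝ, 0 ≤ a → ∫ z, (if a < |z| then (1 : ℝ) else 0) ∂(P : Measure ℝ)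
      = 2 * (1 - cdf (P : Measure ℝ) a) := by
    intro a ha
    have h2 : (fun z : ℝ => if a < |z| then (1 : ℝ) else 0)
        = ({z : ℝ | a < |z|}).indicator 1 := by
      ext z; simp [Set.indicator]
    have h3 : {z : ℝ | a < |z|} = (Set.Iic a)ᶜ ∪ Set.Iio (-a) := by
      ext z; simp [lt_abs, lt_neg]
    have hd : Disjoint (Set.Iic a)ᶜ (Set.Iio (-a)) := by
      rw [Set.disjoint_left]
      intro z hz hz'
      simp at hz hz'
      linarith
    rw [h2, h3, integral_indicator_one (by measurability),
      measureReal_union hd measurableSet_Iio, probReal_compl_eq_one_sub measurableSet_Iic,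
      measureReal_congr Iio_ae_eq_Iic, ← cdf_eq_real, ← cdf_eq_real]
    linarith [hsym a]
  have hint : ∀ a : ℝ, Integrable (fun z : ℝ => if a < |z| then (1 : ℝ) else 0) (P : Measure ℝ) :=
    fun a => Integrable.of_bound ((Measurable.ite (measurableSet_lt measurable_const
      measurable_id.abs) measurable_const measurable_const).aestronglyMeasurable) 1
      (.of_forall fun z => by split_ifs <;> simp)
  simp only [rawKernel₃]
  rw [integral_sub (hint _) (hint _), h1 _ (abs_nonneg _), h1 _ (abs_nonneg _)]
  ring

/-- Negating `z` exchanges `|x - z|` and `|x + z|`, so the integrand is odd in `z`. -/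
theorem integral_rawKernel₃_mid (hneg : (P : Measure ℝ).map (fun x => -x) = P) (x y : ℝ) :
    ∫ z, rawKernel₃ x z y ∂(P : Measure ℝ) = 0 := by
  have h1 := integral_comp_neg_of_map_neg hneg fun z => rawKernel₃ x z y
  have h2 : ∀ z, rawKernel₃ x (-z) y = - rawKernel₃ x z y := by
    intro z
    simp only [rawKernel₃, sub_neg_eq_add, ← sub_eq_add_neg]
    ring
  simp only [h2, integral_neg] at h1
  linarith

theorem phi_comm (F : ℝ → ℝ) (x y : ℝ) : phi F x y = phi F y x := by
  rw [phi, phi, add_comm, abs_sub_comm]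

theorem phi_neg_right (F : ℝ → ℝ) (x y : ℝ) : phi F x (-y) = -phi F x y := by
  simp only [phi, sub_neg_eq_add, ← sub_eq_add_neg]
  ring

theorem integral_phi (hneg : (P : Measure ℝ).map (fun x => -x) = P) (F : ℝ → ℝ) (x : ℝ) :
    ∫ y, phi F x y ∂(P : Measure ℝ) = 0 := by
  have h1 := integral_comp_neg_of_map_neg hneg fun y => phi F x y
  simp only [phi_neg_right, integral_neg] at h1
  linarith

/-- Only the term whose threshold is the integrated variable survives; its factor `1/3 · 2` is the
`2/3` of `phi`. -/
theorem integral_symKernel [NullSingletonClass (P : Measure ℝ)]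
    (hsym : ∀ x, 1 - cdf (P : Measure ℝ) x - cdf (P : Measure ℝ) (-x) = 0) (x y : ℝ) :
    ∫ z, symKernel ![x, y, z] ∂(P : Measure ℝ) = phi (cdf (P : Measure ℝ)) x y := by
  have hneg := map_neg_eq_of_cdf_symmetric hsym
  have hi1 := isBoundedKernel₃_rawKernel₃.integrable_section P x y
  have hi : ∀ a b, Integrable (fun z => rawKernel₃ a z b) (P : Measure ℝ) := fun a b =>
    Integrable.of_bound (isBoundedKernel₃_rawKernel₃.measurable.comp
      (f := fun z : ℝ => (a, z, b)) (by fun_prop)).aestronglyMeasurable 1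
      (.of_forall fun z => abs_rawKernel₃_le _ _ _)
  have hi2 : Integrable (fun z => rawKernel₃ x y z + rawKernel₃ x z y) (P : Measure ℝ) :=
    hi1.add (hi x y)
  simp_rw [symKernel_vec]
  rw [integral_const_mul, integral_add hi2 (hi y x), integral_add hi1 (hi x y),
    integral_rawKernel₃_mid hneg, integral_rawKernel₃_mid hneg, integral_rawKernel₃_right hsym, phi]
  ring

theorem continuous_cdf_of_noAtoms [NullSingletonClass (P : Measure ℝ)] : Continuous (cdf (P : Measure ℝ)) := by
  rw [continuous_iff_continuousAt]
  intro x
  rw [(cdf (P : Measure ℝ)).mono.continuousAt_iff_leftLim_eq_rightLim,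
    StieltjesFunction.rightLim_eq]
  have h := (cdf (P : Measure ℝ)).measure_singleton x
  rw [measure_cdf, measure_singleton] at h
  have h2 := ENNReal.ofReal_eq_zero.1 h.symm
  exact le_antisymm ((cdf (P : Measure ℝ)).mono.leftLim_le le_rfl) (by linarith)

theorem continuous_phi [NullSingletonClass (P : Measure ℝ)] :
    Continuous fun p : ℝ × ℝ => phi (cdf (P : Measure ℝ)) p.1 p.2 := by
  have h := continuous_cdf_of_noAtoms (P := P)
  unfold phi
  fun_prop

theorem isBoundedKernel_phi [NullSingletonClass (P : Measure ℝ)] :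
    IsBoundedKernel (phi (cdf (P : Measure ℝ))) 1 where
  measurable := continuous_phi.measurable
  bound x y := by
    rw [phi, abs_le]
    have h1 := cdf_nonneg (P : Measure ℝ) |x + y|
    have h2 := cdf_nonneg (P : Measure ℝ) |x - y|
    have h3 := cdf_le_one (P : Measure ℝ) |x + y|
    have h4 := cdf_le_one (P : Measure ℝ) |x - y|
    constructor <;> linarith

/-- If `x y ≥ 0` then `|x - y| ≤ |x + y|`, and the inequality reverses if `x y ≤ 0`. By monotonicity
of `F` the kernel has the sign of `x y`, so multiplying by the signs of both variables makes it
nonnegative. -/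
theorem abs_phi_le {F : ℝ → ℝ} (hF : Monotone F) (x y : ℝ) :
    |phi F x y| ≤ phi F x y * (if y < 0 then -1 else 1) * (if x < 0 then -1 else 1) := by
  have key : ∀ a b : ℝ, 0 ≤ a * b → 0 ≤ phi F a b := by
    intro a b hab
    have : |a - b| ≤ |a + b| := by
      rw [← sq_le_sq]
      nlinarith
    have := hF this
    rw [phi]; linarith
  have key2 : ∀ a b : ℝ, a * b ≤ 0 → phi F a b ≤ 0 := by
    intro a b hab
    have h := key a (-b) (by nlinarith)
    rw [phi_neg_right] at h
    linarith
  split_ifs with h1 h2 h2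
  · rw [abs_of_nonneg (key x y (by nlinarith))]; linarith
  · rw [abs_of_nonpos (key2 x y (by nlinarith))]; linarith
  · rw [abs_of_nonpos (key2 x y (by nlinarith))]; linarith
  · rw [abs_of_nonneg (key x y (by nlinarith))]; linarith

/-- Symmetry gives the positive half-line mass `1/2`, so it contains a support point `x` of the law.
There `φ(x, x) = (2/3) P((0, 2x]) > 0`, and by continuity `φ` is nonzero on a neighbourhood of `(x,
x)`, which has positive product measure. -/
theorem integral_phi_sq_pos [NullSingletonClass (P : Measure ℝ)]
    (hsym : ∀ x, 1 - cdf (P : Measure ℝ) x - cdf (P : Measure ℝ) (-x) = 0) :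
    0 < ∫ x, ∫ y, phi (cdf (P : Measure ℝ)) x y ^ 2 ∂(P : Measure ℝ) ∂(P : Measure ℝ) := by
  have hK := isBoundedKernel_phi (P := P)
  have h0 : (P : Measure ℝ) (Set.Ioi 0) ≠ 0 := by
    intro h
    have h1 : (P : Measure ℝ).real (Set.Iic 0)ᶜ = 0 := by
      rw [Set.compl_Iic, Measure.real, h]; rfl
    rw [probReal_compl_eq_one_sub measurableSet_Iic, ← cdf_eq_real] at h1
    have := hsym 0
    rw [neg_zero] at this
    linarith
  obtain ⟨x, hx, hpos⟩ := exists_mem_forall_mem_nhdsWithin_pos_measure h0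
  have hx0 : 0 < x := hx
  have hpos' : ∀ t ∈ 𝓝 x, 0 < (P : Measure ℝ) t := fun t ht => hpos t (mem_nhdsWithin_of_mem_nhds ht)
  have hphi : phi (cdf (P : Measure ℝ)) x x ≠ 0 := by
    have h1 : 0 < (P : Measure ℝ).real (Set.Ioc 0 (x + x)) :=
      ENNReal.toReal_pos (hpos' _ (Ioc_mem_nhds hx0 (by linarith))).ne' (measure_ne_top _ _)
    have h2 : Set.Iic 0 ∪ Set.Ioc 0 (x + x) = Set.Iic (x + x) :=
      Set.Iic_union_Ioc_eq_Iic (by linarith)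
    have h3 := measureReal_union (μ := (P : Measure ℝ)) (s₁ := Set.Iic 0) (s₂ := Set.Ioc 0 (x + x))
      (Set.Iic_disjoint_Ioc le_rfl) measurableSet_Ioc
    rw [h2, ← cdf_eq_real, ← cdf_eq_real] at h3
    rw [phi, sub_self, abs_zero, abs_of_pos (by linarith), h3]
    have : 0 < 2 / 3 * ((P : Measure ℝ).real (Set.Ioc 0 (x + x))) := by positivity
    linarith
  have hnn : 0 ≤ fun p : ℝ × ℝ => phi (cdf (P : Measure ℝ)) p.1 p.2 ^ 2 := fun p => sq_nonneg _
  have hint := hK.sq.integrable_prod (P : Measure ℝ)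
  have hprod := integral_prod _ hint
  simp only [Function.uncurry] at hprod
  rw [← hprod, integral_pos_iff_support_of_nonneg hnn hint]
  have hopen : IsOpen (Function.support fun p : ℝ × ℝ => phi (cdf (P : Measure ℝ)) p.1 p.2 ^ 2) :=
    (continuous_phi.pow 2).isOpen_support
  have hmem : Function.support (fun p : ℝ × ℝ => phi (cdf (P : Measure ℝ)) p.1 p.2 ^ 2)
      ∈ 𝓝 (x, x) := hopen.mem_nhds (by simpa using hphi)
  obtain ⟨u, hu, v, hv, huv⟩ := mem_nhds_prod_iff.1 hmem
  refine lt_of_lt_of_le ?_ (measure_mono huv)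
  rw [Measure.prod_prod]
  exact ENNReal.mul_pos (hpos' u hu).ne' (hpos' v hv).ne'

/-- The completely degenerate part of the Hoeffding decomposition of `Φ`. -/
noncomputable def degKernel (F : ℝ → ℝ) (x y z : ℝ) : ℝ :=
  symKernel ![x, y, z] - (phi F z y + phi F z x + phi F y x)

theorem isBoundedKernel₃_degKernel [NullSingletonClass (P : Measure ℝ)] :
    IsBoundedKernel₃ (degKernel (cdf (P : Measure ℝ))) 4 where
  measurable := by
    have h := continuous_phi (P := P)
    refine isBoundedKernel₃_symKernel.measurable.sub (Measurable.add (Measurable.add ?_ ?_) ?_)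
    · exact h.measurable.comp (f := fun p : ℝ × ℝ × ℝ => (p.2.2, p.2.1)) (by fun_prop)
    · exact h.measurable.comp (f := fun p : ℝ × ℝ × ℝ => (p.2.2, p.1)) (by fun_prop)
    · exact h.measurable.comp (f := fun p : ℝ × ℝ × ℝ => (p.2.1, p.1)) (by fun_prop)
  bound x y z := by
    have h0 := abs_le.1 (isBoundedKernel₃_symKernel.bound x y z)
    have h1 := abs_le.1 ((isBoundedKernel_phi (P := P)).bound z y)
    have h2 := abs_le.1 ((isBoundedKernel_phi (P := P)).bound z x)
    have h3 := abs_le.1 ((isBoundedKernel_phi (P := P)).bound y x)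
    rw [degKernel, abs_le]
    constructor <;> linarith [h0.1, h0.2, h1.1, h1.2, h2.1, h2.2, h3.1, h3.2]

theorem degKernel_swap_right (F : ℝ → ℝ) (x y z : ℝ) : degKernel F x y z = degKernel F x z y := by
  rw [degKernel, degKernel, symKernel_swap_right, phi_comm F y z]; ring

theorem degKernel_swap_left (F : ℝ → ℝ) (x y z : ℝ) : degKernel F x y z = degKernel F y x z := by
  rw [degKernel, degKernel, symKernel_swap_left, phi_comm F x y]; ring

/-- Integrating `Φ` over `z` leaves `φ(x, y)`, which the last subtracted term cancels; the two
subtracted terms containing `z` have mean zero. -/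
theorem integral_degKernel [NullSingletonClass (P : Measure ℝ)]
    (hsym : ∀ x, 1 - cdf (P : Measure ℝ) x - cdf (P : Measure ℝ) (-x) = 0) (x y : ℝ) :
    ∫ z, degKernel (cdf (P : Measure ℝ)) x y z ∂(P : Measure ℝ) = 0 := by
  have hneg := map_neg_eq_of_cdf_symmetric hsym
  have hK := isBoundedKernel_phi (P := P)
  have hi : ∀ a, Integrable (fun z => phi (cdf (P : Measure ℝ)) z a) (P : Measure ℝ) := fun a => by
    simp_rw [phi_comm _ _ a]
    exact (hK.memLp_section _ a).integrable (by norm_num)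
  have hz : ∀ a, ∫ z, phi (cdf (P : Measure ℝ)) z a ∂(P : Measure ℝ) = 0 := fun a => by
    simp_rw [phi_comm _ _ a]
    exact integral_phi hneg _ a
  have h1 : Integrable (fun z => phi (cdf (P : Measure ℝ)) z y + phi (cdf (P : Measure ℝ)) z x)
    (P : Measure ℝ) := (hi y).add (hi x)
  have h2 : Integrable (fun z => phi (cdf (P : Measure ℝ)) z y + phi (cdf (P : Measure ℝ)) z x
    + phi (cdf (P : Measure ℝ)) y x) (P : Measure ℝ) := h1.add (integrable_const _)
  simp only [degKernel]
  rw [integral_sub (isBoundedKernel₃_symKernel.integrable_section P x y) h2,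
    integral_symKernel hsym, integral_add h1 (integrable_const _), integral_add (hi y) (hi x), hz, hz,
    phi_comm]
  simp

theorem integral_sq_sum_degKernel_le [NullSingletonClass (P : Measure ℝ)]
    (hsym : ∀ x, 1 - cdf (P : Measure ℝ) x - cdf (P : Measure ℝ) (-x) = 0) (n : ℕ) :
    ∫ ω, (∑ t ∈ tripleIdx n, degKernel (cdf (P : Measure ℝ)) (ω t.2.2) (ω t.2.1) (ω t.1)) ^ 2
      ∂(sampleLaw P) ≤ (n.choose 3 : ℕ) * 4 ^ 2 := by
  refine isBoundedKernel₃_degKernel.integral_sq_sum_le_of_degenerate P (fun y z => ?_)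
    (fun x z => ?_) (integral_degKernel hsym) n
  · simp_rw [degKernel_swap_left _ _ y z, degKernel_swap_right _ y _ z]
    exact integral_degKernel hsym y z
  · simp_rw [degKernel_swap_right _ x _ z]
    exact integral_degKernel hsym x z

theorem sum_symKernel_eq (F : ℝ → ℝ) (n : ℕ) (ω : ℕ → ℝ) :
    ∑ t ∈ tripleIdx n, symKernel ![ω t.2.2, ω t.2.1, ω t.1]
      = ∑ t ∈ tripleIdx n, degKernel F (ω t.2.2) (ω t.2.1) (ω t.1)
        + ((n : ℝ) - 2) * ∑ p ∈ pairIdx n, phi F (ω p.1) (ω p.2) := by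
  rw [← sum_tripleIdx_pairs n fun i j => phi F (ω i) (ω j), ← Finset.sum_add_distrib]
  refine Finset.sum_congr rfl fun t _ => ?_
  rw [degKernel]
  ring

end Symmetric

/-! ### Convergence in distribution through `L¹` approximation -/

theorem abs_integral_lipschitz_sub_le {Ω : Type*} [MeasurableSpace Ω] {μ : Measure Ω}
    [IsProbabilityMeasure μ] {F : ℝ → ℝ} {L : NNReal} (hF : LipschitzWith L F) {C : ℝ}
    (hC : ∀ x, |F x| ≤ C) {X Y : Ω → ℝ} (hX : AEMeasurable X μ) (hY : AEMeasurable Y μ)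
    (hint : Integrable (fun ω => X ω - Y ω) μ) :
    |∫ ω, F (X ω) ∂μ - ∫ ω, F (Y ω) ∂μ| ≤ L * ∫ ω, |X ω - Y ω| ∂μ := by
  have hi : ∀ {Z : Ω → ℝ}, AEMeasurable Z μ → Integrable (fun ω => F (Z ω)) μ := fun hZ =>
    Integrable.of_bound (hF.continuous.measurable.comp_aemeasurable hZ).aestronglyMeasurable C
      (.of_forall fun ω => hC _)
  rw [← integral_sub (hi hX) (hi hY), ← integral_const_mul]
  refine abs_integral_le_integral_abs.trans (integral_mono ((hi hX).sub (hi hY)).abs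
    (hint.abs.const_mul _) fun ω => ?_)
  simpa [Real.dist_eq] using hF.dist_le_mul (X ω) (Y ω)

/-- Convergence in distribution follows from that of approximations that are uniformly close
in `L¹`. -/
theorem tendstoInDistribution_of_forall_approx {Ω Ω' : Type*} [MeasurableSpace Ω]
    [MeasurableSpace Ω'] {μ : Measure Ω} [IsProbabilityMeasure μ] {μ' : Measure Ω'}
    [IsProbabilityMeasure μ'] {X : ℕ → Ω → ℝ} {Y : Ω' → ℝ} (hX : ∀ n, AEMeasurable (X n) μ)
    (hY : AEMeasurable Y μ')
    (h : ∀ ε > 0, ∃ (A : ℕ → Ω → ℝ) (W : Ω' → ℝ),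
      TendstoInDistribution A atTop W (fun _ => μ) μ' ∧
      (∀ n, Integrable (fun ω => X n ω - A n ω) μ) ∧
      (∀ᶠ n in atTop, ∫ ω, |X n ω - A n ω| ∂μ ≤ ε) ∧
      Integrable (fun ω => W ω - Y ω) μ' ∧ ∫ ω, |W ω - Y ω| ∂μ' ≤ ε) :
    TendstoInDistribution X atTop Y (fun _ => μ) μ' := by
  refine ⟨hX, hY, ?_⟩
  refine tendsto_iff_forall_lipschitz_integral_tendsto.2 ?_
  rintro F ⟨C, hFC⟩ ⟨L, hL⟩
  have hb : ∀ x, |F x| ≤ |F 0| + C := by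
    intro x
    have := hFC x 0
    rw [Real.dist_eq] at this
    have h2 := abs_sub_abs_le_abs_sub (F x) (F 0)
    linarith
  have hmap : ∀ {Z : Ω → ℝ}, AEMeasurable Z μ → ∫ x, F x ∂(μ.map Z) = ∫ ω, F (Z ω) ∂μ :=
    fun hZ => integral_map hZ hL.continuous.measurable.aestronglyMeasurable
  have hmap' : ∀ {Z : Ω' → ℝ}, AEMeasurable Z μ' → ∫ x, F x ∂(μ'.map Z) = ∫ ω, F (Z ω) ∂μ' :=
    fun hZ => integral_map hZ hL.continuous.measurable.aestronglyMeasurable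
  change Tendsto (fun n => ∫ x, F x ∂(μ.map (X n))) atTop (𝓝 (∫ x, F x ∂(μ'.map Y)))
  rw [hmap' hY]
  simp_rw [fun n => hmap (hX n)]
  rw [Metric.tendsto_atTop]
  intro ε hε
  -- Each of the two approximation errors then costs less than `ε/4`, leaving `ε/2` for the
  -- convergence of the approximants; `L + 1` avoids division by zero.
  obtain ⟨A, W, hAW, hi, hle, hi', hle'⟩ := h (ε / (4 * (L + 1))) (by positivity)
  have h1 : Tendsto (fun n => ∫ x, F x ∂(μ.map (A n))) atTop (𝓝 (∫ x, F x ∂(μ'.map W))) :=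
    (tendsto_iff_forall_lipschitz_integral_tendsto.1 hAW.tendsto) F ⟨C, hFC⟩ ⟨L, hL⟩
  rw [hmap' hAW.aemeasurable_limit] at h1
  simp_rw [fun n => hmap (hAW.forall_aemeasurable n)] at h1
  obtain ⟨N1, hN1⟩ := Metric.tendsto_atTop.1 h1 (ε / 2) (by positivity)
  obtain ⟨N2, hN2⟩ := eventually_atTop.1 hle
  refine ⟨max N1 N2, fun n hn => ?_⟩
  have hLb : (L : ℝ) * (ε / (4 * (L + 1))) < ε / 4 := by
    have hL0 : (0 : ℝ) ≤ L := L.coe_nonneg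
    rw [mul_div_assoc', div_lt_div_iff₀ (by positivity) (by norm_num)]
    nlinarith
  have h2 := abs_integral_lipschitz_sub_le hL hb (hX n) (hAW.forall_aemeasurable n) (hi n)
  have h3 := abs_integral_lipschitz_sub_le hL hb hAW.aemeasurable_limit hY hi'
  have h4 := hN1 n (le_trans (le_max_left _ _) hn)
  have h5 := mul_le_mul_of_nonneg_left (hN2 n (le_trans (le_max_right _ _) hn)) L.coe_nonneg
  have h6 := mul_le_mul_of_nonneg_left hle' L.coe_nonneg
  rw [Real.dist_eq] at h4 ⊢
  rw [abs_le] at h2 h3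
  rw [abs_lt] at h4 ⊢
  constructor <;> linarith [h2.1, h2.2, h3.1, h3.2, h4.1, h4.2]

/-! ### Central limit theorem and finite quadratic forms -/

/-- The law of a sequence of independent standard Gaussian variables. -/
noncomputable def gaussianSeq (ι : Type) : Measure (ι → ℝ) :=
  Measure.infinitePi fun _ : ι => gaussianReal 0 1

instance (ι : Type) : IsProbabilityMeasure (gaussianSeq ι) := by
  unfold gaussianSeq; infer_instance

theorem map_gaussianSeq_restrict {ι : Type} (s : Finset ι) :
    (gaussianSeq ι).map (fun z => (WithLp.toLp 2 (fun i : s => z i) : EuclideanSpace ℝ s))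
      = stdGaussian (EuclideanSpace ℝ s) := by
  rw [← map_pi_eq_stdGaussian,
    ← Measure.infinitePi_map_restrict (fun _ : ι => gaussianReal 0 1) (I := s),
    Measure.map_map (WithLp.measurable_toLp 2 _) (by fun_prop)]
  rfl

theorem iIndepFun_sampleLaw (P : ProbabilityMeasure ℝ) {g : ℝ → ℝ} (hg : Measurable g) :
    iIndepFun (fun k ω => g (ω k)) (sampleLaw P) :=
  iIndepFun_infinitePi (X := fun _ => g) fun _ => hg

theorem identDistrib_sampleLaw (P : ProbabilityMeasure ℝ) {g : ℝ → ℝ} (hg : Measurable g) (i : ℕ) :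
    IdentDistrib (fun ω : ℕ → ℝ => g (ω i)) (fun ω => g (ω 0)) (sampleLaw P) (sampleLaw P) where
  aemeasurable_fst := (hg.comp (measurable_pi_apply i)).aemeasurable
  aemeasurable_snd := (hg.comp (measurable_pi_apply 0)).aemeasurable
  map_eq := by
    have h : ∀ j, (sampleLaw P).map (fun ω : ℕ → ℝ => g (ω j)) = (P : Measure ℝ).map g := by
      intro j
      rw [← (measurePreserving_eval_sampleLaw P j).map_eq, Measure.map_map hg (measurable_pi_apply j)]
      rfl
    rw [h, h]

section CLT

variable {ι : Type} (P : ProbabilityMeasure ℝ) {e : ι → ℝ → ℝ}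

theorem integral_sum_mul_sq (s : Finset ι) (he : ∀ i, Measurable (e i))
    (hb : ∀ i, ∃ B, ∀ x, |e i x| ≤ B) (h1 : ∀ i, ∫ x, e i x * e i x ∂(P : Measure ℝ) = 1)
    (h2 : ∀ i j, i ≠ j → ∫ x, e i x * e j x ∂(P : Measure ℝ) = 0) (t : ι → ℝ) :
    ∫ x, (∑ i ∈ s, t i * e i x) ^ 2 ∂(P : Measure ℝ) = ∑ i ∈ s, t i ^ 2 := by
  classical
  have hint : ∀ i j, Integrable (fun x => t i * e i x * (t j * e j x)) (P : Measure ℝ) := by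
    intro i j
    obtain ⟨B, hB⟩ := hb i
    obtain ⟨B', hB'⟩ := hb j
    have := (Integrable.of_bound ((he i).mul (he j)).aestronglyMeasurable (B * B')
      (.of_forall fun x => by
        rw [Pi.mul_apply, norm_mul]
        exact mul_le_mul (hB x) (hB' x) (norm_nonneg _) ((abs_nonneg _).trans (hB x))) :
      Integrable (e i * e j) (P : Measure ℝ)).const_mul (t i * t j)
    refine this.congr (.of_forall fun x => ?_)
    simp only [Pi.mul_apply]
    ring
  simp_rw [pow_two, Finset.sum_mul_sum]
  rw [integral_finsetSum _ fun i _ => integrable_finsetSum _ fun j _ => hint i j]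
  refine Finset.sum_congr rfl fun i hi => ?_
  rw [integral_finsetSum _ fun j _ => hint i j, Finset.sum_eq_single i]
  · have : ∀ x, t i * e i x * (t i * e i x) = t i * t i * (e i x * e i x) := fun x => by ring
    simp_rw [this]
    rw [integral_const_mul, h1, mul_one]
  · intro j _ hj
    have : ∀ x, t i * e i x * (t j * e j x) = t i * t j * (e i x * e j x) := fun x => by ring
    simp_rw [this]
    rw [integral_const_mul, h2 i j hj.symm, mul_zero]
  · exact fun h => absurd hi h

/-- Multivariate central limit theorem for bounded orthonormal centered functions. -/
theorem tendstoInDistribution_vector_sum (s : Finset ι) (he : ∀ i, Measurable (e i))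
    (hb : ∀ i, ∃ B, ∀ x, |e i x| ≤ B) (h0 : ∀ i, ∫ x, e i x ∂(P : Measure ℝ) = 0)
    (h1 : ∀ i, ∫ x, e i x * e i x ∂(P : Measure ℝ) = 1)
    (h2 : ∀ i j, i ≠ j → ∫ x, e i x * e j x ∂(P : Measure ℝ) = 0) :
    TendstoInDistribution (fun (n : ℕ) (ω : ℕ → ℝ) =>
        (WithLp.toLp 2 (fun i : s => (√n)⁻¹ * ∑ k ∈ Finset.range n, e i (ω k)) :
          EuclideanSpace ℝ s)) atTop
      (fun z : ι → ℝ => (WithLp.toLp 2 (fun i : s => z i) : EuclideanSpace ℝ s))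
      (fun _ => sampleLaw P) (gaussianSeq ι) := by
  classical
  have hm : ∀ n : ℕ, Measurable fun ω : ℕ → ℝ =>
      (WithLp.toLp 2 (fun i : s => (√n)⁻¹ * ∑ k ∈ Finset.range n, e i (ω k)) :
          EuclideanSpace ℝ s) := by
    intro n
    refine (WithLp.measurable_toLp 2 _).comp (measurable_pi_iff.2 fun i => ?_)
    exact (Finset.measurable_fun_sum _ fun k _ => (he i).comp (measurable_pi_apply k)).const_mul _
  refine ⟨fun n => (hm n).aemeasurable, ((WithLp.measurable_toLp 2 _).comp
    (by fun_prop : Measurable fun (z : ι → ℝ) (i : s) => z i)).aemeasurable, ?_⟩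
  -- Cramér–Wold: the characteristic function of the vector at `t` is that of the normalized sum of
  -- `g = ∑ t_i e_i` at `1`, and orthonormality gives `g` the variance `‖t‖²`.
  refine ProbabilityMeasure.tendsto_iff_tendsto_charFun.2 ?_
  intro t
  simp only [ProbabilityMeasure.coe_mk]
  rw [map_gaussianSeq_restrict, charFun_stdGaussian]
  let T : ι → ℝ := fun i => if h : i ∈ s then t ⟨i, h⟩ else 0
  have hT : ∀ i : s, T i = t i := fun i => by simp [T]
  let g : ℝ → ℝ := fun x => ∑ i ∈ s, T i * e i x
  have hg : Measurable g := Finset.measurable_fun_sum _ fun i _ => (he i).const_mul _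
  choose B hB using hb
  have hgb : ∀ x, |g x| ≤ ∑ i ∈ s, |T i| * B i := fun x =>
    (Finset.abs_sum_le_sum_abs _ _).trans (Finset.sum_le_sum fun i _ => by
      rw [abs_mul]; exact mul_le_mul_of_nonneg_left (hB i x) (abs_nonneg _))
  have hg0 : ∫ x, g x ∂(P : Measure ℝ) = 0 := by
    simp only [g]
    rw [integral_finsetSum _ fun i _ => (Integrable.of_bound (he i).aestronglyMeasurable (B i)
      (.of_forall fun x => hB i x)).const_mul _]
    simp [integral_const_mul, h0]
  have hsum : ∑ i ∈ s, T i ^ 2 = ‖t‖ ^ 2 := by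
    rw [EuclideanSpace.real_norm_sq_eq, ← Finset.sum_coe_sort s]
    simp [hT]
  have hg2 : ∫ x, g x ^ 2 ∂(P : Measure ℝ) = ‖t‖ ^ 2 := by
    rw [← hsum]
    exact integral_sum_mul_sq P s he (fun i => ⟨B i, hB i⟩) h1 h2 T
  have hgm : MemLp (fun ω : ℕ → ℝ => g (ω 0)) 2 (sampleLaw P) :=
    MemLp.of_bound (hg.comp (measurable_pi_apply 0)).aestronglyMeasurable _
      (.of_forall fun ω => hgb _)
  have hE : (sampleLaw P)[fun ω : ℕ → ℝ => g (ω 0)] = 0 := by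
    rw [integral_sampleLaw_eval P 0 hg, hg0]
  have hVar : Var[fun ω : ℕ → ℝ => g (ω 0); sampleLaw P] = ‖t‖ ^ 2 := by
    rw [variance_of_integral_eq_zero hgm.aestronglyMeasurable.aemeasurable hE,
      integral_sampleLaw_eval P 0 (f := fun x => g x ^ 2) (hg.pow_const 2), hg2]
  have hclt := tendstoInDistribution_inv_sqrt_mul_sum_sub (P := sampleLaw P)
    (P' := gaussianReal 0 (‖t‖ ^ 2).toNNReal) (Y := id) (X := fun k ω => g (ω k))
    (by rw [hVar]; exact HasLaw.id) hgm (iIndepFun_sampleLaw P hg) (identDistrib_sampleLaw P hg)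
  have hch := (ProbabilityMeasure.tendsto_iff_tendsto_charFun.1 hclt.tendsto) 1
  simp only [ProbabilityMeasure.coe_mk, Measure.map_id, charFun_gaussianReal] at hch
  have hv : (((‖t‖ ^ 2).toNNReal : ℝ) : ℂ) = (‖t‖ : ℂ) ^ 2 := by
    rw [Real.coe_toNNReal _ (by positivity)]; push_cast; rfl
  rw [hv] at hch
  convert hch using 2 with n
  · rw [charFun_apply, charFun_apply, integral_map (hm n).aemeasurable (by fun_prop),
      integral_map (hclt.forall_aemeasurable n) (by fun_prop)]
    refine integral_congr_ae (.of_forall fun ω => ?_)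
    simp only [hE, mul_zero, sub_zero]
    congr 3
    rw [PiLp.inner_apply]
    simp only [g]
    rw [Finset.sum_comm]
    simp_rw [← Finset.mul_sum]
    rw [← Finset.sum_coe_sort s, Finset.mul_sum]
    simp only [hT]
    simp
    refine Finset.sum_congr rfl fun i _ => ?_
    ring
  · congr 1
    simp [neg_div]

theorem tendstoInMeasure_sample_mean {g : ℝ → ℝ} (hg : Measurable g) {C : ℝ}
    (hC : ∀ x, |g x| ≤ C) :
    TendstoInMeasure (sampleLaw P) (fun n ω => (∑ k ∈ Finset.range n, g (ω k)) / n) atTop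
      fun _ => ∫ x, g x ∂(P : Measure ℝ) := by
  refine tendstoInMeasure_of_tendsto_ae (fun n => Measurable.aestronglyMeasurable ?_) ?_
  · exact (Finset.measurable_fun_sum _ fun k _ => hg.comp (measurable_pi_apply k)).div_const _
  · have := strong_law_ae_real (μ := sampleLaw P) (fun k ω => g (ω k))
      (Integrable.of_bound (hg.comp (measurable_pi_apply 0)).aestronglyMeasurable C
        (.of_forall fun ω => hC _))
      (fun i j hij => (iIndepFun_sampleLaw P hg).indepFun hij) (identDistrib_sampleLaw P hg)
    rwa [integral_sampleLaw_eval P 0 hg] at this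

/-- Twice the sum over pairs of `e_i(X_k) e_i(X_l)` is the square of the sum of the `e_i(X_k)` minus
the sum of the squares. The first part converges by the central limit theorem, the second by the law
of large numbers, and Slutsky's lemma combines them. The prefactor is the value of `n (n - 2) /
n.choose 3` for `n ≥ 3`. -/
theorem tendstoInDistribution_quadratic (s : Finset ι) (ν : ι → ℝ) (he : ∀ i, Measurable (e i))
    (hb : ∀ i, ∃ B, ∀ x, |e i x| ≤ B) (h0 : ∀ i, ∫ x, e i x ∂(P : Measure ℝ) = 0)
    (h1 : ∀ i, ∫ x, e i x * e i x ∂(P : Measure ℝ) = 1)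
    (h2 : ∀ i j, i ≠ j → ∫ x, e i x * e j x ∂(P : Measure ℝ) = 0) :
    TendstoInDistribution (fun (n : ℕ) (ω : ℕ → ℝ) =>
        6 / ((n : ℝ) - 1) * ∑ p ∈ pairIdx n, ∑ i ∈ s, ν i * e i (ω p.1) * e i (ω p.2)) atTop
      (fun z : ι → ℝ => ∑ i ∈ s, 3 * ν i * (z i ^ 2 - 1))
      (fun _ => sampleLaw P) (gaussianSeq ι) := by
  choose B hB using hb
  have hV := tendstoInDistribution_vector_sum P s he (fun i => ⟨B i, hB i⟩) h0 h1 h2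
  have hg : Measurable fun x => ∑ i ∈ s, ν i * (e i x * e i x) :=
    Finset.measurable_fun_sum _ fun i _ => ((he i).mul (he i)).const_mul _
  have hgb : ∀ x, |∑ i ∈ s, ν i * (e i x * e i x)| ≤ ∑ i ∈ s, |ν i| * (B i * B i) := fun x =>
    (Finset.abs_sum_le_sum_abs _ _).trans (Finset.sum_le_sum fun i _ => by
      rw [abs_mul, abs_mul]
      exact mul_le_mul_of_nonneg_left (mul_le_mul (hB i x) (hB i x) (abs_nonneg _)
        ((abs_nonneg _).trans (hB i x))) (abs_nonneg _))
  have hmean := tendstoInMeasure_sample_mean P hg hgb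
  have hgi : ∫ x, ∑ i ∈ s, ν i * (e i x * e i x) ∂(P : Measure ℝ) = ∑ i ∈ s, ν i := by
    rw [integral_finsetSum]
    · simp [integral_const_mul, h1]
    · intro i _
      exact (Integrable.of_bound ((he i).mul (he i)).aestronglyMeasurable (B i * B i)
        (.of_forall fun x => by
          rw [Pi.mul_apply, norm_mul]
          exact mul_le_mul (hB i x) (hB i x) (norm_nonneg _)
            ((abs_nonneg _).trans (hB i x)))).const_mul _
  rw [hgi] at hmean
  have hS1 := hV.continuous_comp_prodMk_of_tendstoInMeasure_const
    (g := fun q : EuclideanSpace ℝ s × ℝ => 3 * (∑ i : s, ν i * q.1 i ^ 2 - q.2)) (by fun_prop)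
    hmean fun n => Measurable.aemeasurable
      ((Finset.measurable_fun_sum _ fun k _ => hg.comp (measurable_pi_apply k)).div_const _)
  have hcn : TendstoInMeasure (sampleLaw P) (fun (n : ℕ) (_ : ℕ → ℝ) => (n : ℝ) / ((n : ℝ) - 1))
      atTop fun _ => (1 : ℝ) := by
    refine tendstoInMeasure_of_tendsto_ae (fun n => aestronglyMeasurable_const)
      (.of_forall fun ω => ?_)
    have := tendsto_natCast_div_add_atTop (-1 : ℝ)
    simpa [sub_eq_add_neg] using this
  have hS2 := hS1.continuous_comp_prodMk_of_tendstoInMeasure_const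
    (g := fun q : ℝ × ℝ => q.2 * q.1) (by fun_prop) hcn fun n => aemeasurable_const
  have e1 : (fun (n : ℕ) (ω : ℕ → ℝ) =>
        6 / ((n : ℝ) - 1) * ∑ p ∈ pairIdx n, ∑ i ∈ s, ν i * e i (ω p.1) * e i (ω p.2))
      = fun (n : ℕ) (ω : ℕ → ℝ) => (n : ℝ) / ((n : ℝ) - 1) *
        (3 * (∑ i : s, ν i * ((√n)⁻¹ * ∑ k ∈ Finset.range n, e i (ω k)) ^ 2
          - (∑ k ∈ Finset.range n, ∑ i ∈ s, ν i * (e i (ω k) * e i (ω k))) / n)) := by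
    funext n ω
    rcases Nat.eq_zero_or_pos n with rfl | hn
    · simp [pairIdx]
    have hn' : (n : ℝ) ≠ 0 := by exact_mod_cast hn.ne'
    have hp : ∑ p ∈ pairIdx n, ∑ i ∈ s, ν i * e i (ω p.1) * e i (ω p.2)
        = ∑ i ∈ s, ν i * (((∑ k ∈ Finset.range n, e i (ω k)) ^ 2
          - ∑ k ∈ Finset.range n, e i (ω k) ^ 2) / 2) := by
      rw [Finset.sum_comm]
      refine Finset.sum_congr rfl fun i _ => ?_
      rw [← sq_sum_eq_pairIdx n fun k => e i (ω k)]
      simp_rw [mul_assoc]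
      rw [← Finset.mul_sum]
      ring
    have hq : ∑ i : s, ν i * ((√n)⁻¹ * ∑ k ∈ Finset.range n, e i (ω k)) ^ 2
        = (∑ i ∈ s, ν i * (∑ k ∈ Finset.range n, e i (ω k)) ^ 2) / n := by
      rw [Finset.sum_coe_sort s fun i => ν i * ((√n)⁻¹ * ∑ k ∈ Finset.range n, e i (ω k)) ^ 2,
        Finset.sum_div]
      refine Finset.sum_congr rfl fun i _ => ?_
      rw [mul_pow, inv_pow, Real.sq_sqrt (Nat.cast_nonneg n)]
      ring
    have hr : ∑ k ∈ Finset.range n, ∑ i ∈ s, ν i * (e i (ω k) * e i (ω k))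
        = ∑ i ∈ s, ν i * ∑ k ∈ Finset.range n, e i (ω k) ^ 2 := by
      rw [Finset.sum_comm]
      refine Finset.sum_congr rfl fun i _ => ?_
      rw [Finset.mul_sum]
      exact Finset.sum_congr rfl fun k _ => by ring
    rw [hp, hq, hr, ← sub_div, ← Finset.sum_sub_distrib]
    simp_rw [← mul_sub, mul_div_assoc', ← Finset.sum_div]
    field_simp
    ring
  have e2 : (fun z : ι → ℝ => ∑ i ∈ s, 3 * ν i * (z i ^ 2 - 1))
      = fun z : ι → ℝ => 1 * (3 * (∑ i : s, ν i * z i ^ 2 - ∑ i ∈ s, ν i)) := by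
    funext z
    rw [Finset.sum_coe_sort s fun i => ν i * z i ^ 2, ← Finset.sum_sub_distrib, one_mul,
      Finset.mul_sum]
    exact Finset.sum_congr rfl fun i _ => by ring
  rw [e1, e2]
  exact hS2

end CLT

/-! ### Quadratic forms in independent Gaussian variables -/

theorem memLp_sq_sub_one_gaussianReal :
    MemLp (fun x : ℝ => x ^ 2 - 1) 2 (gaussianReal 0 1) := by
  refine MemLp.sub ?_ (memLp_const 1)
  refine (memLp_two_iff_integrable_sq (by fun_prop)).2 ?_
  have h := (memLp_id_gaussianReal (μ := 0) (v := 1) 4).integrable_norm_pow (by norm_num)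
  refine h.congr (.of_forall fun x => ?_)
  simp only [id, Real.norm_eq_abs]
  rw [← pow_mul, ← abs_pow, abs_of_nonneg (by positivity)]

theorem integral_sq_sub_one_gaussianReal : ∫ x : ℝ, (x ^ 2 - 1) ∂(gaussianReal 0 1) = 0 := by
  have h1 : ∫ x : ℝ, x ^ 2 ∂(gaussianReal 0 1) = 1 := by
    have h := variance_id_gaussianReal (μ := 0) (v := 1)
    rw [variance_of_integral_eq_zero aemeasurable_id (by simp)] at h
    simpa using h
  have h2 : Integrable (fun x : ℝ => x ^ 2) (gaussianReal 0 1) := by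
    by_contra h
    rw [integral_undef h] at h1
    norm_num at h1
  rw [integral_sub h2 (integrable_const 1), h1]
  simp

theorem measurePreserving_eval_gaussianSeq {ι : Type} (i : ι) :
    MeasurePreserving (fun z : ι → ℝ => z i) (gaussianSeq ι) (gaussianReal 0 1) :=
  measurePreserving_eval_infinitePi _ i

theorem iIndepFun_gaussianSeq {ι : Type} {g : ι → ℝ → ℝ} (hg : ∀ i, Measurable (g i)) :
    iIndepFun (fun i (z : ι → ℝ) => g i (z i)) (gaussianSeq ι) :=
  iIndepFun_infinitePi (X := g) hg

theorem memLp_sq_sub_one_gaussianSeq {ι : Type} (i : ι) :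
    MemLp (fun z : ι → ℝ => z i ^ 2 - 1) 2 (gaussianSeq ι) :=
  memLp_sq_sub_one_gaussianReal.comp_measurePreserving (measurePreserving_eval_gaussianSeq i)

theorem integral_eval_gaussianSeq {ι : Type} (i : ι) {f : ℝ → ℝ} (hf : Measurable f) :
    ∫ z, f (z i) ∂gaussianSeq ι = ∫ x, f x ∂gaussianReal 0 1 := by
  rw [← (measurePreserving_eval_gaussianSeq i).map_eq,
    integral_map (measurable_pi_apply i).aemeasurable hf.aestronglyMeasurable]

/-- The variance of the square of a standard Gaussian variable. -/
noncomputable def gaussianSqVariance : ℝ := ∫ x : ℝ, (x ^ 2 - 1) ^ 2 ∂gaussianReal 0 1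

theorem gaussianSqVariance_nonneg : 0 ≤ gaussianSqVariance :=
  integral_nonneg fun _ => sq_nonneg _

theorem integral_mul_sq_sub_one_gaussianSeq {ι : Type} [DecidableEq ι] (i j : ι) :
    ∫ z, (z i ^ 2 - 1) * (z j ^ 2 - 1) ∂gaussianSeq ι
      = if i = j then gaussianSqVariance else 0 := by
  have hm : Measurable fun x : ℝ => x ^ 2 - 1 := by fun_prop
  split_ifs with h
  · subst h
    simp_rw [← pow_two]
    exact integral_eval_gaussianSeq i (hm.pow_const 2)
  · have hind := (iIndepFun_gaussianSeq (ι := ι) (g := fun _ x => x ^ 2 - 1)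
      fun _ => hm).indepFun h
    rw [hind.integral_fun_mul_eq_mul_integral
      ((hm.comp (measurable_pi_apply i)).aestronglyMeasurable)
      ((hm.comp (measurable_pi_apply j)).aestronglyMeasurable),
      integral_eval_gaussianSeq i hm, integral_sq_sub_one_gaussianReal, zero_mul]

/-- The centered quadratic form `∑ i ∈ s, a i * (z i ^ 2 - 1)`. -/
def centeredChiSq {ι : Type} (a : ι → ℝ) (s : Finset ι) (z : ι → ℝ) : ℝ :=
  ∑ i ∈ s, a i * (z i ^ 2 - 1)

theorem measurable_centeredChiSq {ι : Type} (a : ι → ℝ) (s : Finset ι) :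
    Measurable (centeredChiSq a s) :=
  Finset.measurable_fun_sum _ fun i _ => by fun_prop

theorem memLp_centeredChiSq {ι : Type} (a : ι → ℝ) (s : Finset ι) :
    MemLp (centeredChiSq a s) 2 (gaussianSeq ι) :=
  memLp_finsetSum _ fun i _ => (memLp_sq_sub_one_gaussianSeq i).const_mul (a i)

theorem norm_sq_sum_of_orthogonal {ι E : Type*} [DecidableEq ι] [NormedAddCommGroup E]
    [InnerProductSpace ℝ E] {u : ι → E} {c : ℝ}
    (hu : ∀ i j, inner ℝ (u i) (u j) = if i = j then c else 0) (a : ι → ℝ) (s : Finset ι) :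
    ‖∑ i ∈ s, a i • u i‖ ^ 2 = c * ∑ i ∈ s, a i ^ 2 := by
  rw [← real_inner_self_eq_norm_sq, sum_inner, Finset.mul_sum]
  refine Finset.sum_congr rfl fun i hi => ?_
  rw [inner_sum]
  simp only [inner_smul_left, inner_smul_right, hu]
  simp [hi]
  ring

theorem inner_toLp_sq_sub_one {ι : Type} [DecidableEq ι] (i j : ι) :
    inner ℝ (memLp_sq_sub_one_gaussianSeq i).toLp (memLp_sq_sub_one_gaussianSeq j).toLp
      = if i = j then gaussianSqVariance else 0 := by
  rw [L2.inner_def, ← integral_mul_sq_sub_one_gaussianSeq i j]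
  refine integral_congr_ae ?_
  filter_upwards [(memLp_sq_sub_one_gaussianSeq i).coeFn_toLp,
    (memLp_sq_sub_one_gaussianSeq j).coeFn_toLp] with z h1 h2
  rw [h1, h2]
  simp [mul_comm]

theorem coeFn_sum_smul_sq_sub_one {ι : Type} (a : ι → ℝ) (s : Finset ι) :
    ⇑(∑ i ∈ s, a i • (memLp_sq_sub_one_gaussianSeq i).toLp) =ᵐ[gaussianSeq ι]
      centeredChiSq a s := by
  have h := fun i : ι => (Lp.coeFn_smul (a i) (memLp_sq_sub_one_gaussianSeq i).toLp).trans
    ((memLp_sq_sub_one_gaussianSeq i).coeFn_toLp.fun_const_smul (a i))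
  classical
  induction s using Finset.induction_on with
  | empty => 
    simp only [Finset.sum_empty]
    refine (Lp.coeFn_zero ℝ 2 _).trans (.of_forall fun z => ?_)
    simp [centeredChiSq]
  | insert i s hi ih =>
    rw [Finset.sum_insert hi]
    filter_upwards [Lp.coeFn_add (a i • (memLp_sq_sub_one_gaussianSeq i).toLp)
      (∑ i ∈ s, a i • (memLp_sq_sub_one_gaussianSeq i).toLp), h i, ih] with z h1 h2 h3
    rw [h1, Pi.add_apply, h2, h3]
    simp [centeredChiSq, Finset.sum_insert hi]

theorem integral_sq_eq_norm_sq {Ω : Type*} [MeasurableSpace Ω] {μ : Measure Ω} (f : Lp ℝ 2 μ) :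
    ∫ x, (f x) ^ 2 ∂μ = ‖f‖ ^ 2 := by
  rw [← real_inner_self_eq_norm_sq, L2.inner_def]
  simp [pow_two]

theorem integral_sq_centeredChiSq {ι : Type} (a : ι → ℝ) (s : Finset ι) :
    ∫ z, centeredChiSq a s z ^ 2 ∂gaussianSeq ι = gaussianSqVariance * ∑ i ∈ s, a i ^ 2 := by
  classical
  rw [← norm_sq_sum_of_orthogonal inner_toLp_sq_sub_one a s, ← integral_sq_eq_norm_sq]
  refine integral_congr_ae ?_
  filter_upwards [coeFn_sum_smul_sq_sub_one a s] with z hz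
  rw [hz]

/-- Existence of the infinite quadratic form, as an `L²` limit. -/
theorem exists_limit_centeredChiSq {ι : Type} {a : ι → ℝ} (ha : Summable fun i => a i ^ 2) :
    ∃ Y : (ι → ℝ) → ℝ, Measurable Y ∧ MemLp Y 2 (gaussianSeq ι) ∧
      ∀ ε > 0, ∃ s₀ : Finset ι, ∀ s, s₀ ⊆ s →
        ∫ z, (centeredChiSq a s z - Y z) ^ 2 ∂gaussianSeq ι ≤ ε := by
  classical
  set u : ι → Lp ℝ 2 (gaussianSeq ι) := fun i => (memLp_sq_sub_one_gaussianSeq i).toLp with hu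
  have hs : Summable fun i => a i • u i := by
    rw [summable_iff_vanishing_norm]
    intro ε hε
    -- The summands are orthogonal, so the Cauchy criterion reduces to that of `∑ a i²`. The `+ 1`
    -- makes the denominator positive using only nonnegativity of the variance.
    obtain ⟨s, hs⟩ := summable_iff_vanishing_norm.1 ha (ε ^ 2 / (gaussianSqVariance + 1))
      (div_pos (by positivity) (by linarith [gaussianSqVariance_nonneg]))
    refine ⟨s, fun t ht => ?_⟩
    have h1 := hs t ht
    rw [Real.norm_of_nonneg (Finset.sum_nonneg fun i _ => sq_nonneg _),
      lt_div_iff₀ (by linarith [gaussianSqVariance_nonneg])] at h1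
    have h2 := norm_sq_sum_of_orthogonal inner_toLp_sq_sub_one a t
    have h3 : 0 ≤ ∑ i ∈ t, a i ^ 2 := Finset.sum_nonneg fun i _ => sq_nonneg _
    refine lt_of_pow_lt_pow_left₀ 2 hε.le ?_
    rw [h2]
    nlinarith
  obtain ⟨y, hy⟩ := hs
  refine ⟨y, (Lp.stronglyMeasurable y).measurable, Lp.memLp y, fun ε hε => ?_⟩
  obtain ⟨s₀, hs₀⟩ := eventually_atTop.1 ((Metric.tendsto_nhds.1 hy) (√ε) (Real.sqrt_pos.2 hε))
  refine ⟨s₀, fun s hs => ?_⟩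
  have h1 := hs₀ s hs
  rw [dist_eq_norm] at h1
  have h2 : ∫ z, (centeredChiSq a s z - y z) ^ 2 ∂gaussianSeq ι
      = ‖∑ i ∈ s, a i • u i - y‖ ^ 2 := by
    rw [← integral_sq_eq_norm_sq]
    refine integral_congr_ae ?_
    filter_upwards [coeFn_sum_smul_sq_sub_one a s,
      Lp.coeFn_sub (∑ i ∈ s, a i • u i) y] with z h3 h4
    rw [h4, Pi.sub_apply, h3]
  rw [h2, ← Real.sq_sqrt hε.le]
  exact pow_le_pow_left₀ (norm_nonneg _) h1.le 2

theorem integral_exp_mul_sq_sub_one {b : ℝ} (hb : 2 * b < 1) :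
    ∫ x : ℝ, Real.exp (b * (x ^ 2 - 1)) ∂gaussianReal 0 1
      = Real.exp (-b) * (√(1 - 2 * b))⁻¹ := by
  rw [integral_gaussianReal_eq_integral_smul one_ne_zero]
  have h : ∀ x : ℝ, gaussianPDFReal 0 1 x • Real.exp (b * (x ^ 2 - 1))
      = (√(2 * Real.pi))⁻¹ * Real.exp (-b) * Real.exp (-(1 / 2 - b) * x ^ 2) := by
    intro x
    rw [gaussianPDFReal_def]
    simp only [NNReal.coe_one, mul_one, sub_zero, smul_eq_mul]
    rw [mul_assoc, mul_assoc, ← Real.exp_add, ← Real.exp_add]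
    congr 2
    ring
  simp_rw [h]
  rw [integral_const_mul, integral_gaussian]
  have h1 : Real.pi / (1 / 2 - b) = 2 * Real.pi / (1 - 2 * b) := by
    rw [div_eq_div_iff (by linarith) (by linarith)]
    ring
  have h2 : √(2 * Real.pi) ≠ 0 := (Real.sqrt_pos.2 (by positivity)).ne'
  rw [h1, Real.sqrt_div (by positivity)]
  field_simp

theorem integrable_exp_mul_sq_sub_one {b : ℝ} (hb : 2 * b < 1) :
    Integrable (fun x : ℝ => Real.exp (b * (x ^ 2 - 1))) (gaussianReal 0 1) := by
  -- Without integrability the integral would be `0` by convention, whereas the closed formula is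
  -- positive.
  by_contra h
  have h1 := integral_exp_mul_sq_sub_one hb
  rw [integral_undef h] at h1
  have h2 : 0 < √(1 - 2 * b) := Real.sqrt_pos.2 (by linarith)
  have h3 : 0 < Real.exp (-b) * (√(1 - 2 * b))⁻¹ := by positivity
  linarith

/-- From `1/(1 - 2b) = 1 + 2b/(1 - 2b) ≤ exp(2b/(1 - 2b))` and `-b + b/(1 - 2b) = 2b²/(1 - 2b)`. An
exponent quadratic in `b` lets a product over coordinates be controlled by `∑ a i²`; summability of
`|a i|` is not required. -/
theorem integral_exp_mul_sq_sub_one_le {b : ℝ} (hb : 2 * b < 1) :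
    ∫ x : ℝ, Real.exp (b * (x ^ 2 - 1)) ∂gaussianReal 0 1
      ≤ Real.exp (2 * b ^ 2 / (1 - 2 * b)) := by
  rw [integral_exp_mul_sq_sub_one hb]
  have hy : 0 < 1 - 2 * b := by linarith
  have h1 : (√(1 - 2 * b))⁻¹ ≤ Real.exp (b / (1 - 2 * b)) := by
    rw [← Real.sqrt_inv]
    refine Real.sqrt_le_iff.2 ⟨(Real.exp_pos _).le, ?_⟩
    rw [← Real.exp_nat_mul]
    have h2 := Real.add_one_le_exp ((2 : ℕ) * (b / (1 - 2 * b)))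
    refine le_trans (le_of_eq ?_) h2
    push_cast
    field_simp
    ring
  calc Real.exp (-b) * (√(1 - 2 * b))⁻¹ ≤ Real.exp (-b) * Real.exp (b / (1 - 2 * b)) :=
        mul_le_mul_of_nonneg_left h1 (Real.exp_pos _).le
    _ = _ := by
        rw [← Real.exp_add]
        congr 1
        rw [eq_div_iff hy.ne', add_mul, div_mul_cancel₀ _ hy.ne']
        ring

/-! ### Tails of the limiting quadratic form -/

/-- Chernoff bound for centered quadratic forms in Gaussian variables. -/
theorem measureReal_le_centeredChiSq_le {ι : Type} {a : ι → ℝ} {M l δ : ℝ} (hM : ∀ i, |a i| ≤ M)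
    (hl : 0 ≤ l) (hδ : 0 < δ) (hlM : 2 * l * M ≤ 1 - δ) (s : Finset ι) (u : ℝ) :
    (gaussianSeq ι).real {z | u ≤ centeredChiSq a s z}
      ≤ Real.exp (-l * u + 2 * l ^ 2 / δ * ∑ i ∈ s, a i ^ 2) := by
  have hb : ∀ i, δ ≤ 1 - 2 * (l * a i) := by
    intro i
    have := mul_le_mul_of_nonneg_left ((le_abs_self _).trans (hM i)) hl
    linarith
  have hm : ∀ i, Measurable fun x : ℝ => a i * (x ^ 2 - 1) := fun i => by fun_prop
  have hind := iIndepFun_gaussianSeq (ι := ι) (g := fun i x => a i * (x ^ 2 - 1)) hm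
  have hm' : ∀ i, Measurable fun z : ι → ℝ => a i * (z i ^ 2 - 1) := fun i => by fun_prop
  have hi : ∀ i, Integrable (fun z : ι → ℝ => Real.exp (l * (a i * (z i ^ 2 - 1))))
      (gaussianSeq ι) := by
    intro i
    have := (measurePreserving_eval_gaussianSeq i).integrable_comp_of_integrable
      (integrable_exp_mul_sq_sub_one (b := l * a i) (by linarith [hb i]))
    refine this.congr (.of_forall fun z => ?_)
    simp [mul_assoc]
  have heq : (∑ i ∈ s, fun z : ι → ℝ => a i * (z i ^ 2 - 1)) = centeredChiSq a s := by
    funext z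
    simp [centeredChiSq]
  have h1 := measure_ge_le_exp_mul_mgf u hl (hind.integrable_exp_mul_sum hm' (s := s)
    fun i _ => hi i)
  rw [hind.mgf_sum hm', heq] at h1
  refine h1.trans ?_
  rw [Real.exp_add, Finset.mul_sum, Real.exp_sum]
  refine mul_le_mul_of_nonneg_left (Finset.prod_le_prod (fun i _ => mgf_nonneg) fun i _ => ?_)
    (Real.exp_pos _).le
  have h2 : mgf (fun z : ι → ℝ => a i * (z i ^ 2 - 1)) (gaussianSeq ι) l
      = ∫ x : ℝ, Real.exp (l * a i * (x ^ 2 - 1)) ∂gaussianReal 0 1 := by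
    rw [← integral_eval_gaussianSeq i (by fun_prop)]
    simp [mgf, mul_assoc]
  rw [h2]
  refine (integral_exp_mul_sq_sub_one_le (by linarith [hb i])).trans (Real.exp_le_exp.2 ?_)
  calc 2 * (l * a i) ^ 2 / (1 - 2 * (l * a i)) ≤ 2 * (l * a i) ^ 2 / δ :=
        div_le_div_of_nonneg_left (by positivity) hδ (hb i)
    _ = _ := by ring

theorem measureReal_one_le_abs_sub_le {Ω : Type*} [MeasurableSpace Ω] {μ : Measure Ω}
    [IsFiniteMeasure μ] {f g : Ω → ℝ} (hf : MemLp f 2 μ) (hg : MemLp g 2 μ) :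
    μ.real {z | 1 ≤ |f z - g z|} ≤ ∫ z, (f z - g z) ^ 2 ∂μ := by
  have h := mul_meas_ge_le_integral_of_nonneg (μ := μ) (f := fun z => (f z - g z) ^ 2)
    (.of_forall fun z => sq_nonneg _) (hf.sub hg).integrable_sq 1
  rw [one_mul] at h
  refine le_trans (le_of_eq ?_) h
  congr 1
  ext z
  simp [one_le_sq_iff_one_le_abs]

section Limit

variable {ι : Type} {a : ι → ℝ} {Y : (ι → ℝ) → ℝ}

/-- If `|Y| ≥ u`, then a partial sum or its negative is at least `u - 1`, or the partial sum misses
`Y` by at least `1`. The Chernoff bound applies to both `a` and `-a` uniformly in the partial sum,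
and the last event has arbitrarily small probability. -/
theorem measureReal_le_abs_limit_le (ha : Summable fun i => a i ^ 2)
    (hY : MemLp Y 2 (gaussianSeq ι))
    (hlim : ∀ ε > 0, ∃ s₀ : Finset ι, ∀ s, s₀ ⊆ s →
      ∫ z, (centeredChiSq a s z - Y z) ^ 2 ∂gaussianSeq ι ≤ ε)
    {M l δ : ℝ} (hM : ∀ i, |a i| ≤ M) (hl : 0 ≤ l) (hδ : 0 < δ) (hlM : 2 * l * M ≤ 1 - δ) (u : ℝ) :
    (gaussianSeq ι).real {z | u ≤ |Y z|}
      ≤ 2 * Real.exp (-l * (u - 1) + 2 * l ^ 2 / δ * ∑' i, a i ^ 2) := by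
  refine le_of_forall_pos_le_add fun ε hε => ?_
  obtain ⟨s, hs⟩ := hlim ε hε
  have h1 := hs s subset_rfl
  have h2 := measureReal_one_le_abs_sub_le (memLp_centeredChiSq a s) hY
  have hneg : ∀ z, centeredChiSq (fun i => -a i) s z = -centeredChiSq a s z := by
    intro z; simp [centeredChiSq]
  have h3 := measureReal_le_centeredChiSq_le hM hl hδ hlM s (u - 1)
  have h4 := measureReal_le_centeredChiSq_le (a := fun i => -a i) (by simpa using hM) hl hδ hlM s
    (u - 1)
  simp only [neg_sq] at h4
  have h5 : Real.exp (-l * (u - 1) + 2 * l ^ 2 / δ * ∑ i ∈ s, a i ^ 2)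
      ≤ Real.exp (-l * (u - 1) + 2 * l ^ 2 / δ * ∑' i, a i ^ 2) := by
    gcongr
    exact ha.sum_le_tsum s fun i _ => sq_nonneg _
  have hsub : {z | u ≤ |Y z|} ⊆ ({z | u - 1 ≤ centeredChiSq a s z} ∪
      {z | u - 1 ≤ centeredChiSq (fun i => -a i) s z}) ∪ {z | 1 ≤ |centeredChiSq a s z - Y z|} := by
    intro z hz
    simp only [Set.mem_union, Set.mem_ofPred_eq, hneg] at hz ⊢
    by_contra! hcon
    obtain ⟨⟨c1, c2⟩, c3⟩ := hcon
    rw [abs_lt] at c3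
    rcases le_abs.1 hz with h | h <;> linarith
  have h6 := (measureReal_mono (μ := gaussianSeq ι) hsub).trans ((measureReal_union_le _ _).trans
    (add_le_add_left (measureReal_union_le _ _) _))
  linarith

/-- The coordinate `i₀` is independent of the rest of a partial sum, which exceeds a fixed level
`-r` with probability at least `1/2` by Chebyshev. A further loss of `1` absorbs the distance to
`Y`, so the shift `m = 1 + r` does not depend on `u`. -/
theorem half_mul_measureReal_le (ha : Summable fun i => a i ^ 2)
    (hY : MemLp Y 2 (gaussianSeq ι))
    (hlim : ∀ ε > 0, ∃ s₀ : Finset ι, ∀ s, s₀ ⊆ s →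
      ∫ z, (centeredChiSq a s z - Y z) ^ 2 ∂gaussianSeq ι ≤ ε) (i₀ : ι) :
    ∃ m, 0 ≤ m ∧ ∀ u, 1 / 2 * (gaussianReal 0 1).real {x | u + m ≤ a i₀ * (x ^ 2 - 1)}
      ≤ (gaussianSeq ι).real {z | u ≤ Y z} := by
  classical
  set c := gaussianSqVariance
  have hc : 0 ≤ c := gaussianSqVariance_nonneg
  set S := ∑' i, a i ^ 2
  have hS : 0 ≤ S := tsum_nonneg fun i => sq_nonneg _
  -- Chosen so that `r²` is at least twice the variance of any partial sum; the `+ 1` keeps `r`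
  -- positive.
  set r := √(2 * c * S) + 1
  have hr0 : 0 < r := by positivity
  have hr2 : 2 * (c * S) ≤ r ^ 2 := by
    have := Real.sq_sqrt (show 0 ≤ 2 * c * S by positivity)
    nlinarith [Real.sqrt_nonneg (2 * c * S)]
  refine ⟨1 + r, by positivity, fun u => le_of_forall_pos_le_add fun ε hε => ?_⟩
  obtain ⟨s₀, hs₀⟩ := hlim ε hε
  set s := s₀.erase i₀
  have h1 := hs₀ (insert i₀ s) fun i hi => by
    by_cases h : i = i₀ <;> simp [s, h, hi]
  have hns : i₀ ∉ s := by simp [s]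
  have h2 := measureReal_one_le_abs_sub_le (memLp_centeredChiSq a (insert i₀ s)) hY
  have hm : ∀ i, Measurable fun x : ℝ => a i * (x ^ 2 - 1) := fun i => by fun_prop
  have hm' : ∀ i, Measurable fun z : ι → ℝ => a i * (z i ^ 2 - 1) := fun i => by fun_prop
  have hind := (iIndepFun_gaussianSeq (ι := ι) (g := fun i x => a i * (x ^ 2 - 1)) hm
    ).indepFun_finsetSum_of_notMem hm' hns
  have heq : (∑ i ∈ s, fun z : ι → ℝ => a i * (z i ^ 2 - 1)) = centeredChiSq a s := by
    funext z
    simp [centeredChiSq]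
  rw [heq] at hind
  have h3 : (gaussianSeq ι).real {z | -r ≤ centeredChiSq a s z} ≥ 1 / 2 := by
    have h := mul_meas_ge_le_integral_of_nonneg (μ := gaussianSeq ι)
      (f := fun z => centeredChiSq a s z ^ 2)
      (.of_forall fun z => sq_nonneg _) (memLp_centeredChiSq a s).integrable_sq (r ^ 2)
    rw [integral_sq_centeredChiSq] at h
    have h' : c * ∑ i ∈ s, a i ^ 2 ≤ c * S :=
      mul_le_mul_of_nonneg_left (ha.sum_le_tsum s fun i _ => sq_nonneg _) hc
    have h'' : (gaussianSeq ι).real {z | r ^ 2 ≤ centeredChiSq a s z ^ 2} ≤ 1 / 2 := by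
      have : r ^ 2 * (gaussianSeq ι).real {z | r ^ 2 ≤ centeredChiSq a s z ^ 2}
        ≤ r ^ 2 * (1 / 2) := by linarith
      exact le_of_mul_le_mul_left this (by positivity)
    have hmeas : MeasurableSet {z | -r ≤ centeredChiSq a s z} :=
      measurableSet_le measurable_const (measurable_centeredChiSq a s)
    have hcompl := measureReal_compl (μ := gaussianSeq ι) hmeas
    have hsub : {z | -r ≤ centeredChiSq a s z}ᶜ ⊆ {z | r ^ 2 ≤ centeredChiSq a s z ^ 2} := by
      intro z hz
      simp only [Set.mem_compl_iff, Set.mem_ofPred_eq, not_le] at hz ⊢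
      nlinarith
    have := measureReal_mono (μ := gaussianSeq ι) hsub
    rw [probReal_univ] at hcompl
    linarith
  have h4 := hind.measure_inter_preimage_eq_mul (Set.Ici (-r)) (Set.Ici (u + (1 + r)))
    measurableSet_Ici measurableSet_Ici
  have h5 : (gaussianSeq ι).real ({z | -r ≤ centeredChiSq a s z} ∩
      {z | u + (1 + r) ≤ a i₀ * (z i₀ ^ 2 - 1)})
      = (gaussianSeq ι).real {z | -r ≤ centeredChiSq a s z} *
        (gaussianSeq ι).real {z | u + (1 + r) ≤ a i₀ * (z i₀ ^ 2 - 1)} := by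
    rw [Measure.real, Measure.real, Measure.real, ← ENNReal.toReal_mul]
    exact congrArg ENNReal.toReal h4
  have h6 : (gaussianSeq ι).real {z | u + (1 + r) ≤ a i₀ * (z i₀ ^ 2 - 1)}
      = (gaussianReal 0 1).real {x | u + (1 + r) ≤ a i₀ * (x ^ 2 - 1)} :=
    (measurePreserving_eval_gaussianSeq i₀).measureReal_preimage
      (measurableSet_le measurable_const (hm i₀)).nullMeasurableSet
  have hsub : ({z | -r ≤ centeredChiSq a s z} ∩ {z | u + (1 + r) ≤ a i₀ * (z i₀ ^ 2 - 1)})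
      ⊆ {z | u ≤ Y z} ∪ {z | 1 ≤ |centeredChiSq a (insert i₀ s) z - Y z|} := by
    rintro z ⟨z1, z2⟩
    simp only [Set.mem_union, Set.mem_ofPred_eq] at z1 z2 ⊢
    by_contra! hcon
    obtain ⟨c1, c2⟩ := hcon
    have : centeredChiSq a (insert i₀ s) z = a i₀ * (z i₀ ^ 2 - 1) + centeredChiSq a s z := by
      simp [centeredChiSq, Finset.sum_insert hns]
    rw [this, abs_lt] at c2
    linarith
  have h7 := (measureReal_mono (μ := gaussianSeq ι) hsub).trans (measureReal_union_le _ _)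
  rw [h5, h6] at h7
  have h8 := mul_le_mul_of_nonneg_right h3 (measureReal_nonneg (μ := gaussianReal 0 1)
    (s := {x | u + (1 + r) ≤ a i₀ * (x ^ 2 - 1)}))
  linarith

end Limit

theorem le_measureReal_Ici_gaussianReal {w : ℝ} (hw : 0 ≤ w) :
    (√(2 * Real.pi))⁻¹ * Real.exp (-(w + 1) ^ 2 / 2) ≤ (gaussianReal 0 1).real (Set.Ici w) := by
  have h1 : (gaussianReal 0 1).real (Set.Icc w (w + 1)) ≤ (gaussianReal 0 1).real (Set.Ici w) :=
    measureReal_mono fun x hx => hx.1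
  refine le_trans ?_ h1
  rw [Measure.real, gaussianReal_apply_eq_integral 0 one_ne_zero, ENNReal.toReal_ofReal
    (integral_nonneg fun x => gaussianPDFReal_nonneg _ _ _)]
  have h2 : ∫ x in Set.Icc w (w + 1), (√(2 * Real.pi))⁻¹ * Real.exp (-(w + 1) ^ 2 / 2)
      = (√(2 * Real.pi))⁻¹ * Real.exp (-(w + 1) ^ 2 / 2) := by
    simp
  rw [← h2]
  refine setIntegral_mono_on (integrableOn_const (by simp)) (integrable_gaussianPDFReal 0 1).integrableOn
    measurableSet_Icc fun x hx => ?_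
  rw [gaussianPDFReal_def]
  simp only [NNReal.coe_one, mul_one, sub_zero]
  refine mul_le_mul_of_nonneg_left (Real.exp_le_exp.2 ?_) (by positivity)
  have : x ^ 2 ≤ (w + 1) ^ 2 := pow_le_pow_left₀ (hw.trans hx.1) hx.2 2
  linarith

/-- The upper bound is required only for rates `l < A`, because the constant of the Chernoff bound
blows up as `l` approaches the critical rate. -/
theorem isEquivalent_neg_mul_sq {f : ℝ → ℝ} {A : ℝ} (hA : 0 < A)
    (h1 : ∀ l, 0 < l → l < A → ∃ C, ∀ᶠ t in atTop, f t ≤ -l * t ^ 2 + C)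
    (h2 : ∃ C, ∀ᶠ t in atTop, -A * t ^ 2 - C * t - C ≤ f t) :
    f ~[atTop] fun t => -(A * t ^ 2) := by
  rw [IsEquivalent, isLittleO_iff]
  intro ε' hε'
  -- Capping at `1` keeps the rate `A (1 - ε/2)` positive.
  set ε := min ε' 1
  have hε : 0 < ε := lt_min hε' one_pos
  obtain ⟨C, hC⟩ := h1 (A * (1 - ε / 2)) (mul_pos hA (by linarith [min_le_right ε' 1]))
    (by nlinarith)
  obtain ⟨D, hD⟩ := h2
  filter_upwards [hC, hD, eventually_ge_atTop 1,
    eventually_ge_atTop (2 * |C| / (ε * A)), eventually_ge_atTop (2 * |D| / (ε * A))]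
    with t h3 h4 h5 h6 h7
  have hεA : 0 < ε * A := by positivity
  rw [div_le_iff₀ hεA] at h6 h7
  have ht2 : t ≤ t ^ 2 := by nlinarith
  have h8 : t * (ε * A) ≤ t ^ 2 * (ε * A) := mul_le_mul_of_nonneg_right ht2 hεA.le
  have h9 : 2 * |D| * t ≤ t ^ 2 * (ε * A) := by nlinarith
  have h10 := mul_le_mul_of_nonneg_right (le_abs_self D) (zero_le_one.trans h5)
  have h11 : ε * (A * t ^ 2) ≤ ε' * (A * t ^ 2) :=
    mul_le_mul_of_nonneg_right (min_le_left _ _) (by positivity)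
  have h12 : |D| ≤ |D| * t := le_mul_of_one_le_right (abs_nonneg D) h5
  rw [Real.norm_eq_abs, Real.norm_eq_abs, abs_neg, abs_of_nonneg (by positivity : 0 ≤ A * t ^ 2),
    Pi.sub_apply, abs_le]
  constructor
  · nlinarith [le_abs_self D]
  · nlinarith [le_abs_self C, abs_nonneg C]

section Tail

variable {ι : Type} {a : ι → ℝ} {Y : (ι → ℝ) → ℝ}

/-- `√|Y| > t` as soon as `Y ≥ t² + 1`. The single-coordinate event `a i₀ (x² - 1) ≥ t² + 1 + m`
holds once `x ≥ t/√(a i₀) + k` with `k² = 1 + (1 + m)/a i₀`, and the Gaussian density on an interval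
of length one bounds its probability from below. -/
theorem exists_le_measureReal_sqrt_abs_limit (ha : Summable fun i => a i ^ 2)
    (hY : MemLp Y 2 (gaussianSeq ι))
    (hlim : ∀ ε > 0, ∃ s₀ : Finset ι, ∀ s, s₀ ⊆ s →
      ∫ z, (centeredChiSq a s z - Y z) ^ 2 ∂gaussianSeq ι ≤ ε)
    {i₀ : ι} (hpos : 0 < a i₀) :
    ∃ d k, 0 < d ∧ 0 ≤ k ∧ ∀ t, 0 ≤ t → d * Real.exp (-(t / √(a i₀) + k) ^ 2 / 2)
      ≤ (gaussianSeq ι).real {z | t < √|Y z|} := by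
  obtain ⟨m, hm, hle⟩ := half_mul_measureReal_le ha hY hlim i₀
  set M := a i₀
  set k := √(1 + (1 + m) / M)
  have hk : k ^ 2 = 1 + (1 + m) / M := Real.sq_sqrt (by positivity)
  refine ⟨1 / 2 * (√(2 * Real.pi))⁻¹, k + 1, by positivity, by positivity, fun t ht => ?_⟩
  have h1 : (gaussianSeq ι).real {z | t ^ 2 + 1 ≤ Y z} ≤ (gaussianSeq ι).real {z | t < √|Y z|} := by
    refine measureReal_mono fun z hz => ?_
    simp only [Set.mem_ofPred_eq] at hz ⊢
    exact Real.lt_sqrt_of_sq_lt (by linarith [le_abs_self (Y z)])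
  have hw : 0 ≤ t / √M + k := by positivity
  have h2 : (gaussianReal 0 1).real (Set.Ici (t / √M + k))
      ≤ (gaussianReal 0 1).real {x | t ^ 2 + 1 + m ≤ M * (x ^ 2 - 1)} := by
    refine measureReal_mono fun x hx => ?_
    simp only [Set.mem_ofPred_eq, Set.mem_Ici] at hx ⊢
    have h3 : (t / √M + k) ^ 2 ≤ x ^ 2 := pow_le_pow_left₀ hw hx 2
    have h4 : (t / √M) ^ 2 = t ^ 2 / M := by rw [div_pow, Real.sq_sqrt hpos.le]
    have h5 : 0 ≤ t / √M * k := by positivity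
    have h6 : t ^ 2 / M + (1 + m) / M ≤ x ^ 2 - 1 := by nlinarith
    rw [← add_div, div_le_iff₀ hpos] at h6
    linarith
  have h3 := le_measureReal_Ici_gaussianReal hw
  rw [← add_assoc, mul_assoc]
  linarith [hle (t ^ 2 + 1)]

/-- Logarithmic tail asymptotics of the square root of the infinite quadratic form. -/
theorem isEquivalent_log_measureReal_sqrt_abs_limit (ha : Summable fun i => a i ^ 2)
    (hY : MemLp Y 2 (gaussianSeq ι))
    (hlim : ∀ ε > 0, ∃ s₀ : Finset ι, ∀ s, s₀ ⊆ s →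
      ∫ z, (centeredChiSq a s z - Y z) ^ 2 ∂gaussianSeq ι ≤ ε)
    {i₀ : ι} (hpos : 0 < a i₀) (hM : ∀ i, |a i| ≤ a i₀) :
    (fun t => Real.log ((gaussianSeq ι).real {z | t < √|Y z|})) ~[atTop]
      fun t => -(1 / (2 * a i₀) * t ^ 2) := by
  obtain ⟨d, k, hd, hk, hlow⟩ := exists_le_measureReal_sqrt_abs_limit ha hY hlim hpos
  have hppos : ∀ t, 0 ≤ t → 0 < (gaussianSeq ι).real {z | t < √|Y z|} := fun t ht =>
    (by positivity : 0 < d * Real.exp (-(t / √(a i₀) + k) ^ 2 / 2)).trans_le (hlow t ht)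
  refine isEquivalent_neg_mul_sq (by positivity) (fun l hl hlt => ?_) ?_
  -- With this `δ` the constraint of the Chernoff bound is an equality; `δ` is positive because `l <
  -- 1/(2 a i₀)`.
  · set δ := 1 - 2 * l * a i₀
    have hδ : 0 < δ := by
      rw [lt_div_iff₀ (by positivity)] at hlt
      simp only [δ]
      linarith
    refine ⟨Real.log 2 + l + 2 * l ^ 2 / δ * ∑' i, a i ^ 2, ?_⟩
    filter_upwards [eventually_ge_atTop 0] with t ht
    have h1 : (gaussianSeq ι).real {z | t < √|Y z|} ≤ (gaussianSeq ι).real {z | t ^ 2 ≤ |Y z|} := by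
      refine measureReal_mono fun z hz => ?_
      simp only [Set.mem_ofPred_eq] at hz ⊢
      exact ((Real.lt_sqrt ht).1 hz).le
    have h2 := Real.log_le_log (hppos t ht) (h1.trans
      (measureReal_le_abs_limit_le ha hY hlim hM hl.le hδ (by simp [δ]) (t ^ 2)))
    rw [Real.log_mul two_ne_zero (Real.exp_pos _).ne', Real.log_exp] at h2
    linarith
  · refine ⟨|Real.log d| + k / √(a i₀) + k ^ 2 / 2, ?_⟩
    filter_upwards [eventually_ge_atTop 0] with t ht
    have h1 := Real.log_le_log (by positivity) (hlow t ht)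
    rw [Real.log_mul hd.ne' (Real.exp_pos _).ne', Real.log_exp] at h1
    have h2 : -(t / √(a i₀) + k) ^ 2 / 2
        = -(1 / (2 * a i₀) * t ^ 2) - k / √(a i₀) * t - k ^ 2 / 2 := by
      have h3 : (t / √(a i₀)) ^ 2 = t ^ 2 / a i₀ := by rw [div_pow, Real.sq_sqrt hpos.le]
      calc -(t / √(a i₀) + k) ^ 2 / 2
          = -((t / √(a i₀)) ^ 2) / 2 - k / √(a i₀) * t - k ^ 2 / 2 := by ring
        _ = _ := by rw [h3]; ring
    rw [h2] at h1
    have h4 := neg_abs_le (Real.log d)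
    have h5 : 0 ≤ |Real.log d| * t := by positivity
    have h6 : 0 ≤ k ^ 2 / 2 * t := by positivity
    have h7 : 0 ≤ k / √(a i₀) := by positivity
    linarith

end Tail

/-! ### Limit law of the statistic under the null hypothesis -/

theorem integral_abs_le_of_integral_sq_le {Ω : Type*} [MeasurableSpace Ω] {μ : Measure Ω}
    [IsProbabilityMeasure μ] {f : Ω → ℝ} (hf : MemLp f 2 μ) {ε : ℝ} (hε : 0 < ε)
    (h : ∫ ω, f ω ^ 2 ∂μ ≤ ε ^ 2) : ∫ ω, |f ω| ∂μ ≤ ε := by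
  have h1 : ∀ ω, |f ω| ≤ (2 * ε)⁻¹ * f ω ^ 2 + ε / 2 := by
    intro ω
    have h2 : 2 * ε * |f ω| ≤ f ω ^ 2 + ε ^ 2 := by
      nlinarith [sq_nonneg (|f ω| - ε), sq_abs (f ω)]
    have h3 : (2 * ε)⁻¹ * (2 * ε * |f ω|) ≤ (2 * ε)⁻¹ * (f ω ^ 2 + ε ^ 2) :=
      mul_le_mul_of_nonneg_left h2 (by positivity)
    rw [inv_mul_cancel_left₀ (by positivity)] at h3
    refine h3.trans (le_of_eq ?_)
    field_simp
  have hi : Integrable (fun ω => (2 * ε)⁻¹ * f ω ^ 2) μ := hf.integrable_sq.const_mul _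
  have h2 := integral_mono (hf.integrable one_le_two).abs (hi.add (integrable_const (ε / 2)))
    fun ω => h1 ω
  have h3 : ∫ ω, ((2 * ε)⁻¹ * f ω ^ 2 + ε / 2) ∂μ = (2 * ε)⁻¹ * ∫ ω, f ω ^ 2 ∂μ + ε / 2 := by
    rw [integral_add hi (integrable_const _), integral_const_mul]
    simp
  have h4 : (2 * ε)⁻¹ * ∫ ω, f ω ^ 2 ∂μ ≤ (2 * ε)⁻¹ * ε ^ 2 :=
    mul_le_mul_of_nonneg_left h (by positivity)
  have h5 : (2 * ε)⁻¹ * ε ^ 2 = ε / 2 := by field_simp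
  change _ ≤ ∫ ω, ((2 * ε)⁻¹ * f ω ^ 2 + ε / 2) ∂μ at h2
  rw [h3] at h2
  linarith

theorem integral_sq_add_le {Ω : Type*} [MeasurableSpace Ω] {μ : Measure Ω} {f g : Ω → ℝ}
    (hf : MemLp f 2 μ) (hg : MemLp g 2 μ) :
    ∫ ω, (f ω + g ω) ^ 2 ∂μ ≤ 2 * ∫ ω, f ω ^ 2 ∂μ + 2 * ∫ ω, g ω ^ 2 ∂μ := by
  rw [← integral_const_mul, ← integral_const_mul,
    ← integral_add (hf.integrable_sq.const_mul 2) (hg.integrable_sq.const_mul 2)]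
  exact integral_mono (hf.add hg).integrable_sq
    ((hf.integrable_sq.const_mul 2).add (hg.integrable_sq.const_mul 2)) fun ω => by
      nlinarith [sq_nonneg (f ω - g ω)]

theorem IsBoundedKernel.memLp_sum_pairIdx {K : ℝ → ℝ → ℝ} {C : ℝ} (hK : IsBoundedKernel K C)
    (P : ProbabilityMeasure ℝ) (n : ℕ) :
    MemLp (fun ω : ℕ → ℝ => ∑ p ∈ pairIdx n, K (ω p.1) (ω p.2)) 2 (sampleLaw P) :=
  memLp_finsetSum _ fun p _ => MemLp.of_bound (hK.measurable_eval p.1 p.2).aestronglyMeasurable C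
    (.of_forall fun _ => hK.bound _ _)

theorem IsBoundedKernel₃.memLp_sum_tripleIdx {h : ℝ → ℝ → ℝ → ℝ} {C : ℝ}
    (hh : IsBoundedKernel₃ h C) (P : ProbabilityMeasure ℝ) (n : ℕ) :
    MemLp (fun ω : ℕ → ℝ => ∑ t ∈ tripleIdx n, h (ω t.2.2) (ω t.2.1) (ω t.1)) 2 (sampleLaw P) :=
  memLp_finsetSum _ fun t _ => MemLp.of_bound
    (hh.measurable_eval t.2.2 t.2.1 t.1).aestronglyMeasurable C (.of_forall fun _ => hh.bound _ _ _)

theorem isBoundedKernel_mul {f g : ℝ → ℝ} (hf : Measurable f) (hg : Measurable g) {A B : ℝ}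
    (hA : ∀ x, |f x| ≤ A) (hB : ∀ x, |g x| ≤ B) : IsBoundedKernel (fun x y => f x * g y) (A * B) where
  measurable := (hf.comp measurable_fst).mul (hg.comp measurable_snd)
  bound x y := by
    rw [abs_mul]
    exact mul_le_mul (hA x) (hB y) (abs_nonneg _) ((abs_nonneg _).trans (hA 0))

theorem IsBoundedKernel.sum {ι : Type*} {K : ι → ℝ → ℝ → ℝ} {C : ι → ℝ} (s : Finset ι)
    (hK : ∀ i, IsBoundedKernel (K i) (C i)) :
    IsBoundedKernel (fun x y => ∑ i ∈ s, K i x y) (∑ i ∈ s, C i) where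
  measurable := by
    have := Finset.measurable_fun_sum s (f := fun i => Function.uncurry (K i))
      fun i _ => (hK i).measurable
    exact this
  bound x y := (Finset.abs_sum_le_sum_abs _ _).trans (Finset.sum_le_sum fun i _ => (hK i).bound x y)

section Null

variable {P : ProbabilityMeasure ℝ}

/-- By Fubini, `ν i ∫ e i = ∬ K x y e i(y) = 0` since `K` integrates to zero in each variable, and
`ν i ≠ 0`. -/
theorem IsEigenExpansion.integral_eq_zero {ι : Type} {μ : Measure ℝ} [IsProbabilityMeasure μ]
    {K : ℝ → ℝ → ℝ} {C : ℝ} {ν : ι → ℝ} {e : ι → ℝ → ℝ} (he : IsEigenExpansion K μ ν e)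
    (hK : IsBoundedKernel K C) (hs : ∀ x y, K x y = K y x) (h0 : ∀ x, ∫ y, K x y ∂μ = 0) (i : ι) :
    ∫ x, e i x ∂μ = 0 := by
  obtain ⟨B, hB⟩ := he.bounded i
  have hint : Integrable (Function.uncurry fun x y => K x y * e i y) (μ.prod μ) :=
    Integrable.of_bound (hK.measurable.mul
      ((he.measurable i).comp measurable_snd)).aestronglyMeasurable (C * B)
      (.of_forall fun p => by
        simp only [Function.uncurry, norm_mul]
        exact mul_le_mul (hK.bound _ _) (hB _) (norm_nonneg _) ((abs_nonneg _).trans (hK.bound 0 0)))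
  have h1 := integral_integral_swap hint
  simp only [he.eigen, integral_const_mul, integral_mul_const] at h1
  have h2 : ∀ y, ∫ x, K x y ∂μ = 0 := fun y =>
    (integral_congr_ae (.of_forall fun x => hs x y)).trans (h0 y)
  simp only [h2, zero_mul, integral_zero] at h1
  exact (mul_eq_zero.1 h1).resolve_left (he.ne_zero i)

theorem IsEigenExpansion.isBoundedKernel_residual {ι : Type} {μ : Measure ℝ}
    {K : ℝ → ℝ → ℝ} {C : ℝ} {ν : ι → ℝ} {e : ι → ℝ → ℝ} (he : IsEigenExpansion K μ ν e)
    (hK : IsBoundedKernel K C) (s : Finset ι) :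
    ∃ C', IsBoundedKernel (fun x y => K x y - ∑ i ∈ s, ν i * e i x * e i y) C' := by
  choose B hB using he.bounded
  exact ⟨_, hK.sub (IsBoundedKernel.sum s fun i => isBoundedKernel_mul
    ((he.measurable i).const_mul (ν i)) (he.measurable i) (A := |ν i| * B i) (fun x => by
      rw [abs_mul]; exact mul_le_mul_of_nonneg_left (hB i x) (abs_nonneg _)) (hB i))⟩

/-- The truncated kernel inherits symmetry and degeneracy, so the second moment bound for pairs
applies. The constant comes from `(6/(n-1))² · n(n-1)/2 = 18 n/(n-1) ≤ 36`. -/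
theorem integral_sq_residual_le {ι : Type} {C : ℝ} {K : ℝ → ℝ → ℝ} {ν : ι → ℝ}
    {e : ι → ℝ → ℝ} (he : IsEigenExpansion K (P : Measure ℝ) ν e) (hK : IsBoundedKernel K C)
    (hs : ∀ x y, K x y = K y x) (h0 : ∀ x, ∫ y, K x y ∂(P : Measure ℝ) = 0) (s : Finset ι) {n : ℕ}
    (hn : 2 ≤ n) :
    ∫ ω, (6 / ((n : ℝ) - 1) * ∑ p ∈ pairIdx n,
        (K (ω p.1) (ω p.2) - ∑ i ∈ s, ν i * e i (ω p.1) * e i (ω p.2))) ^ 2 ∂(sampleLaw P)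
      ≤ 36 * ∫ x, ∫ y, (K x y - ∑ i ∈ s, ν i * e i x * e i y) ^ 2 ∂(P : Measure ℝ)
        ∂(P : Measure ℝ) := by
  obtain ⟨C', hR⟩ := he.isBoundedKernel_residual hK s
  have hE := he.integral_eq_zero hK hs h0
  have h1 := hR.integral_sq_sum_le_of_degenerate P (fun x y => by
    rw [hs x y]
    congr 1
    exact Finset.sum_congr rfl fun i _ => by ring) (fun x => by
      choose B hB using he.bounded
      have hei : ∀ i ∈ s, Integrable (fun y => ν i * e i x * e i y) (P : Measure ℝ) := fun i _ =>
        (Integrable.of_bound (he.measurable i).aestronglyMeasurable (B i)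
          (.of_forall fun y => hB i y)).const_mul _
      have hKi : Integrable (fun y => K x y) (P : Measure ℝ) :=
        Integrable.of_bound (hK.measurable.comp measurable_prodMk_left).aestronglyMeasurable C
          (.of_forall fun y => hK.bound x y)
      rw [integral_sub hKi (integrable_finsetSum _ hei), h0, integral_finsetSum _ hei]
      simp [integral_const_mul, hE]) n
  set I := ∫ x, ∫ y, (K x y - ∑ i ∈ s, ν i * e i x * e i y) ^ 2 ∂(P : Measure ℝ) ∂(P : Measure ℝ)
  have hI : 0 ≤ I := integral_nonneg fun x => integral_nonneg fun y => sq_nonneg _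
  simp_rw [mul_pow]
  rw [integral_const_mul]
  have hn' : (2 : ℝ) ≤ n := by exact_mod_cast hn
  refine (mul_le_mul_of_nonneg_left h1 (by positivity)).trans ?_
  rw [← mul_assoc]
  refine mul_le_mul_of_nonneg_right ?_ hI
  rw [Nat.cast_choose_two, div_pow, div_mul_eq_mul_div, div_le_iff₀ (by nlinarith)]
  nlinarith

/-- The difference is `n / n.choose 3` times the sum of the completely degenerate kernel, whose
second moment is at most `16 · n.choose 3`. With `n³/27 ≤ n.choose 3` this gives `16 · 27 = 432`. -/
theorem integral_sq_remainder_le [NullSingletonClass (P : Measure ℝ)]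
    (hsym : ∀ x, 1 - cdf (P : Measure ℝ) x - cdf (P : Measure ℝ) (-x) = 0) {n : ℕ} (hn : 3 ≤ n) :
    ∫ ω, ((n : ℝ) * evalStat statJ n ω - 6 / ((n : ℝ) - 1) *
        ∑ p ∈ pairIdx n, phi (cdf (P : Measure ℝ)) (ω p.1) (ω p.2)) ^ 2 ∂(sampleLaw P)
      ≤ (432 : ℝ) / n := by
  have hn' : (3 : ℝ) ≤ n := by exact_mod_cast hn
  have hc := cube_le_choose_three hn
  have hc' := cast_choose_three n
  have hcpos : (0 : ℝ) < (n.choose 3 : ℕ) := by exact_mod_cast Nat.choose_pos hn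
  have h1 : ∀ ω : ℕ → ℝ, n * evalStat statJ n ω - 6 / ((n : ℝ) - 1) *
        ∑ p ∈ pairIdx n, phi (cdf (P : Measure ℝ)) (ω p.1) (ω p.2)
      = n / (n.choose 3 : ℕ) * ∑ t ∈ tripleIdx n,
        degKernel (cdf (P : Measure ℝ)) (ω t.2.2) (ω t.2.1) (ω t.1) := by
    intro ω
    rw [statJ_eq_sum_tripleIdx, sum_symKernel_eq (cdf (P : Measure ℝ))]
    have h2 : n * ((n.choose 3 : ℕ) : ℝ)⁻¹ * ((n : ℝ) - 2) = 6 / ((n : ℝ) - 1) := by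
      have a1 : (n : ℝ) ≠ 0 := by linarith
      have a2 : (n : ℝ) - 1 ≠ 0 := by linarith
      have a3 : (n : ℝ) - 2 ≠ 0 := by linarith
      rw [hc']
      field_simp
    rw [← h2]
    ring
  simp_rw [h1, mul_pow]
  rw [integral_const_mul]
  refine (mul_le_mul_of_nonneg_left (integral_sq_sum_degKernel_le hsym n) (by positivity)).trans ?_
  rw [div_pow, div_mul_eq_mul_div, div_le_div_iff₀ (by positivity) (by positivity)]
  nlinarith [mul_le_mul_of_nonneg_left hc hcpos.le]

/-- Limit law of the degenerate U-statistic `J_n` under a symmetric null law. -/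
theorem tendstoInDistribution_mul_statJ [NullSingletonClass (P : Measure ℝ)]
    (hsym : ∀ x, 1 - cdf (P : Measure ℝ) x - cdf (P : Measure ℝ) (-x) = 0)
    {ι : Type} {ν : ι → ℝ} {e : ι → ℝ → ℝ}
    (he : IsEigenExpansion (phi (cdf (P : Measure ℝ))) (P : Measure ℝ) ν e)
    {Y : (ι → ℝ) → ℝ} (hYm : Measurable Y) (hY : MemLp Y 2 (gaussianSeq ι))
    (hlim : ∀ ε > 0, ∃ s₀ : Finset ι, ∀ s, s₀ ⊆ s →
      ∫ z, (centeredChiSq (fun i => 3 * ν i) s z - Y z) ^ 2 ∂gaussianSeq ι ≤ ε) :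
    TendstoInDistribution (fun (n : ℕ) ω => n * evalStat statJ n ω) atTop Y
      (fun _ => sampleLaw P) (gaussianSeq ι) := by
  classical
  have hK := isBoundedKernel_phi (P := P)
  have hs := phi_comm (cdf (P : Measure ℝ))
  have h0 := integral_phi (map_neg_eq_of_cdf_symmetric hsym) (cdf (P : Measure ℝ))
  have hX : ∀ n : ℕ, MemLp (fun ω => n * evalStat statJ n ω) 2 (sampleLaw P) := by
    intro n
    simp_rw [statJ_eq_sum_tripleIdx]
    exact ((isBoundedKernel₃_symKernel.memLp_sum_tripleIdx P n).const_mul _).const_mul _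
  refine tendstoInDistribution_of_forall_approx
    (fun n => (hX n).aestronglyMeasurable.aemeasurable) hYm.aemeasurable fun ε hε => ?_
  -- The truncation error contributes `2 · 36 · ε²/144 = ε²/2` to the second moment. The degenerate
  -- remainder contributes `2 · 432/n ≤ ε²/2` once `n ≥ 1728/ε²`.
  obtain ⟨s₁, hs₁⟩ := he.approx (ε ^ 2 / 144) (by positivity)
  obtain ⟨s₂, hs₂⟩ := hlim (ε ^ 2) (by positivity)
  set s := s₁ ∪ s₂
  have hs1 := hs₁ s Finset.subset_union_left
  have hs2 := hs₂ s Finset.subset_union_right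
  obtain ⟨C', hR⟩ := he.isBoundedKernel_residual hK s
  have hD : ∀ n : ℕ, MemLp (fun ω : ℕ → ℝ => n * evalStat statJ n ω - 6 / ((n : ℝ) - 1) *
      ∑ p ∈ pairIdx n, phi (cdf (P : Measure ℝ)) (ω p.1) (ω p.2)) 2 (sampleLaw P) := fun n =>
    (hX n).sub ((hK.memLp_sum_pairIdx P n).const_mul _)
  have hB : ∀ n : ℕ, MemLp (fun ω : ℕ → ℝ => 6 / ((n : ℝ) - 1) * ∑ p ∈ pairIdx n,
      (phi (cdf (P : Measure ℝ)) (ω p.1) (ω p.2) - ∑ i ∈ s, ν i * e i (ω p.1) * e i (ω p.2))) 2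
      (sampleLaw P) := fun n => (hR.memLp_sum_pairIdx P n).const_mul _
  have hsplit : ∀ (n : ℕ) (ω : ℕ → ℝ), n * evalStat statJ n ω -
      6 / ((n : ℝ) - 1) * ∑ p ∈ pairIdx n, ∑ i ∈ s, ν i * e i (ω p.1) * e i (ω p.2)
      = (n * evalStat statJ n ω - 6 / ((n : ℝ) - 1) *
        ∑ p ∈ pairIdx n, phi (cdf (P : Measure ℝ)) (ω p.1) (ω p.2))
      + 6 / ((n : ℝ) - 1) * ∑ p ∈ pairIdx n,
      (phi (cdf (P : Measure ℝ)) (ω p.1) (ω p.2) - ∑ i ∈ s, ν i * e i (ω p.1) * e i (ω p.2)) := by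
    intro n ω
    rw [Finset.sum_sub_distrib]
    ring
  refine ⟨_, _, tendstoInDistribution_quadratic P s ν he.measurable he.bounded
    (he.integral_eq_zero hK hs h0) he.norm_one he.orthogonal, fun n => ?_, ?_, ?_, ?_⟩
  · simp_rw [hsplit]
    exact ((hD n).add (hB n)).integrable one_le_two
  · filter_upwards [eventually_ge_atTop 3, eventually_ge_atTop ⌈1728 / ε ^ 2⌉₊] with n hn hnε
    simp_rw [hsplit]
    refine integral_abs_le_of_integral_sq_le ((hD n).add (hB n)) hε
      ((integral_sq_add_le (hD n) (hB n)).trans ?_)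
    have h1 := integral_sq_remainder_le hsym hn
    have h2 := integral_sq_residual_le he hK hs h0 s (by omega : 2 ≤ n)
    have hn0 : (0 : ℝ) < n := by exact_mod_cast (by omega : 0 < n)
    have h3 : 432 / (n : ℝ) ≤ ε ^ 2 / 4 := by
      have := (Nat.le_ceil _).trans (Nat.cast_le (α := ℝ).2 hnε)
      rw [div_le_iff₀ (by positivity)] at this
      rw [div_le_div_iff₀ hn0 (by norm_num)]
      linarith
    linarith
  · exact ((memLp_centeredChiSq (fun i => 3 * ν i) s).sub hY).integrable one_le_two
  · exact integral_abs_le_of_integral_sq_le ((memLp_centeredChiSq (fun i => 3 * ν i) s).sub hY) hε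
      hs2

end Null

theorem tendstoInDistribution_id_map {Ω : ℕ → Type*} {Ω' : Type*} [∀ n, MeasurableSpace (Ω n)]
    [MeasurableSpace Ω'] {μ : ∀ n, Measure (Ω n)} [∀ n, IsProbabilityMeasure (μ n)]
    {μ' : Measure Ω'} [IsProbabilityMeasure μ'] {X : ∀ n, Ω n → ℝ} {Y : Ω' → ℝ}
    (h : TendstoInDistribution X atTop Y μ μ') {Q : Measure ℝ} [IsProbabilityMeasure Q]
    (hQ : Q = μ'.map Y) : TendstoInDistribution X atTop (id : ℝ → ℝ) μ Q := by
  refine ⟨h.forall_aemeasurable, aemeasurable_id, ?_⟩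
  have hlaw : (⟨Q.map id, Measure.isProbabilityMeasure_map aemeasurable_id⟩ : ProbabilityMeasure ℝ)
      = ⟨μ'.map Y, Measure.isProbabilityMeasure_map h.aemeasurable_limit⟩ :=
    Subtype.ext (Measure.map_id.trans hQ)
  have ht := h.tendsto
  rw [← hlaw] at ht
  exact ht

/-- The null law of `√(n |J_n|)` converges to a law whose logarithmic tail is governed by the
largest eigenvalue of the kernel `phi`. -/
theorem exists_isGreatest_tendstoInDistribution_statJTilde (P : ProbabilityMeasure ℝ)
    [NullSingletonClass (P : Measure ℝ)]
    (hsym : ∀ x, 1 - cdf (P : Measure ℝ) x - cdf (P : Measure ℝ) (-x) = 0) :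
    ∃ r, IsGreatest (integralOpEigenvalues (phi (cdf (P : Measure ℝ))) (P : Measure ℝ)) r ∧ 0 < r ∧
      ∃ Q : ProbabilityMeasure ℝ,
        TendstoInDistribution (evalStat statJTilde) atTop (id : ℝ → ℝ) (fun _ => sampleLaw P)
          (Q : Measure ℝ) ∧
        (∀ z : ℝ, (Q : Measure ℝ) ≠ Measure.dirac z) ∧
        (fun t : ℝ => Real.log (1 - cdf (Q : Measure ℝ) t)) ~[atTop]
          fun t : ℝ => -(1 / (3 * r) * t ^ 2 / 2) := by
  have hK := isBoundedKernel_phi (P := P)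
  have hs := phi_comm (cdf (P : Measure ℝ))
  have hc : ∀ y, Continuous fun x => phi (cdf (P : Measure ℝ)) x y := fun y =>
    continuous_phi.comp (f := fun x => (x, y)) (by fun_prop)
  obtain ⟨r, hr, hgr, hmax⟩ := hK.isGreatest_integralOpEigenvalues_norm (P : Measure ℝ) hs hc
    (integral_phi_sq_pos hsym) (σ := fun x => if x < 0 then -1 else 1)
    (Measurable.ite measurableSet_Iio measurable_const measurable_const)
    (fun x => by split_ifs <;> simp) fun x y => abs_phi_le (monotone_cdf _) x y
  obtain ⟨ι, _, ν, e, he⟩ := hK.exists_isEigenExpansion (P : Measure ℝ) hs hc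
  obtain ⟨i₀, hi₀⟩ := he.complete r hgr.1 hr.ne'
  have ha : Summable fun i => (3 * ν i) ^ 2 := by
    simp_rw [mul_pow]
    exact he.summable_sq.mul_left _
  obtain ⟨Y, hYm, hY, hlim⟩ := exists_limit_centeredChiSq ha
  have hpos : 0 < 3 * ν i₀ := by rw [hi₀]; positivity
  -- Negative eigenvalues are dominated as well, so the lower tail of `Y`, which enters through
  -- `|Y|`, does not spoil the rate.
  have hM : ∀ i, |3 * ν i| ≤ 3 * ν i₀ := fun i => by
    rw [abs_mul, abs_of_pos (by norm_num : (0 : ℝ) < 3), hi₀]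
    exact mul_le_mul_of_nonneg_left (hmax _ (he.mem_eigenvalues i)) (by norm_num)
  have hZm : Measurable fun z => √|Y z| :=
    (Real.continuous_sqrt.comp continuous_abs).measurable.comp hYm
  have hX := tendstoInDistribution_mul_statJ hsym he hYm hY hlim
  have hX' := hX.continuous_comp (g := fun x => √|x|) (Real.continuous_sqrt.comp continuous_abs)
  have hfun : (fun n : ℕ => (fun x => √|x|) ∘ fun ω => n * evalStat statJ n ω)
      = evalStat statJTilde := by
    funext n ω
    simp [evalStat, statJTilde, abs_mul]
  rw [hfun] at hX'
  let Q : ProbabilityMeasure ℝ := ⟨(gaussianSeq ι).map fun z => √|Y z|,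
    Measure.isProbabilityMeasure_map hZm.aemeasurable⟩
  have htail : ∀ t, 1 - cdf (Q : Measure ℝ) t = (gaussianSeq ι).real {z | t < √|Y z|} := by
    intro t
    rw [cdf_eq_real, ← probReal_compl_eq_one_sub measurableSet_Iic, Set.compl_Iic]
    exact map_measureReal_apply hZm measurableSet_Ioi
  refine ⟨r, hgr, hr, Q, tendstoInDistribution_id_map hX' rfl, fun z hz => ?_, ?_⟩
  -- The limit law charges every half-line `(t, ∞)`, whereas a point mass at `z` gives no mass
  -- beyond `|z|`.
  · obtain ⟨d, k, hd, -, hlow⟩ := exists_le_measureReal_sqrt_abs_limit ha hY hlim hpos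
    have h1 := hlow |z| (abs_nonneg z)
    rw [← htail, hz, cdf_eq_real] at h1
    have h2 : (Measure.dirac z).real (Set.Iic |z|) = 1 := by
      simp [Measure.real, le_abs_self]
    rw [h2, sub_self] at h1
    have : 0 < d * Real.exp (-(|z| / √(3 * ν i₀) + k) ^ 2 / 2) := by positivity
    linarith
  · simp_rw [htail]
    refine (isEquivalent_log_measureReal_sqrt_abs_limit ha hY hlim hpos hM).congr_right
      (.of_forall fun t => ?_)
    simp only [hi₀]
    field_simp

/-! ### Behaviour under alternatives and the Bahadur slope -/

theorem abs_sqrt_sub_sqrt_sq_le {x y : ℝ} (hx : 0 ≤ x) (hy : 0 ≤ y) :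
    (√x - √y) ^ 2 ≤ |x - y| := by
  have h1 := Real.sq_sqrt hx
  have h2 := Real.sq_sqrt hy
  have h3 := Real.sqrt_nonneg x
  have h4 := Real.sqrt_nonneg y
  rcases le_total (√x) (√y) with h | h
  · refine le_trans ?_ (neg_le_abs _)
    nlinarith
  · refine le_trans ?_ (le_abs_self _)
    nlinarith

theorem tendstoInMeasure_statJ (P : ProbabilityMeasure ℝ) :
    TendstoInMeasure (sampleLaw P) (evalStat statJ) atTop
      fun _ => ∫ x, ∫ y, ∫ z, symKernel ![x, y, z] ∂(P : Measure ℝ) ∂(P : Measure ℝ)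
        ∂(P : Measure ℝ) := by
  have h := isBoundedKernel₃_symKernel.tendstoInMeasure_average P
  have hfun : evalStat statJ = fun n ω => ((n.choose 3 : ℕ) : ℝ)⁻¹ *
      ∑ t ∈ tripleIdx n, symKernel ![ω t.2.2, ω t.2.1, ω t.1] := by
    funext n ω
    exact statJ_eq_sum_tripleIdx n ω
  rw [hfun]
  exact h

theorem tendstoInMeasure_statJTilde_div_sqrt {P : ProbabilityMeasure ℝ} {b : ℝ}
    (h : TendstoInMeasure (sampleLaw P) (evalStat statJ) atTop fun _ => b) :
    TendstoInMeasure (sampleLaw P) (fun (n : ℕ) ω => evalStat statJTilde n ω / √n) atTop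
      fun _ => √|b| := by
  have h1 : TendstoInMeasure (sampleLaw P) (fun n ω => √|evalStat statJ n ω|) atTop
      fun _ => √|b| := by
    rw [tendstoInMeasure_iff_norm] at h ⊢
    intro ε hε
    refine tendsto_of_tendsto_of_tendsto_of_le_of_le tendsto_const_nhds (h (ε ^ 2) (by positivity))
      (fun n => zero_le) fun n => measure_mono fun ω hω => ?_
    simp only [Set.mem_ofPred_eq, Real.norm_eq_abs] at hω ⊢
    have h2 := pow_le_pow_left₀ hε.le hω 2
    rw [sq_abs] at h2
    exact h2.trans ((abs_sqrt_sub_sqrt_sq_le (abs_nonneg _) (abs_nonneg _)).trans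
      (abs_abs_sub_abs_le_abs_sub _ _))
  refine h1.congr' ?_ .rfl
  filter_upwards [eventually_gt_atTop 0] with n hn
  refine .of_forall fun ω => ?_
  have hn' : √(n : ℝ) ≠ 0 := (Real.sqrt_pos.2 (by exact_mod_cast hn)).ne'
  change √|statJ n _| = √(n * |statJ n _|) / √n
  rw [Real.sqrt_mul (Nat.cast_nonneg n), mul_div_cancel_left₀ _ hn']

theorem eq_of_isEquivalent_neg_mul_sq {a a' : ℝ} (ha' : 0 < a')
    (h : (fun t : ℝ => -(a * t ^ 2 / 2)) ~[atTop] fun t : ℝ => -(a' * t ^ 2 / 2)) : a = a' := by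
  have hne : ∀ᶠ t : ℝ in atTop, -(a' * t ^ 2 / 2) ≠ 0 := by
    filter_upwards [eventually_gt_atTop 0] with t ht
    exact neg_ne_zero.2 (by positivity)
  have h1 := (isEquivalent_iff_tendsto_one hne).1 h
  have h2 : Tendsto (fun _ : ℝ => a / a') atTop (𝓝 1) := by
    refine h1.congr' ?_
    filter_upwards [eventually_gt_atTop 0] with t ht
    simp only [Pi.div_apply]
    field_simp
  exact (div_eq_one_iff_eq ha'.ne').1 (tendsto_nhds_unique tendsto_const_nhds h2)

/-- The approximate Bahadur slope is determined by the limits in its definition. -/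
theorem isApproxBahadurSlope_iff {T : (n : ℕ) → (Fin n → ℝ) → ℝ} {P₀ P₁ : ProbabilityMeasure ℝ}
    {Q : ProbabilityMeasure ℝ} {a b : ℝ}
    (hT : TendstoInDistribution (evalStat T) atTop (id : ℝ → ℝ) (fun _ => sampleLaw P₀)
      (Q : Measure ℝ))
    (hQ : ∀ z : ℝ, (Q : Measure ℝ) ≠ Measure.dirac z) (ha : 0 < a)
    (hlog : (fun t : ℝ => Real.log (1 - cdf (Q : Measure ℝ) t)) ~[atTop]
      fun t : ℝ => -(a * t ^ 2 / 2))
    (hb : TendstoInMeasure (sampleLaw P₁) (fun (n : ℕ) ω => evalStat T n ω / √n) atTop fun _ => b)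
    (c : ℝ) : IsApproxBahadurSlope T P₀ P₁ c ↔ 0 < b ∧ c = a * b ^ 2 := by
  constructor
  · rintro ⟨Q', a', b', hT', -, ha', hlog', hb', hbpos', rfl⟩
    have hQQ : (Q' : Measure ℝ) = Q := by
      have := tendstoInDistribution_unique _ hT' hT
      simpa using this
    rw [hQQ] at hlog'
    have haa : a' = a := eq_of_isEquivalent_neg_mul_sq ha (hlog'.symm.trans hlog)
    obtain ⟨ω, hω⟩ := (tendstoInMeasure_ae_unique hb' hb).exists
    have hbb : b' = b := hω
    rw [← haa, ← hbb]
    exact ⟨hbpos', rfl⟩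
  · rintro ⟨hbpos, rfl⟩
    exact ⟨Q, a, b, hT, hQ, ha, hlog, hb, hbpos, rfl⟩

namespace AlternativeFamily

variable (𝒢 : AlternativeFamily)

instance (θ : 𝒢.Θ) : NullSingletonClass (𝒢.law θ : Measure ℝ) :=
  inferInstanceAs (NullSingletonClass (volume.withDensity fun y => ENNReal.ofReal (𝒢.g y θ)))

theorem cdf_null_symmetric (x : ℝ) :
    1 - cdf (𝒢.law 𝒢.null : Measure ℝ) x - cdf (𝒢.law 𝒢.null : Measure ℝ) (-x) = 0 :=
  (𝒢.symmetric_iff 𝒢.null).2 rfl x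

end AlternativeFamily

theorem lemma1 (𝒢 : AlternativeFamily) :
    ∃ ν₁ : ℝ,
      IsGreatest (integralOpEigenvalues (phi 𝒢.nullCdf) (𝒢.law 𝒢.null : Measure ℝ)) ν₁ ∧
      0 < ν₁ ∧
      ∃ bJ : 𝒢.Θ → ℝ,
        (∀ θ : 𝒢.Θ, θ ≠ 𝒢.null →
          TendstoInMeasure (sampleLaw (𝒢.law θ)) (evalStat statJ) atTop (fun _ => bJ θ)) ∧
        (∀ θ : 𝒢.Θ, θ ≠ 𝒢.null → bJ θ ≠ 0 →
          ∀ c : ℝ, IsApproxBahadurSlope statJTilde (𝒢.law 𝒢.null) (𝒢.law θ) c ↔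
            c = |bJ θ| / (3 * ν₁)) ∧
        (∀ c : 𝒢.Θ → ℝ,
          (∀ᶠ θ in 𝓝[≠] 𝒢.null,
            IsApproxBahadurSlope statJTilde (𝒢.law 𝒢.null) (𝒢.law θ) (c θ)) →
          c ~[𝓝[≠] 𝒢.null] fun θ => |bJ θ| / (3 * ν₁)) := by
  obtain ⟨r, hgr, hr, Q, hT, hQ, hlog⟩ :=
    exists_isGreatest_tendstoInDistribution_statJTilde (𝒢.law 𝒢.null) 𝒢.cdf_null_symmetric
  have key := fun (θ : 𝒢.Θ) (c : ℝ) => isApproxBahadurSlope_iff hT hQ (by positivity) hlog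
    (tendstoInMeasure_statJTilde_div_sqrt (tendstoInMeasure_statJ (𝒢.law θ))) c
  have hval : ∀ b : ℝ, 1 / (3 * r) * √|b| ^ 2 = |b| / (3 * r) := fun b => by
    rw [Real.sq_sqrt (abs_nonneg b)]
    ring
  simp_rw [hval] at key
  refine ⟨r, hgr, hr, _, fun θ _ => tendstoInMeasure_statJ (𝒢.law θ), fun θ _ hθ c => ?_,
    fun c hc => ?_⟩
  · rw [key]
    exact and_iff_right (Real.sqrt_pos.2 (abs_pos.2 hθ))
  -- Wherever the slope exists it equals the formula exactly, so the asymptotic equivalence is an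
  -- eventual equality.
  · refine EventuallyEq.isEquivalent ?_
    filter_upwards [hc] with θ hθ
    exact ((key θ _).1 hθ).2
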